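/- Let $d\ge 2$ and let $p,q\in(1,\infty]$ satisfy $$\Bigl(1-\frac1d\Bigr)\frac1p+\frac1q\le\frac1d,\qquad \frac1{p-1}+\frac1q<\frac2d .$$ Then there is a function $C:[0,\infty)\to(0,\infty)$, depending only on $d,p,q$, with the following property. Let $(\tau_x)_{x\in\mathbb Z^d}$ be a measurable, measure-preserving and ergodic action of the group $\mathbb Z^d$ on a probability space $(\Omega,\mathcal F,\mathbb P)$. Let $C_{x,y}$, $x,y\in\mathbb Z^d$, be non-negative random variables with $C_{x,y}(\omega)=C_{y,x}(\omega)$ and $C_{x+z,y+z}(\omega)=C_{x,y}(\tau_z\omega)$ for all $x,y,z,\omega$, such that almost surely $0<\sum_y C_{x,y}<\infty$ for all $x$. With $|\cdot|$ the Euclidean norm, assume that $$\tilde\mu(\omega):=\sum_{z\in\mathbb Z^d}|z|^2C_{0,z}(\omega)\in L^p(\Omega;\mathbb P),\qquad \tilde\nu(\omega):=\sum_{|z|=1}\frac1{C_{0,z}(\omega)}\in L^q(\Omega;\mathbb P).$$ Write $B_R=\{x\in\mathbb Z^d:|x|\le R\}$, $\mu(x,\omega)=\tilde\mu(\tau_x\omega)$,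 $\nu(x,\omega)=\tilde\nu(\tau_x\omega)$, $\|f\|_{s,A}=\bigl(|A|^{-1}\sum_{x\in A}|f(x)|^s\bigr)^{1/s}$ for finite $A$ and $s<\infty$ (and $\|f\|_{\infty,A}=\sup_A|f|$), and $$M_0(\omega)=\sup_{k\in\mathbb N,\,k\ge1}\|\max\{\mu(\cdot,\omega),1\}\|_{p,B_k}\,\|\max\{\nu(\cdot,\omega),1\}\|_{q,B_k}.$$ Then for almost every $\omega$ one has $M_0(\omega)<\infty$ and the following holds. Let $R\ge2$ and let $u:\mathbb R\times\mathbb Z^d\to\mathbb R$ be non-negative on $[-2R^2,2R^2]\times B_R$ and satisfy there $$\partial_tu(t,x)=\mathcal L^\omega u(t,\cdot)(x):=\sum_{y\in\mathbb Z^d}\bigl(u(t,y)-u(t,x)\bigr)C_{x,y}(\omega),$$ the series being absolutely convergent. Put $u_-=\max\{-u,0\}$ and $$\mathrm{Tail}(u_-(t,\cdot),R)(x)=R^2\sum_{y\in\mathbb Z^d\setminus B_R}u_-(t,y)\,C_{x,y}(\omega).$$ Then for all real $2\le r<R/4$ and $t_0$ with $[t_0-4r^2,t_0+4r^2]\subset[-R^2,R^2]$,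 $$\frac1{r^2|B_r|}\int_{t_0-2r^2}^{t_0-r^2}\sum_{x\in B_r}u(t,x)\,dt\le C(M_0(\omega))\inf_{[t_0+r^2,t_0+2r^2]\times B_r}u+C(M_0(\omega))\Bigl(\frac rR\Bigr)^2\sup_{t\in[t_0-4r^2,t_0+4r^2]}\bigl\|\mathrm{Tail}(u_-(t,\cdot),R)\bigr\|_{p,B_{2r}},$$ where the right-hand side may be $+\infty$. -/

import Mathlib

open MeasureTheory Set
open scoped ENNReal NNReal

noncomputable section

namespace LRRW

/-- The lattice `ℤ^d`. -/
abbrev Site (d : ℕ) : Type := Fin d → ℤ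

/-- The standard Euclidean norm `|x|` of a lattice point. -/
def euclid {d : ℕ} (x : Site d) : ℝ :=
  ‖WithLp.toLp 2 (fun i => (x i : ℝ))‖

theorem finite_ball {d : ℕ} (R : ℝ) : {x : Site d | euclid x ≤ R}.Finite := by
  refine (Set.finite_Icc (fun _ : Fin d => -⌈R⌉) (fun _ => ⌈R⌉)).subset ?_
  intro x hx
  have hx' : euclid x ≤ R := hx
  have key : ∀ i, |(x i : ℝ)| ≤ R := fun i => by
    have h := PiLp.norm_apply_le (WithLp.toLp 2 (fun i => (x i : ℝ)) : EuclideanSpace ℝ (Fin d)) i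
    rw [Real.norm_eq_abs] at h
    exact h.trans hx'
  constructor
  · intro i
    have h := (abs_le.mp (key i)).1
    have h2 := Int.le_ceil R
    have h3 : ((-⌈R⌉ : ℤ) : ℝ) ≤ (x i : ℝ) := by push_cast; linarith
    exact_mod_cast h3
  · intro i
    have h := (abs_le.mp (key i)).2
    have h2 := Int.le_ceil R
    have h3 : (x i : ℝ) ≤ ((⌈R⌉ : ℤ) : ℝ) := by linarith
    exact_mod_cast h3

/-- The ball `B_R = {x ∈ ℤ^d : |x| ≤ R}`, as a finite set. -/
def ball (d : ℕ) (R : ℝ) : Finset (Site d) := (finite_ball (d := d) R).toFinset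

theorem mem_ball {d : ℕ} {R : ℝ} {x : Site d} : x ∈ ball d R ↔ euclid x ≤ R := by
  simp [ball]

/-- The normalized norm `‖f‖_{p,A}` of a nonnegative function on a finite set `A`:
`(|A|⁻¹ ∑_{x ∈ A} f(x)^p)^{1/p}` for `p < ∞`, and `sup_{x ∈ A} f(x)` for `p = ∞`. -/
def avgNorm {d : ℕ} (p : ℝ≥0∞) (A : Finset (Site d)) (f : Site d → ℝ≥0∞) : ℝ≥0∞ :=
  if p = ∞ then ⨆ x ∈ A, f x
  else ((∑ x ∈ A, f x ^ p.toReal) / (A.card : ℝ≥0∞)) ^ (1 / p.toReal)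

section Environment

variable {d : ℕ} {Ω : Type*}

/-- Random conductances: nonnegative, symmetric random variables `C x y`, covariant under the
shifts `τ_z ω = z +ᵥ ω`, with `0 < ∑_y C x y < ∞` for all `x`, almost surely. -/
structure IsRandomConductance [MeasurableSpace Ω] [AddAction (Site d) Ω] (P : Measure Ω)
    (C : Site d → Site d → Ω → ℝ) : Prop where
  measurable : ∀ x y, Measurable (C x y)
  nonneg : ∀ x y ω, 0 ≤ C x y ω
  symm : ∀ x y ω, C x y ω = C y x ω
  shift : ∀ x y z ω, C (x + z) (y + z) ω = C x y (z +ᵥ ω)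
  total : ∀ᵐ ω ∂P, ∀ x, Summable (fun y => C x y ω) ∧ 0 < ∑' y, C x y ω

/-- `μ̃(ω) = ∑_z |z|² C_{0,z}(ω)`, with values in `[0, ∞]`. -/
def muTilde (C : Site d → Site d → Ω → ℝ) (ω : Ω) : ℝ≥0∞ :=
  ∑' z : Site d, ENNReal.ofReal (euclid z ^ 2 * C 0 z ω)

/-- `ν̃(ω) = ∑_{|z| = 1} 1 / C_{0,z}(ω)`, with values in `[0, ∞]` (so `1 / 0 = ∞`). -/
def nuTilde (C : Site d → Site d → Ω → ℝ) (ω : Ω) : ℝ≥0∞ :=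
  ∑' z : {z : Site d // euclid z = 1}, (ENNReal.ofReal (C 0 z.1 ω))⁻¹

/-- `M₀(ω) = sup_{k ≥ 1} ‖max{μ,1}‖_{p,B_k} ‖max{ν,1}‖_{q,B_k}`, where `μ(x,ω) = μ̃(τ_x ω)` and
`ν(x,ω) = ν̃(τ_x ω)`. -/
def M0 [AddAction (Site d) Ω] (C : Site d → Site d → Ω → ℝ) (p q : ℝ≥0∞) (ω : Ω) : ℝ≥0∞ :=
  ⨆ (k : ℕ) (_ : 1 ≤ k),
    avgNorm p (ball d k) (fun x => max (muTilde C (x +ᵥ ω)) 1) *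
      avgNorm q (ball d k) (fun x => max (nuTilde C (x +ᵥ ω)) 1)

end Environment

section Deterministic

variable {d : ℕ}

/-- `u` solves `∂_t u = 𝓛 u` on `I × A`, where
`𝓛 f(x) = ∑_y (f(y) - f(x)) c(x,y)` and the series is required to converge. -/
def IsCaloricOn (c : Site d → Site d → ℝ) (u : ℝ → Site d → ℝ) (I : Set ℝ)
    (A : Finset (Site d)) : Prop :=
  ∀ t ∈ I, ∀ x ∈ A,
    Summable (fun y => (u t y - u t x) * c x y) ∧
      HasDerivWithinAt (fun s => u s x) (∑' y, (u t y - u t x) * c x y) I t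

/-- The tail `Tail(f₋, R)(x) = R² ∑_{y ∉ B_R} f₋(y) c(x,y)` of the negative part
`f₋ = max{-f, 0}`, with values in `[0, ∞]`. -/
def tailNeg (c : Site d → Site d → ℝ) (f : Site d → ℝ) (R : ℝ) (x : Site d) : ℝ≥0∞ :=
  ENNReal.ofReal (R ^ 2) *
    ∑' y : {y : Site d // y ∉ ball d R}, ENNReal.ofReal (max (-f y.1) 0 * c x y.1)

end Deterministic

end LRRW

end

/-! On the ball of radius 2r take the walk killed on leaving it, with time in units of r². Since u ≥
0 on B_R, dropping its values outside the smaller ball only helps, except for u₋ beyond B_R. Hence u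
is a supersolution of the killed equation up to a source equal to (r/R)² times the tail. Duhamel's
formula (`exists_avg_sub_le`) then reduces the theorem to two facts about the killed heat kernel: a
bound in L¹ in time and dual to L^p in space, which pairs with the source
(`exists_integral_dualBound_le`), and a lower bound on B_r × B_r at rescaled times in [2, 4]
(`exists_le_density`).

Upper bound. Let v ≥ 0 be a solution of average at most 1. The part of v between heights a ≤ b has
integrated energy at most b - a, however singular the initial datum. A weak Sobolev inequality,
obtained from Gagliardo–Nirenberg–Sobolev on the lattice, Cauchy–Schwarz against the resistances and
Hölder for ν, bounds the proportion of points above one dyadic height by the energy of a band and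
the proportion above a lower height. With Markov's and Young's inequalities this is a recursion for
the time integral of |{v > 2^j}|^(1 - 1/p). It closes because 1/p + 1/q < 2/d, which the second
condition on the exponents implies, and gives decay l^j with l < 1/2. This is exactly what makes the
sum with weights 2^j, and hence the dual bound, finite.

Lower bound. The same decay shows that a solution started at a point of B_r keeps half of its mass
near B_r for a short time (`exists_avg_mul_sub_le`). By the dual bound this mass cannot concentrate,
so at a suitable time v > 1/4 on a definite proportion of a ball. A Poincaré inequality and the
energy estimate for log(v + δ), in the manner of Nash and of Fabes–Stroock, spread this to most of
B_r at all times in [1, 4] (`exists_frac_lt_le`). For two starting points the good sets at half the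
time overlap, and duality turns the overlap into a pointwise bound.

The constants depend on the environment through the averages of μ^p and ν^q on a ball: μ bounds the
energy density of Lipschitz cutoffs, ν enters the Sobolev and Poincaré inequalities. Both averages
are controlled by M₀, which is finite almost surely by Wiener's maximal inequality
(`mul_measure_exists_le`). -/

noncomputable section

/-! ### Finite graphs with killing, truncations and averages. -/

/-- A finite weighted graph with killing: symmetric nonnegative conductances `c` and a nonnegative
killing rate `k`. -/
structure KilledGraph (V : Type*) where
  c : V → V → ℝ
  k : V → ℝ
  c_symm : ∀ x y, c x y = c y x
  c_nonneg : ∀ x y, 0 ≤ c x y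
  k_nonneg : ∀ x, 0 ≤ k x

/-- The average of a function on a finite type. -/
def avg {V : Type*} [Fintype V] (f : V → ℝ) : ℝ := (∑ x, f x) / Fintype.card V

/-- The part of `s` between the levels `a ≤ b`. -/
def slice (a b s : ℝ) : ℝ := min s b - min s a

/-- The primitive of `T` that vanishes at `0`. -/
def prim (T : ℝ → ℝ) (s : ℝ) : ℝ := ∫ u in (0 : ℝ)..s, T u

theorem hasDerivAt_prim {T : ℝ → ℝ} (hT : Continuous T) (s : ℝ) : HasDerivAt (prim T) (T s) s :=
  intervalIntegral.integral_hasDerivAt_right (hT.intervalIntegrable _ _)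
    (hT.stronglyMeasurableAtFilter _ _) hT.continuousAt

theorem continuous_prim {T : ℝ → ℝ} (hT : Continuous T) : Continuous (prim T) :=
  continuous_iff_continuousAt.2 fun s => (hasDerivAt_prim hT s).continuousAt

theorem prim_nonneg {T : ℝ → ℝ} (hpos : ∀ s, 0 ≤ s → 0 ≤ T s)
    (hneg : ∀ s, s ≤ 0 → T s ≤ 0) (s : ℝ) : 0 ≤ prim T s := by
  unfold prim
  rcases le_total 0 s with h | h
  · exact intervalIntegral.integral_nonneg h fun u hu => hpos u hu.1
  · rw [intervalIntegral.integral_symm, ← intervalIntegral.integral_neg]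
    exact intervalIntegral.integral_nonneg h fun u hu => by linarith [hneg u hu.2]

theorem continuous_slice (a b : ℝ) : Continuous (slice a b) := by
  unfold slice; fun_prop

theorem slice_nonneg {a b : ℝ} (hab : a ≤ b) (s : ℝ) : 0 ≤ slice a b s :=
  sub_nonneg.2 (min_le_min_left _ hab)

theorem slice_le {a b : ℝ} (hab : a ≤ b) (s : ℝ) : slice a b s ≤ b - a := by
  unfold slice; grind

theorem slice_le_self {a b s : ℝ} (ha : 0 ≤ a) (hs : 0 ≤ s) : slice a b s ≤ s := by
  unfold slice; grind

theorem slice_of_le {a b s : ℝ} (hab : a ≤ b) (h : s ≤ a) : slice a b s = 0 := by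
  unfold slice; grind

theorem slice_of_ge {a b s : ℝ} (hab : a ≤ b) (h : b ≤ s) : slice a b s = b - a := by
  unfold slice; grind

/-- Truncation is monotone and 1-Lipschitz. This form combines both facts and is what `form_comp_le`
needs. -/
theorem slice_contract {a b : ℝ} (hab : a ≤ b) (s t : ℝ) :
    (slice a b s - slice a b t) ^ 2 ≤ (s - t) * (slice a b s - slice a b t) := by
  have key : ∀ s t : ℝ, t ≤ s →
      (slice a b s - slice a b t) ^ 2 ≤ (s - t) * (slice a b s - slice a b t) := by
    intro s t h
    have h1 : 0 ≤ slice a b s - slice a b t := by unfold slice; grind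
    have h2 : slice a b s - slice a b t ≤ s - t := by unfold slice; grind
    nlinarith
  rcases le_total t s with h | h
  · exact key s t h
  · have := key t s h
    nlinarith

theorem prim_slice_le {a b s : ℝ} (hab : a ≤ b) (hs : 0 ≤ s) :
    prim (slice a b) s ≤ (b - a) * s := by
  unfold prim
  calc ∫ u in (0 : ℝ)..s, slice a b u ≤ ∫ u in (0 : ℝ)..s, (b - a) :=
        intervalIntegral.integral_mono_on hs ((continuous_slice a b).intervalIntegrable _ _)
          (by simp) fun u _ => slice_le hab u
    _ = (b - a) * s := by simp; ring

section Average

variable {V : Type*} [Fintype V]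

theorem avg_nonneg {f : V → ℝ} (h : ∀ x, 0 ≤ f x) : 0 ≤ avg f :=
  div_nonneg (Finset.sum_nonneg fun x _ => h x) (Nat.cast_nonneg _)

theorem avg_mono {f g : V → ℝ} (h : ∀ x, f x ≤ g x) : avg f ≤ avg g :=
  div_le_div_of_nonneg_right (Finset.sum_le_sum fun x _ => h x) (Nat.cast_nonneg _)

theorem avg_add (f g : V → ℝ) : avg (fun x => f x + g x) = avg f + avg g := by
  simp [avg, Finset.sum_add_distrib, add_div]

theorem avg_sub (f g : V → ℝ) : avg (fun x => f x - g x) = avg f - avg g := by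
  simp [avg, Finset.sum_sub_distrib, sub_div]

theorem avg_const_mul (a : ℝ) (f : V → ℝ) : avg (fun x => a * f x) = a * avg f := by
  simp [avg, ← Finset.mul_sum, mul_div_assoc]

theorem avg_sum {ι : Type*} (s : Finset ι) (f : ι → V → ℝ) :
    avg (fun x => ∑ i ∈ s, f i x) = ∑ i ∈ s, avg (f i) := by
  simp only [avg]
  rw [Finset.sum_comm, Finset.sum_div]

theorem avg_const [Nonempty V] (a : ℝ) : avg (fun _ : V => a) = a := by
  have : (Fintype.card V : ℝ) ≠ 0 := by positivity
  simp [avg]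

end Average

/-! ### The Dirichlet form and the heat equation. -/

namespace KilledGraph

variable {V : Type*} [Fintype V] (G : KilledGraph V)

/-- The generator of the random walk among conductances `c`, killed at rate `k`. -/
def gen (f : V → ℝ) (x : V) : ℝ := ∑ y, G.c x y * (f y - f x) - G.k x * f x

/-- The Dirichlet form. -/
def form (f g : V → ℝ) : ℝ :=
  (∑ x, ∑ y, G.c x y * ((f x - f y) * (g x - g y))) / 2 + ∑ x, G.k x * (f x * g x)

/-- The energy density of `f` at `x`. -/
def density (f : V → ℝ) (x : V) : ℝ := ∑ y, G.c x y * (f x - f y) ^ 2 + G.k x * f x ^ 2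

/-- Solutions of the heat equation. -/
def IsHeat (v : ℝ → V → ℝ) : Prop := ∀ t x, HasDerivAt (fun s => v s x) (G.gen (v t) x) t

theorem sum_swap (F : V → V → ℝ) : ∑ x, ∑ y, F x y = ∑ x, ∑ y, F y x := Finset.sum_comm

theorem sum_mul_gen (f g : V → ℝ) : ∑ x, g x * G.gen f x = - G.form f g := by
  have h1 : ∑ x, ∑ y, G.c x y * (g x * (f y - f x)) =
      ∑ x, ∑ y, G.c x y * (g y * (f x - f y)) := by
    rw [sum_swap]
    simp only [G.c_symm]
  have h2 : ∑ x, ∑ y, G.c x y * ((f x - f y) * (g x - g y)) =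
      -(∑ x, ∑ y, G.c x y * (g x * (f y - f x))) -
        ∑ x, ∑ y, G.c x y * (g y * (f x - f y)) := by
    simp only [← Finset.sum_neg_distrib, ← Finset.sum_sub_distrib]
    refine Finset.sum_congr rfl fun x _ => Finset.sum_congr rfl fun y _ => by ring
  have h3 : ∑ x, g x * G.gen f x =
      ∑ x, ∑ y, G.c x y * (g x * (f y - f x)) - ∑ x, G.k x * (f x * g x) := by
    rw [← Finset.sum_sub_distrib]
    refine Finset.sum_congr rfl fun x _ => ?_
    rw [gen, mul_sub, Finset.mul_sum]
    congr 1
    · exact Finset.sum_congr rfl fun y _ => by ring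
    · ring
  unfold form
  linarith

theorem form_comm (f g : V → ℝ) : G.form f g = G.form g f := by
  unfold form
  simp only [mul_comm (f _) (g _), mul_comm (f _ - f _) (g _ - g _)]

theorem form_nonneg (f : V → ℝ) : 0 ≤ G.form f f := by
  unfold form
  have h1 : 0 ≤ ∑ x, ∑ y, G.c x y * ((f x - f y) * (f x - f y)) :=
    Finset.sum_nonneg fun x _ => Finset.sum_nonneg fun y _ =>
      mul_nonneg (G.c_nonneg x y) (mul_self_nonneg _)
  have h2 : 0 ≤ ∑ x, G.k x * (f x * f x) :=
    Finset.sum_nonneg fun x _ => mul_nonneg (G.k_nonneg x) (mul_self_nonneg _)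
  linarith

theorem density_nonneg (f : V → ℝ) (x : V) : 0 ≤ G.density f x :=
  add_nonneg (Finset.sum_nonneg fun y _ => mul_nonneg (G.c_nonneg x y) (sq_nonneg _))
    (mul_nonneg (G.k_nonneg x) (sq_nonneg _))

/-- The two sides agree on edges; the killing term is counted once on the left and twice on the
right. -/
theorem sum_density_le (f : V → ℝ) : ∑ x, G.density f x ≤ 2 * G.form f f := by
  unfold density form
  have h2 : 0 ≤ ∑ x, G.k x * (f x * f x) :=
    Finset.sum_nonneg fun x _ => mul_nonneg (G.k_nonneg x) (mul_self_nonneg _)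
  rw [Finset.sum_add_distrib]
  simp only [sq]
  linarith

theorem form_sum {ι : Type*} (s : Finset ι) (f : V → ℝ) (g : ι → V → ℝ) :
    G.form f (fun x => ∑ i ∈ s, g i x) = ∑ i ∈ s, G.form f (g i) := by
  have h : ∀ g, G.form f g = -∑ x, g x * G.gen f x := fun g => by rw [sum_mul_gen]; ring
  simp only [h, Finset.sum_neg_distrib, Finset.sum_mul]
  rw [Finset.sum_comm]

/-- The hypothesis applies edge by edge. Killing acts as an edge to a point where functions vanish,
whence the condition `T 0 = 0`. -/
theorem form_comp_le {T : ℝ → ℝ} (h0 : T 0 = 0)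
    (hT : ∀ a b, (T a - T b) ^ 2 ≤ (a - b) * (T a - T b)) (f : V → ℝ) :
    G.form (fun x => T (f x)) (fun x => T (f x)) ≤ G.form f (fun x => T (f x)) := by
  unfold form
  refine add_le_add (div_le_div_of_nonneg_right (Finset.sum_le_sum fun x _ =>
    Finset.sum_le_sum fun y _ => mul_le_mul_of_nonneg_left ?_ (G.c_nonneg x y)) zero_le_two)
    (Finset.sum_le_sum fun x _ => mul_le_mul_of_nonneg_left ?_ (G.k_nonneg x))
  · rw [← sq]; exact hT _ _
  · have := hT (f x) 0
    rw [h0] at this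
    nlinarith

/-- Young's inequality for the Dirichlet form, localized to the support of `g`. -/
theorem form_le {s : ℝ} (hs : 0 < s) (f g : V → ℝ) (A : Set V) (hA : ∀ x, x ∉ A → g x = 0) :
    G.form f g ≤ s / 2 * G.form g g + 1 / (2 * s) * ∑ x, A.indicator (G.density f) x := by
  classical
  have young : ∀ a b : ℝ, a * b ≤ s / 2 * (b * b) + 1 / (2 * s) * a ^ 2 := by
    intro a b
    have : s / 2 * (b * b) + 1 / (2 * s) * a ^ 2 - a * b = (s * b - a) ^ 2 / (2 * s) := by
      field_simp; ring
    have : 0 ≤ (s * b - a) ^ 2 / (2 * s) := by positivity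
    linarith
  have hs' : 0 < 1 / (2 * s) := by positivity
  -- Each edge touching `A` is charged to its endpoints in `A`. By symmetry the two charges have
  -- equal sums, which cancels the factor `1 / 2` in `form`.
  set i : V → ℝ := fun x => A.indicator 1 x with hi
  have i0 : ∀ x, 0 ≤ i x := fun x => Set.indicator_nonneg (by simp) x
  have i1 : ∀ x, x ∈ A → i x = 1 := fun x hx => by simp [hi, hx]
  have e1 : ∑ x, A.indicator (G.density f) x =
      ∑ x, ∑ y, G.c x y * (i x * (f x - f y) ^ 2) + ∑ x, G.k x * (i x * f x ^ 2) := by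
    rw [← Finset.sum_add_distrib]
    refine Finset.sum_congr rfl fun x _ => ?_
    by_cases hx : x ∈ A
    · simp [hi, hx, density]
    · simp [hi, hx]
  have e2 : ∑ x, ∑ y, G.c x y * (i x * (f x - f y) ^ 2) =
      ∑ x, ∑ y, G.c x y * (i y * (f x - f y) ^ 2) := by
    rw [sum_swap]
    refine Finset.sum_congr rfl fun x _ => Finset.sum_congr rfl fun y _ => ?_
    rw [G.c_symm]; ring
  have m1 : ∑ x, ∑ y, G.c x y * ((f x - f y) * (g x - g y)) ≤
      s / 2 * ∑ x, ∑ y, G.c x y * ((g x - g y) * (g x - g y)) +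
      1 / (2 * s) * (∑ x, ∑ y, G.c x y * (i x * (f x - f y) ^ 2) +
        ∑ x, ∑ y, G.c x y * (i y * (f x - f y) ^ 2)) := by
    simp only [Finset.mul_sum, ← Finset.sum_add_distrib]
    refine Finset.sum_le_sum fun x _ => Finset.sum_le_sum fun y _ => ?_
    have hc := G.c_nonneg x y
    suffices h : (f x - f y) * (g x - g y) ≤ s / 2 * ((g x - g y) * (g x - g y)) +
        1 / (2 * s) * (i x * (f x - f y) ^ 2 + i y * (f x - f y) ^ 2) by
      have := mul_le_mul_of_nonneg_left h hc
      linarith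
    by_cases hxy : x ∈ A ∨ y ∈ A
    · have h1 : 1 ≤ i x + i y := by
        rcases hxy with h | h
        · linarith [i1 x h, i0 y]
        · linarith [i1 y h, i0 x]
      have h2 := young (f x - f y) (g x - g y)
      have h3 : 1 / (2 * s) * (f x - f y) ^ 2 ≤
          1 / (2 * s) * (i x * (f x - f y) ^ 2 + i y * (f x - f y) ^ 2) := by
        gcongr
        nlinarith [sq_nonneg (f x - f y)]
      linarith
    · push Not at hxy
      rw [hA x hxy.1, hA y hxy.2]
      have := i0 x
      have := i0 y
      simp only [sub_self, mul_zero, zero_add]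
      positivity
  have m2 : ∑ x, G.k x * (f x * g x) ≤ s / 2 * ∑ x, G.k x * (g x * g x) +
      1 / (2 * s) * ∑ x, G.k x * (i x * f x ^ 2) := by
    simp only [Finset.mul_sum, ← Finset.sum_add_distrib]
    refine Finset.sum_le_sum fun x _ => ?_
    have hk := G.k_nonneg x
    suffices h : f x * g x ≤ s / 2 * (g x * g x) + 1 / (2 * s) * (i x * f x ^ 2) by
      have := mul_le_mul_of_nonneg_left h hk
      linarith
    by_cases hx : x ∈ A
    · rw [i1 x hx, one_mul]
      exact young _ _
    · rw [hA x hx]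
      have := i0 x
      simp only [mul_zero, zero_add]
      positivity
  rw [e1]
  unfold form
  rw [← e2] at m1
  linarith

/-- The generator as a continuous linear map. -/
def genCLM : (V → ℝ) →L[ℝ] (V → ℝ) :=
  LinearMap.toContinuousLinearMap
    { toFun := fun f x => G.gen f x
      map_add' := fun f g => by
        funext x
        simp only [gen, Pi.add_apply]
        rw [show ∀ a b c d : ℝ, a - b + (c - d) = a + c - (b + d) by intros; ring,
          ← Finset.sum_add_distrib]
        congr 1
        · exact Finset.sum_congr rfl fun y _ => by ring
        · ring
      map_smul' := fun a f => by
        funext x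
        simp only [gen, Pi.smul_apply, smul_eq_mul, RingHom.id_apply, mul_sub, Finset.mul_sum]
        congr 1
        · exact Finset.sum_congr rfl fun y _ => by ring
        · ring }

theorem exists_isHeat (v₀ : V → ℝ) : ∃ v, G.IsHeat v ∧ v 0 = v₀ := by
  refine ⟨fun t => NormedSpace.exp (t • G.genCLM) v₀, fun t x => ?_, by simp⟩
  have h := (hasDerivAt_exp_smul_const' (𝕂 := ℝ) G.genCLM t).clm_apply (hasDerivAt_const t v₀)
  have h2 := (hasDerivAt_pi.1 h) x
  simpa [genCLM] using h2

variable {G} {v w : ℝ → V → ℝ}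

theorem IsHeat.continuous_apply (hv : G.IsHeat v) (x : V) : Continuous fun t => v t x :=
  continuous_iff_continuousAt.2 fun t => (hv t x).continuousAt

theorem IsHeat.continuous (hv : G.IsHeat v) : Continuous v :=
  continuous_pi fun x => hv.continuous_apply x

theorem continuous_form {f g : ℝ → V → ℝ} (hf : Continuous f) (hg : Continuous g) :
    Continuous fun t => G.form (f t) (g t) := by
  unfold form
  fun_prop

theorem IsHeat.hasDerivAt_sum_mul (hv : G.IsHeat v) (f : V → ℝ) (t : ℝ) :
    HasDerivAt (fun s => ∑ x, f x * v s x) (-G.form f (v t)) t := by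
  rw [form_comm, ← sum_mul_gen]
  exact HasDerivAt.fun_sum fun x _ => (hv t x).const_mul (f x)

/-- Testing the equation with `T v` produces `-form v (T v)`, which is at most `-form (T v) (T v)`
by `form_comp_le`. -/
theorem IsHeat.sum_prim_add_le (hv : G.IsHeat v) {T : ℝ → ℝ} (hTc : Continuous T) (h0 : T 0 = 0)
    (hT : ∀ a b, (T a - T b) ^ 2 ≤ (a - b) * (T a - T b)) {t : ℝ} (ht : 0 ≤ t) :
    ∑ x, prim T (v t x) + ∫ s in (0 : ℝ)..t, G.form (fun x => T (v s x)) (fun x => T (v s x)) ≤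
      ∑ x, prim T (v 0 x) := by
  have hc := hv.continuous
  have hTv : Continuous fun s => fun x => T (v s x) :=
    continuous_pi fun x => hTc.comp (hv.continuous_apply x)
  have hd : ∀ s, HasDerivAt (fun s => ∑ x, prim T (v s x))
      (-G.form (v s) (fun x => T (v s x))) s := by
    intro s
    rw [← sum_mul_gen]
    exact HasDerivAt.fun_sum fun x _ => HasDerivAt.comp (h₂ := prim T) s (hasDerivAt_prim hTc (v s x)) (hv s x)
  have hcf := continuous_form (G := G) hc hTv
  have e := intervalIntegral.integral_eq_sub_of_hasDerivAt (a := 0) (b := t) (fun s _ => hd s)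
    (hcf.neg.intervalIntegrable _ _)
  have m : ∫ s in (0 : ℝ)..t, G.form (fun x => T (v s x)) (fun x => T (v s x)) ≤
      ∫ s in (0 : ℝ)..t, G.form (v s) (fun x => T (v s x)) :=
    intervalIntegral.integral_mono_on ht ((continuous_form hTv hTv).intervalIntegrable _ _)
      (hcf.intervalIntegrable _ _) fun s _ => G.form_comp_le h0 hT _
  rw [intervalIntegral.integral_neg] at e
  linarith

/-- The energy inequality with `T s = min s 0`, whose primitive is half the square of the negative
part: it vanishes at time 0 and cannot grow. -/
theorem IsHeat.nonneg (hv : G.IsHeat v) (h0 : ∀ x, 0 ≤ v 0 x) {t : ℝ} (ht : 0 ≤ t) (x : V) :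
    0 ≤ v t x := by
  have hpos : ∀ s : ℝ, 0 ≤ s → min s 0 = 0 := fun s hs => min_eq_right hs
  have hneg : ∀ s : ℝ, s ≤ 0 → min s 0 = s := fun s hs => min_eq_left hs
  have key := hv.sum_prim_add_le (T := fun s => min s 0) (by fun_prop) (by simp) (by
    intro a b
    rcases le_total a 0 with ha | ha <;> rcases le_total b 0 with hb | hb <;>
      simp only [ha, hb, min_eq_left, min_eq_right] <;> nlinarith) ht
  have e0 : ∑ x, prim (fun s => min s 0) (v 0 x) = 0 := by
    refine Finset.sum_eq_zero fun x _ => ?_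
    unfold prim
    rw [intervalIntegral.integral_congr (g := fun _ => 0)]
    · simp
    · intro u hu
      rw [uIcc_of_le (h0 x)] at hu
      exact hpos u hu.1
  have hn : ∀ x, 0 ≤ prim (fun s => min s 0) (v t x) :=
    fun x => prim_nonneg (fun s hs => (hpos s hs).ge) (fun s hs => min_le_right _ _) _
  have hi : 0 ≤ ∫ s in (0 : ℝ)..t, G.form (fun x => min (v s x) 0) (fun x => min (v s x) 0) :=
    intervalIntegral.integral_nonneg ht fun s _ => G.form_nonneg _
  have hz : ∑ x, prim (fun s => min s 0) (v t x) ≤ 0 := by linarith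
  have hx : prim (fun s => min s 0) (v t x) ≤ 0 :=
    (Finset.single_le_sum (fun y _ => hn y) (Finset.mem_univ x)).trans hz
  by_contra! hlt
  have e : prim (fun s => min s 0) (v t x) = (v t x) ^ 2 / 2 := by
    unfold prim
    rw [intervalIntegral.integral_congr (g := fun u => u)]
    · simp
    · intro u hu
      rw [uIcc_of_ge hlt.le] at hu
      exact hneg u hu.2
  have : 0 < (v t x) ^ 2 / 2 := by have := hlt.ne; positivity
  linarith

/-- Testing with the constant 1 shows that mass changes through killing alone. -/
theorem IsHeat.avg_le (hv : G.IsHeat v) (h0 : ∀ x, 0 ≤ v 0 x) {t : ℝ} (ht : 0 ≤ t) :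
    avg (v t) ≤ avg (v 0) := by
  have hd : ∀ s, HasDerivAt (fun s => ∑ x, v s x) (-∑ x, G.k x * v s x) s := by
    intro s
    have h := hv.hasDerivAt_sum_mul (fun _ => 1) s
    simpa [form] using h
  have hanti : AntitoneOn (fun s => ∑ x, v s x) (Ici 0) := by
    refine antitoneOn_of_deriv_nonpos (convex_Ici 0)
      (fun s _ => (hd s).continuousAt.continuousWithinAt)
      (fun s _ => (hd s).differentiableAt.differentiableWithinAt) fun s hs => ?_
    rw [(hd s).deriv, neg_nonpos]
    rw [interior_Ici] at hs
    exact Finset.sum_nonneg fun x _ => mul_nonneg (G.k_nonneg x) (hv.nonneg h0 (le_of_lt hs) x)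
  exact div_le_div_of_nonneg_right (hanti (mem_Ici.2 le_rfl) ht ht) (Nat.cast_nonneg _)

/-- Self-adjointness of the generator. For point-mass data this contains both the symmetry of the
heat kernel and the Chapman–Kolmogorov identity. -/
theorem IsHeat.sum_mul_const (hv : G.IsHeat v) (hw : G.IsHeat w) (T s : ℝ) :
    ∑ x, v (T - s) x * w s x = ∑ x, v T x * w 0 x := by
  have hd : ∀ s, HasDerivAt (fun s => ∑ x, v (T - s) x * w s x) 0 s := by
    intro s
    have h1 : ∀ x, HasDerivAt (fun s => v (T - s) x) (-(G.gen (v (T - s)) x)) s := by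
      intro x
      exact (hv (T - s) x).comp_const_sub T s
    have h2 := HasDerivAt.fun_sum (u := Finset.univ) fun x _ => (h1 x).fun_mul (hw s x)
    refine h2.congr_deriv ?_
    rw [Finset.sum_add_distrib, G.sum_mul_gen, form_comm]
    have := G.sum_mul_gen (v (T - s)) (w s)
    simp only [neg_mul, Finset.sum_neg_distrib, mul_comm (G.gen _ _), this]
    ring
  have := is_const_of_deriv_eq_zero (fun s => (hd s).differentiableAt) (fun s => (hd s).deriv) s 0
  simpa using this

/-- Integrated energy of a slice of a nonnegative solution. -/
theorem IsHeat.integral_form_slice_le (hv : G.IsHeat v) (h0 : ∀ x, 0 ≤ v 0 x)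
    (h1 : avg (v 0) ≤ 1) {a b : ℝ} (ha : 0 ≤ a) (hab : a ≤ b) {t : ℝ} (ht : 0 ≤ t) :
    ∫ s in (0 : ℝ)..t, G.form (fun x => slice a b (v s x)) (fun x => slice a b (v s x)) /
      Fintype.card V ≤ b - a := by
  have key := hv.sum_prim_add_le (continuous_slice a b) (slice_of_le hab ha) (slice_contract hab) ht
  have hn : 0 ≤ ∑ x, prim (slice a b) (v t x) :=
    Finset.sum_nonneg fun x _ => prim_nonneg (fun s _ => slice_nonneg hab s)
      (fun s hs => (slice_of_le hab (hs.trans ha)).le) _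
  -- The primitive grows linearly with slope at most `b - a`, so the initial cost is the band height
  -- times the mass, uniformly over initial data.
  have hm : ∑ x, prim (slice a b) (v 0 x) ≤ (b - a) * ∑ x, v 0 x := by
    rw [Finset.mul_sum]
    exact Finset.sum_le_sum fun x _ => prim_slice_le hab (h0 x)
  rw [intervalIntegral.integral_div]
  calc _ ≤ (b - a) * avg (v 0) := by
        rw [avg, ← mul_div_assoc]
        gcongr
        linarith
    _ ≤ (b - a) * 1 := by gcongr
    _ = b - a := mul_one _

end KilledGraph

/-! ### Elementary inequalities for the recursion over levels. -/

theorem geom_sum_range_le {x : ℝ} (h0 : 0 ≤ x) (h1 : x < 1) (n : ℕ) :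
    ∑ i ∈ Finset.range n, x ^ i ≤ 1 / (1 - x) := by
  rw [one_div, ← tsum_geometric_of_lt_one h0 h1]
  exact (summable_geometric_of_lt_one h0 h1).sum_le_tsum _ fun i _ => pow_nonneg h0 i

/-- The minimum of a small constant and a geometric sequence is a small multiple of a slower
geometric sequence. -/
theorem exists_min_le_geometric {K x y δ : ℝ} (hx : 0 < x) (hxy : x < y) (hy : y < 1)
    (hδ : 0 < δ) : ∃ ε : ℝ, 0 < ε ∧ ε ≤ 1 ∧ ∀ i : ℕ, min ε (K * x ^ i) ≤ δ * y ^ i := by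
  have hy0 : 0 < y := hx.trans hxy
  have hr : x / y < 1 := (div_lt_one hy0).2 hxy
  have hr0 : 0 ≤ x / y := by positivity
  have ht : Filter.Tendsto (fun n : ℕ => |K| * (x / y) ^ n) Filter.atTop (nhds (|K| * 0)) :=
    (tendsto_pow_atTop_nhds_zero_of_lt_one hr0 hr).const_mul _
  rw [mul_zero] at ht
  -- Up to `m` the constant `δ * y ^ m` is small enough; beyond `m` the faster geometric decay takes
  -- over.
  obtain ⟨m, hm⟩ := (ht.eventually (gt_mem_nhds hδ)).exists
  refine ⟨min 1 (δ * y ^ m), by positivity, min_le_left _ _, fun i => ?_⟩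
  rcases le_total i m with h | h
  · refine (min_le_left _ _).trans ((min_le_right _ _).trans ?_)
    exact mul_le_mul_of_nonneg_left (pow_le_pow_of_le_one hy0.le hy.le h) hδ.le
  · refine (min_le_right _ _).trans ?_
    have e : x ^ i = (x / y) ^ i * y ^ i := by rw [← mul_pow, div_mul_cancel₀ _ hy0.ne']
    rw [e, ← mul_assoc]
    refine mul_le_mul_of_nonneg_right ?_ (by positivity)
    calc K * (x / y) ^ i ≤ |K| * (x / y) ^ m :=
          mul_le_mul (le_abs_self K) (pow_le_pow_of_le_one hr0 hr.le h) (by positivity)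
            (abs_nonneg _)
      _ ≤ δ := hm.le

/-- Young's inequality in the form used to close the recursion between superlevel sets. -/
theorem exists_rpow_le_of_rpow_le {P Q D : ℝ} (hP0 : 0 < P) (hP1 : P < 1) (hQ : 0 < Q)
    (hD : 1 ≤ D) (hPQ : D < P + Q) :
    ∃ l : ℝ, 0 < l ∧ l < 1 / 2 ∧ ∀ S : ℝ, 0 ≤ S → ∃ C : ℝ, 0 ≤ C ∧ ∀ (j : ℕ) (e x y : ℝ),
      0 ≤ e → 0 ≤ x → x ≤ (1 / 2) ^ j → 0 ≤ y → y ^ D ≤ S * (1 / 2) ^ (j + 1) * e * x ^ Q →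
        y ^ P ≤ C * l ^ j * e + l ^ 2 / 2 * x ^ P := by
  -- Raising the hypothesis to the power `a` makes the left side `y ^ P`. Young's inequality with
  -- weights `a` and `1 - a` then separates `e` from `x`.
  set a := P / D with ha
  have hD0 : 0 < D := by linarith
  have ha0 : 0 < a := by positivity
  have ha1 : a < 1 := (div_lt_one hD0).2 (by linarith)
  set b := (1 - a) / a with hb
  have h1a : 0 < 1 - a := by linarith
  have hb0 : 0 < b := by positivity
  -- The surplus exponent: after Young, `x` carries the power `P + g`, and `g > 0` is equivalent to
  -- `D < P + Q`. Since `x ≤ (1 / 2) ^ j`, the surplus gains a factor `(1 / 2) ^ (j * g)`.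
  set g := Q * a / (1 - a) - P with hg
  have hg0 : 0 < g := by
    have e1 : 1 - a = (D - P) / D := by rw [ha]; field_simp
    have hDP : 0 < D - P := by linarith
    have : Q * a / (1 - a) = Q * P / (D - P) := by rw [e1, ha]; field_simp
    rw [hg, this, sub_pos, lt_div_iff₀ hDP]
    nlinarith
  -- The gain is moved from the `x` term to the `e` term, where it becomes `m ^ j` and pushes the
  -- rate `l = m / 2` strictly below `1 / 2`.
  set m : ℝ := (1 / 2 : ℝ) ^ (g * b) with hm
  have hm0 : 0 < m := by positivity
  have hm1 : m < 1 := Real.rpow_lt_one (by norm_num) (by norm_num) (by positivity)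
  set l : ℝ := 1 / 2 * m with hl
  have hl0 : 0 < l := by positivity
  refine ⟨l, hl0, by linarith, fun S hS => ?_⟩
  refine ⟨S / 2 * (l ^ 2 / 2) ^ (-b), by positivity, ?_⟩
  intro j e x y he hx hxj hy hyx
  -- Young's parameter, tuned so that the `x` term has coefficient exactly `l ^ 2 / 2`.
  set s : ℝ := (l ^ 2 / 2) ^ b * (m ^ j)⁻¹ with hs
  have hs0 : 0 < s := by positivity
  set Z : ℝ := S * (1 / 2) ^ (j + 1) * e with hZ
  have hZ0 : 0 ≤ Z := by positivity
  set Y : ℝ := x ^ (Q * a / (1 - a)) with hY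
  have hY0 : 0 ≤ Y := by positivity
  have hba : b * (a / (1 - a)) = 1 := by rw [hb]; field_simp
  have hsa : s ^ (a / (1 - a)) = l ^ 2 / 2 * ((1 / 2 : ℝ) ^ (j * g))⁻¹ := by
    rw [hs, Real.mul_rpow (by positivity) (by positivity), ← Real.rpow_mul (by positivity), hba,
      Real.rpow_one, Real.inv_rpow (by positivity)]
    congr 2
    rw [hm, ← Real.rpow_natCast, ← Real.rpow_mul (by positivity), ← Real.rpow_mul (by norm_num)]
    congr 1
    calc g * b * (j * (a / (1 - a))) = j * g * (b * (a / (1 - a))) := by ring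
      _ = j * g := by rw [hba, mul_one]
  have hYx : Y ≤ (1 / 2 : ℝ) ^ (j * g) * x ^ P := by
    have e1 : Q * a / (1 - a) = g + P := by rw [hg]; ring
    rw [hY, e1, Real.rpow_add_of_nonneg hx hg0.le hP0.le]
    refine mul_le_mul_of_nonneg_right ?_ (by positivity)
    calc x ^ g ≤ ((1 / 2 : ℝ) ^ j) ^ g := Real.rpow_le_rpow hx hxj hg0.le
      _ = _ := by rw [← Real.rpow_natCast, ← Real.rpow_mul (by norm_num)]
  have hY2 : Y * s ^ (a / (1 - a)) ≤ l ^ 2 / 2 * x ^ P := by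
    rw [hsa]
    have hp : 0 < (1 / 2 : ℝ) ^ (j * g) := by positivity
    calc Y * (l ^ 2 / 2 * ((1 / 2 : ℝ) ^ (j * g))⁻¹)
        ≤ (1 / 2 : ℝ) ^ (j * g) * x ^ P * (l ^ 2 / 2 * ((1 / 2 : ℝ) ^ (j * g))⁻¹) := by gcongr
      _ = _ := by field_simp
  have hZs : Z / s = S / 2 * (l ^ 2 / 2) ^ (-b) * l ^ j * e := by
    rw [hZ, hs, Real.rpow_neg (by positivity), hl, mul_pow (1 / 2) m j, pow_succ]
    field_simp
  have hyP : y ^ P ≤ Z ^ a * Y ^ (1 - a) := by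
    calc y ^ P = (y ^ D) ^ a := by
          rw [← Real.rpow_mul hy, ha, mul_div_cancel₀ _ hD0.ne']
      _ ≤ (Z * x ^ Q) ^ a := Real.rpow_le_rpow (by positivity) hyx ha0.le
      _ = _ := by
          rw [Real.mul_rpow hZ0 (by positivity), hY, ← Real.rpow_mul hx, ← Real.rpow_mul hx,
            div_mul_cancel₀ _ h1a.ne']
  calc y ^ P ≤ Z ^ a * Y ^ (1 - a) := hyP
    _ = (Z / s) ^ a * (Y * s ^ (a / (1 - a))) ^ (1 - a) := by
        rw [Real.div_rpow hZ0 hs0.le, Real.mul_rpow hY0 (by positivity), ← Real.rpow_mul hs0.le,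
          div_mul_cancel₀ _ h1a.ne']
        field_simp
    _ ≤ a * (Z / s) + (1 - a) * (Y * s ^ (a / (1 - a))) :=
        Real.geom_mean_le_arith_mean2_weighted ha0.le h1a.le (by positivity) (by positivity)
          (by ring)
    _ ≤ 1 * (Z / s) + 1 * (Y * s ^ (a / (1 - a))) := by gcongr; linarith
    _ ≤ _ := by rw [hZs]; linarith

/-! ### Superlevel proportions and a dual norm. -/

section Levels

variable {V : Type*} [Fintype V]

/-- A smoothed version of the proportion of points where `f` exceeds `2 ^ j`. -/
def level (j : ℕ) (f : V → ℝ) : ℝ := avg fun x => slice (2 ^ j) (2 ^ (j + 1)) (f x) / 2 ^ j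

/-- The proportion of points of `A`. -/
def frac (A : Set V) : ℝ := avg (A.indicator 1)

theorem two_pow_le_succ (j : ℕ) : (2 : ℝ) ^ j ≤ 2 ^ (j + 1) :=
  pow_le_pow_right₀ one_le_two (Nat.le_succ j)

theorem two_pow_succ_sub (j : ℕ) : (2 : ℝ) ^ (j + 1) - 2 ^ j = 2 ^ j := by ring

theorem avg_le_one {f : V → ℝ} (h : ∀ x, f x ≤ 1) : avg f ≤ 1 := by
  unfold avg
  refine div_le_one_of_le₀ ?_ (Nat.cast_nonneg _)
  calc ∑ x, f x ≤ ∑ _ : V, (1 : ℝ) := Finset.sum_le_sum fun x _ => h x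
    _ = _ := by simp

theorem frac_nonneg (A : Set V) : 0 ≤ frac A :=
  avg_nonneg fun x => Set.indicator_nonneg (by simp) x

theorem frac_mono {A B : Set V} (h : A ⊆ B) : frac A ≤ frac B :=
  avg_mono fun x => Set.indicator_le_indicator_of_subset h (by simp) x

theorem frac_le_one (A : Set V) : frac A ≤ 1 :=
  avg_le_one fun x => Set.indicator_apply_le' (by simp) (by simp)

theorem level_nonneg (j : ℕ) (f : V → ℝ) : 0 ≤ level j f :=
  avg_nonneg fun x => div_nonneg (slice_nonneg (two_pow_le_succ j) _) (by positivity)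

theorem slice_div_le_one (j : ℕ) (s : ℝ) : slice (2 ^ j) (2 ^ (j + 1)) s / 2 ^ j ≤ 1 := by
  rw [div_le_one (by positivity)]
  exact (slice_le (two_pow_le_succ j) _).trans (two_pow_succ_sub j).le

theorem level_le_one (j : ℕ) (f : V → ℝ) : level j f ≤ 1 :=
  avg_le_one fun _ => slice_div_le_one j _

/-- Markov's inequality. -/
theorem level_le_pow (j : ℕ) {f : V → ℝ} (h0 : ∀ x, 0 ≤ f x) (h1 : avg f ≤ 1) :
    level j f ≤ (1 / 2) ^ j := by
  calc level j f ≤ avg fun x => (1 / 2) ^ j * f x := avg_mono fun x => by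
        rw [div_le_iff₀ (by positivity)]
        calc slice (2 ^ j) (2 ^ (j + 1)) (f x) ≤ f x := slice_le_self (by positivity) (h0 x)
          _ = (1 / 2) ^ j * f x * 2 ^ j := by
            rw [mul_right_comm, ← mul_pow]; norm_num
    _ = (1 / 2) ^ j * avg f := avg_const_mul _ _
    _ ≤ _ := mul_le_of_le_one_right (by positivity) h1

/-- With `level_le_frac`, this places `level` between the superlevel proportions at two consecutive
dyadic heights. Unlike those, it is continuous in time along a solution. -/
theorem frac_le_level (j : ℕ) (f : V → ℝ) : frac {x | 2 ^ (j + 1) ≤ f x} ≤ level j f :=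
  avg_mono fun x => by
    by_cases h : 2 ^ (j + 1) ≤ f x
    · rw [slice_of_ge (two_pow_le_succ j) h, two_pow_succ_sub, div_self (by positivity)]
      simp [h]
    · have := div_nonneg (slice_nonneg (two_pow_le_succ j) (f x)) (by positivity : (0 : ℝ) ≤ 2 ^ j)
      simpa [h] using this

theorem level_le_frac (j : ℕ) (f : V → ℝ) : level j f ≤ frac {x | 2 ^ j < f x} :=
  avg_mono fun x => by
    by_cases h : 2 ^ j < f x
    · simpa [h] using slice_div_le_one j (f x)
    · rw [slice_of_le (two_pow_le_succ j) (not_lt.1 h)]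
      simp [h]

theorem continuous_avg {f : ℝ → V → ℝ} (h : ∀ x, Continuous fun t => f t x) :
    Continuous fun t => avg (f t) := by
  unfold avg
  exact (continuous_finsetSum _ fun x _ => h x).div_const _

theorem continuous_level (j : ℕ) {v : ℝ → V → ℝ} (hv : Continuous v) :
    Continuous fun t => level j (v t) :=
  continuous_avg fun x => ((continuous_slice _ _).comp (by fun_prop)).div_const _

theorem continuous_level_rpow (j : ℕ) {v : ℝ → V → ℝ} (hv : Continuous v) {P : ℝ} (hP : 0 ≤ P) :
    Continuous fun t => level j (v t) ^ P :=
  (continuous_level j hv).rpow_const fun _ => Or.inr hP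

/-- Hölder's inequality for averages against a function with values in `[0, 1]`. -/
theorem avg_mul_le {p : ℝ} (hp : 1 < p) {a g : V → ℝ} (ha0 : ∀ x, 0 ≤ a x) (ha1 : ∀ x, a x ≤ 1)
    (hg : ∀ x, 0 ≤ g x) {F : ℝ} (hF : 0 ≤ F) (h : avg (fun x => g x ^ p) ≤ F ^ p) :
    avg (fun x => a x * g x) ≤ avg a ^ (1 - 1 / p) * F := by
  have hp0 : 0 < p := by linarith
  set n : ℝ := (Fintype.card V : ℝ) with hn
  have hn0 : 0 ≤ n := by positivity
  have hc : (p / (p - 1)).HolderConjugate p := (Real.HolderConjugate.conjExponent hp).symm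
  have hc1 : 1 / (p / (p - 1)) = 1 - 1 / p := by field_simp
  have hol := Real.inner_le_Lp_mul_Lq Finset.univ a g hc
  rcases hn0.eq_or_lt with h0 | hn0'
  · simp only [avg, ← hn, ← h0, div_zero]
    positivity
  -- As `a` takes values in `[0, 1]`, its power with the conjugate exponent is at most `a`; so the
  -- average of `a` replaces its norm.
  have e1 : ∑ x, |a x| ^ (p / (p - 1)) ≤ n * avg a := by
    rw [avg, mul_div_cancel₀ _ hn0'.ne']
    refine Finset.sum_le_sum fun x _ => ?_
    rw [abs_of_nonneg (ha0 x)]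
    calc a x ^ (p / (p - 1)) ≤ a x ^ (1 : ℝ) :=
          Real.rpow_le_rpow_of_exponent_ge' (ha0 x) (ha1 x) zero_le_one hc.lt.le
      _ = a x := Real.rpow_one _
  have e2 : ∑ x, |g x| ^ p ≤ n * F ^ p := by
    have : ∑ x, |g x| ^ p = n * avg (fun x => g x ^ p) := by
      rw [avg, mul_div_cancel₀ _ hn0'.ne']
      exact Finset.sum_congr rfl fun x _ => by rw [abs_of_nonneg (hg x)]
    rw [this]
    gcongr
  have ha : 0 ≤ avg a := avg_nonneg ha0
  calc avg (fun x => a x * g x) = (∑ x, a x * g x) / n := rfl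
    _ ≤ ((n * avg a) ^ (1 - 1 / p) * (n * F ^ p) ^ (1 / p)) / n := by
        rw [hc1] at hol
        refine div_le_div_of_nonneg_right (hol.trans ?_) hn0
        gcongr
        rw [sub_nonneg, div_le_one hp0]
        exact hp.le
    _ = avg a ^ (1 - 1 / p) * F := by
        rw [Real.mul_rpow hn0 ha, Real.mul_rpow hn0 (by positivity), ← Real.rpow_mul hF,
          mul_one_div_cancel hp0.ne', Real.rpow_one]
        have : n ^ (1 - 1 / p) * n ^ (1 / p) = n := by
          rw [← Real.rpow_add hn0', sub_add_cancel, Real.rpow_one]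
        calc _ = (n ^ (1 - 1 / p) * n ^ (1 / p)) * (avg a ^ (1 - 1 / p) * F) / n := by ring
          _ = _ := by rw [this, mul_div_cancel_left₀ _ hn0'.ne']

/-- A continuous bound for the dual norm of `f`. -/
def dualBound (J : ℕ) (P : ℝ) (f : V → ℝ) : ℝ :=
  1 + ∑ j ∈ Finset.range J, 2 ^ j * level j f ^ P

theorem eq_sum_slice {J : ℕ} {s : ℝ} (h0 : 0 ≤ s) (h : s ≤ 2 ^ J) :
    s = slice 0 1 s + ∑ j ∈ Finset.range J, slice (2 ^ j) (2 ^ (j + 1)) s := by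
  have : ∑ j ∈ Finset.range J, slice (2 ^ j) (2 ^ (j + 1)) s = min s (2 ^ J) - min s (2 ^ 0) := by
    unfold slice
    exact Finset.sum_range_sub (fun j => min s (2 ^ j)) J
  rw [this, min_eq_left h, slice, min_eq_right h0]
  simp

/-- A crude bound that only truncates the sum over levels; the constants obtained later do not
depend on the cardinality. -/
theorem le_two_pow_card {f : V → ℝ} (h0 : ∀ x, 0 ≤ f x) (h1 : avg f ≤ 1) (x : V) :
    f x ≤ 2 ^ Fintype.card V := by
  have : Nonempty V := ⟨x⟩
  have hn : (0 : ℝ) < Fintype.card V := by positivity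
  calc f x ≤ ∑ y, f y := Finset.single_le_sum (fun y _ => h0 y) (Finset.mem_univ x)
    _ ≤ Fintype.card V := by rwa [avg, div_le_one hn] at h1
    _ ≤ 2 ^ Fintype.card V := by exact_mod_cast Nat.lt_two_pow_self.le

/-- Cut `f` into dyadic slices. Slice `j` divided by `2 ^ j` has values in `[0, 1]` and average
`level j f`, so `avg_mul_le` applies to each; the part of `f` below 1 accounts for the constant 1.
-/
theorem avg_mul_le_dualBound {p : ℝ} (hp : 1 < p) {f g : V → ℝ} (h0 : ∀ x, 0 ≤ f x)
    (h1 : avg f ≤ 1) (hg : ∀ x, 0 ≤ g x) {F : ℝ} (hF : 0 ≤ F)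
    (h : avg (fun x => g x ^ p) ≤ F ^ p) :
    avg (fun x => f x * g x) ≤ dualBound (Fintype.card V) (1 - 1 / p) f * F := by
  have hP : 0 ≤ 1 - 1 / p := by
    rw [sub_nonneg, div_le_one (by linarith)]
    exact hp.le
  have e : (fun x => f x * g x) = fun x => slice 0 1 (f x) * g x +
      ∑ j ∈ Finset.range (Fintype.card V),
        2 ^ j * (slice (2 ^ j) (2 ^ (j + 1)) (f x) / 2 ^ j * g x) := by
    funext x
    conv_lhs => rw [eq_sum_slice (h0 x) (le_two_pow_card h0 h1 x)]
    rw [add_mul, Finset.sum_mul]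
    congr 1
    refine Finset.sum_congr rfl fun j _ => ?_
    field_simp
  rw [e, avg_add, avg_sum, dualBound, add_mul, Finset.sum_mul]
  refine add_le_add ?_ (Finset.sum_le_sum fun j _ => ?_)
  · refine (avg_mul_le hp (fun x => slice_nonneg zero_le_one _)
      (fun x => (slice_le zero_le_one _).trans (by norm_num)) hg hF h).trans ?_
    refine mul_le_mul_of_nonneg_right ?_ hF
    exact Real.rpow_le_one (avg_nonneg fun x => slice_nonneg zero_le_one _)
      (avg_le_one fun x => (slice_le zero_le_one _).trans (by norm_num)) hP
  · rw [avg_const_mul, mul_assoc]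
    refine mul_le_mul_of_nonneg_left ?_ (by positivity)
    exact avg_mul_le hp (fun x => div_nonneg (slice_nonneg (two_pow_le_succ j) _) (by positivity))
      (fun x => slice_div_le_one j _) hg hF h

theorem dualBound_nonneg (J : ℕ) (P : ℝ) (f : V → ℝ) : 1 ≤ dualBound J P f :=
  le_add_of_nonneg_right (Finset.sum_nonneg fun j _ =>
    mul_nonneg (by positivity) (Real.rpow_nonneg (level_nonneg j f) _))

theorem continuous_dualBound (J : ℕ) {P : ℝ} (hP : 0 ≤ P) {v : ℝ → V → ℝ} (hv : Continuous v) :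
    Continuous fun t => dualBound J P (v t) :=
  continuous_const.add (continuous_finsetSum _ fun j _ =>
    (continuous_level_rpow j hv hP).const_mul _)

end Levels

/-! ### Time integrals of the levels of a density. -/

namespace KilledGraph

variable {V : Type*} [Fintype V]

/-- A weak Sobolev inequality with constant `S`. -/
def SobolevBound (G : KilledGraph V) (D Q S : ℝ) : Prop :=
  ∀ f : V → ℝ, (∀ x, 0 ≤ f x) → ∀ h : ℝ, 0 < h →
    h ^ 2 * frac {x | h ≤ f x} ^ D ≤ S * (G.form f f / Fintype.card V) * frac {x | 0 < f x} ^ Q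

/-- Normalized nonnegative solutions of the heat equation. -/
structure IsDensity (G : KilledGraph V) (v : ℝ → V → ℝ) : Prop where
  isHeat : G.IsHeat v
  init_nonneg : ∀ x, 0 ≤ v 0 x
  init_avg : avg (v 0) ≤ 1

variable {G : KilledGraph V} {v : ℝ → V → ℝ}

theorem IsDensity.nonneg (hv : G.IsDensity v) {t : ℝ} (ht : 0 ≤ t) (x : V) : 0 ≤ v t x :=
  hv.isHeat.nonneg hv.init_nonneg ht x

theorem IsDensity.avg_le (hv : G.IsDensity v) {t : ℝ} (ht : 0 ≤ t) : avg (v t) ≤ 1 :=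
  (hv.isHeat.avg_le hv.init_nonneg ht).trans hv.init_avg

theorem IsDensity.continuous (hv : G.IsDensity v) : Continuous v := hv.isHeat.continuous

/-- The Sobolev bound is applied to one slice at its full height `2 ^ (j + 1)`. The slice is full
where `f > 2 ^ (j + 2)` and supported where `f > 2 ^ (j + 1)`; the sandwich of `level` thus links
levels `j` and `j + 2`. One of the two factors `2 ^ (j + 1)` from the squared height normalizes the
energy. -/
theorem SobolevBound.level_rpow_le {D Q S : ℝ} (hS : G.SobolevBound D Q S) (hS0 : 0 ≤ S)
    (hD : 0 ≤ D) (hQ : 0 ≤ Q) (f : V → ℝ) (j : ℕ) :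
    level (j + 2) f ^ D ≤ S * (1 / 2) ^ (j + 1) *
      (G.form (fun x => slice (2 ^ (j + 1)) (2 ^ (j + 2)) (f x))
        (fun x => slice (2 ^ (j + 1)) (2 ^ (j + 2)) (f x)) / Fintype.card V / 2 ^ (j + 1)) *
          level j f ^ Q := by
  have h2 : (2 : ℝ) ^ (j + 2) - 2 ^ (j + 1) = 2 ^ (j + 1) := two_pow_succ_sub (j + 1)
  have hle := two_pow_le_succ (j + 1)
  have key := hS (fun x => slice (2 ^ (j + 1)) (2 ^ (j + 2)) (f x))
    (fun x => slice_nonneg hle _) (2 ^ (j + 1)) (by positivity)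
  set E := G.form (fun x => slice (2 ^ (j + 1)) (2 ^ (j + 2)) (f x))
        (fun x => slice (2 ^ (j + 1)) (2 ^ (j + 2)) (f x)) / Fintype.card V with hE
  have hE0 : 0 ≤ E := div_nonneg (G.form_nonneg _) (Nat.cast_nonneg _)
  have a1 : level (j + 2) f ≤ frac {x | 2 ^ (j + 1) ≤ slice (2 ^ (j + 1)) (2 ^ (j + 2)) (f x)} := by
    refine (level_le_frac _ _).trans (frac_mono fun x hx => ?_)
    simp only [mem_ofPred_eq] at hx ⊢
    rw [slice_of_ge hle (le_of_lt hx), h2]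
  have a2 : frac {x | 0 < slice (2 ^ (j + 1)) (2 ^ (j + 2)) (f x)} ≤ level j f := by
    refine (frac_mono fun x hx => ?_).trans (frac_le_level _ _)
    simp only [mem_ofPred_eq] at hx ⊢
    by_contra! hlt
    rw [slice_of_le hle hlt.le] at hx
    exact lt_irrefl _ hx
  have a3 : (2 ^ (j + 1)) ^ 2 * level (j + 2) f ^ D ≤ S * E * level j f ^ Q := by
    refine le_trans ?_ (key.trans ?_)
    · gcongr
      exact level_nonneg _ _
    · gcongr
      exact frac_nonneg _
  have hpos : (0 : ℝ) < (2 ^ (j + 1)) ^ 2 := by positivity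
  rw [← le_div_iff₀' hpos] at a3
  refine a3.trans (le_of_eq ?_)
  rw [one_div, inv_pow]
  field_simp

/-- Induction in steps of two: Young's inequality splits level `j + 2` into a normalized energy, of
time integral at most 1, and a fraction of level `j`. It is the rate below `1 / 2` that beats the
weights `2 ^ j` of `dualBound`. -/
theorem exists_integral_level_le {P Q D : ℝ} (hP0 : 0 < P) (hP1 : P < 1) (hQ : 0 < Q)
    (hD : 1 ≤ D) (hPQ : D < P + Q) :
    ∃ l : ℝ, 0 < l ∧ l < 1 / 2 ∧ ∀ S : ℝ, 0 ≤ S → ∃ K : ℝ, 0 < K ∧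
      ∀ (V : Type) [Fintype V] (G : KilledGraph V), G.SobolevBound D Q S →
        ∀ v, G.IsDensity v → ∀ (j : ℕ) (T : ℝ), 0 ≤ T → T ≤ 4 →
          ∫ s in (0 : ℝ)..T, level j (v s) ^ P ≤ K * l ^ j := by
  obtain ⟨l, hl0, hl1, hl⟩ := exists_rpow_le_of_rpow_le hP0 hP1 hQ hD hPQ
  refine ⟨l, hl0, hl1, fun S hS => ?_⟩
  obtain ⟨C, hC0, hC⟩ := hl S hS
  -- The first term covers levels 0 and 1 by the trivial bound 4; the second gives `C ≤ K / 2 * l ^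
  -- 2`, which closes the induction.
  refine ⟨4 / l + 2 * C / l ^ 2, by positivity, ?_⟩
  set K := 4 / l + 2 * C / l ^ 2 with hK
  have hK0 : 0 < K := by positivity
  intro V _ G hG v hv j T hT0 hT4
  have hcont := fun j => continuous_level_rpow j hv.continuous hP0.le
  have hint : ∀ j, IntervalIntegrable (fun s => level j (v s) ^ P) volume 0 T :=
    fun j => (hcont j).intervalIntegrable _ _
  have base : ∀ j, ∫ s in (0 : ℝ)..T, level j (v s) ^ P ≤ 4 := by
    intro j
    calc ∫ s in (0 : ℝ)..T, level j (v s) ^ P ≤ ∫ _s in (0 : ℝ)..T, (1 : ℝ) :=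
          intervalIntegral.integral_mono_on hT0 (hint j) (by simp) fun s _ =>
            Real.rpow_le_one (level_nonneg _ _) (level_le_one _ _) hP0.le
      _ ≤ 4 := by simpa using hT4
  induction j using Nat.twoStepInduction with
  | zero =>
    refine (base 0).trans ?_
    rw [pow_zero, mul_one, hK]
    have : 4 ≤ 4 / l := by rw [le_div_iff₀ hl0]; linarith
    have : 0 ≤ 2 * C / l ^ 2 := by positivity
    linarith
  | one =>
    refine (base 1).trans ?_
    rw [pow_one, hK, add_mul, div_mul_cancel₀ _ hl0.ne']
    have : 0 ≤ 2 * C / l ^ 2 * l := by positivity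
    linarith
  | more j ih _ =>
    set e : ℝ → ℝ := fun s => G.form (fun x => slice (2 ^ (j + 1)) (2 ^ (j + 2)) (v s x))
        (fun x => slice (2 ^ (j + 1)) (2 ^ (j + 2)) (v s x)) / Fintype.card V / 2 ^ (j + 1) with he
    have hsl : Continuous fun s => fun x => slice (2 ^ (j + 1)) (2 ^ (j + 2)) (v s x) :=
      continuous_pi fun x => (continuous_slice _ _).comp (hv.isHeat.continuous_apply x)
    have hec : Continuous e := ((continuous_form hsl hsl).div_const _).div_const _
    have hei : ∫ s in (0 : ℝ)..T, e s ≤ 1 := by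
      rw [he, intervalIntegral.integral_div, div_le_one (by positivity)]
      exact (hv.isHeat.integral_form_slice_le hv.init_nonneg hv.init_avg (by positivity)
        (two_pow_le_succ (j + 1)) hT0).trans (two_pow_succ_sub (j + 1)).le
    calc ∫ s in (0 : ℝ)..T, level (j + 2) (v s) ^ P
        ≤ ∫ s in (0 : ℝ)..T, (C * l ^ j * e s + l ^ 2 / 2 * level j (v s) ^ P) := by
          refine intervalIntegral.integral_mono_on hT0 (hint _)
            (((hec.const_mul _).add ((hcont j).const_mul _)).intervalIntegrable _ _) fun s hs => ?_
          refine hC j (e s) _ _ ?_ (level_nonneg _ _)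
            (level_le_pow j (hv.nonneg hs.1) (hv.avg_le hs.1)) (level_nonneg _ _)
            (hG.level_rpow_le hS (by linarith) hQ.le _ _)
          exact div_nonneg (div_nonneg (G.form_nonneg _) (Nat.cast_nonneg _)) (by positivity)
      _ = C * l ^ j * (∫ s in (0 : ℝ)..T, e s) +
            l ^ 2 / 2 * ∫ s in (0 : ℝ)..T, level j (v s) ^ P := by
          rw [intervalIntegral.integral_add ((hec.const_mul _).intervalIntegrable _ _)
            (((hcont j).const_mul _).intervalIntegrable _ _), intervalIntegral.integral_const_mul,
            intervalIntegral.integral_const_mul]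
      _ ≤ C * l ^ j * 1 + l ^ 2 / 2 * (K * l ^ j) := by gcongr
      _ ≤ K * l ^ (j + 2) := by
          have h1 : C ≤ K / 2 * l ^ 2 := by
            rw [← div_le_iff₀ (by positivity), hK]
            have : 0 < 4 / l := by positivity
            have e2 : 2 * C / l ^ 2 = 2 * (C / l ^ 2) := by ring
            linarith
          rw [pow_add]
          have hlj : 0 < l ^ j := by positivity
          nlinarith

/-- The dual bound of a density has bounded time integral. -/
theorem exists_integral_dualBound_le {P Q D : ℝ} (hP0 : 0 < P) (hP1 : P < 1) (hQ : 0 < Q)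
    (hD : 1 ≤ D) (hPQ : D < P + Q) (S : ℝ) (hS : 0 ≤ S) :
    ∃ K : ℝ, 0 < K ∧ ∀ (V : Type) [Fintype V] (G : KilledGraph V), G.SobolevBound D Q S →
      ∀ v, G.IsDensity v → ∀ T : ℝ, 0 ≤ T → T ≤ 4 →
        ∫ s in (0 : ℝ)..T, dualBound (Fintype.card V) P (v s) ≤ K := by
  obtain ⟨l, hl0, hl1, hl⟩ := exists_integral_level_le hP0 hP1 hQ hD hPQ
  obtain ⟨K, hK0, hK⟩ := hl S hS
  have h2l : 0 < 1 - 2 * l := by linarith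
  refine ⟨4 + K * (1 / (1 - 2 * l)), by positivity, ?_⟩
  intro V _ G hG v hv T hT0 hT4
  have hcont := fun j => continuous_level_rpow j hv.continuous hP0.le
  unfold dualBound
  rw [intervalIntegral.integral_add (by simp)
    ((continuous_finsetSum _ fun j _ => (hcont j).const_mul _).intervalIntegrable _ _),
    intervalIntegral.integral_finsetSum fun j _ => ((hcont j).const_mul _).intervalIntegrable _ _]
  simp only [intervalIntegral.integral_const_mul, intervalIntegral.integral_const, sub_zero,
    smul_eq_mul, mul_one]
  refine add_le_add hT4 ?_
  calc ∑ j ∈ Finset.range (Fintype.card V), 2 ^ j * ∫ s in (0 : ℝ)..T, level j (v s) ^ P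
      ≤ ∑ j ∈ Finset.range (Fintype.card V), K * (2 * l) ^ j := by
        refine Finset.sum_le_sum fun j _ => ?_
        calc _ ≤ 2 ^ j * (K * l ^ j) :=
              mul_le_mul_of_nonneg_left (hK V G hG v hv j T hT0 hT4) (by positivity)
          _ = _ := by rw [mul_pow]; ring
    _ ≤ _ := by
        rw [← Finset.mul_sum]
        gcongr
        exact geom_sum_range_le (by positivity) (by linarith) _

end KilledGraph

/-! ### Retention of mass for a short time. -/

namespace KilledGraph

/-- Endpoints of the levels used to decompose a nonnegative function. -/
def levelEnd (i : ℕ) : ℝ := if i = 0 then 0 else 2 ^ (i - 1)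

theorem levelEnd_nonneg (i : ℕ) : 0 ≤ levelEnd i := by
  unfold levelEnd; split_ifs <;> positivity

theorem levelEnd_succ (i : ℕ) : levelEnd (i + 1) = 2 ^ i := by simp [levelEnd]

theorem levelEnd_le_succ (i : ℕ) : levelEnd i ≤ levelEnd (i + 1) := by
  rw [levelEnd_succ]
  rcases i with _ | i
  · simp [levelEnd]
  · rw [levelEnd_succ]; exact two_pow_le_succ i

theorem levelEnd_succ_sub_le (i : ℕ) : levelEnd (i + 1) - levelEnd i ≤ 2 ^ i := by
  rw [levelEnd_succ]; linarith [levelEnd_nonneg i]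

theorem eq_sum_slice_levelEnd {J : ℕ} {s : ℝ} (h0 : 0 ≤ s) (h : s ≤ 2 ^ J) :
    s = ∑ i ∈ Finset.range (J + 1), slice (levelEnd i) (levelEnd (i + 1)) s := by
  have : ∑ i ∈ Finset.range (J + 1), slice (levelEnd i) (levelEnd (i + 1)) s =
      min s (levelEnd (J + 1)) - min s (levelEnd 0) := by
    unfold slice
    exact Finset.sum_range_sub (fun i => min s (levelEnd i)) (J + 1)
  rw [this, levelEnd_succ, min_eq_left h]
  simp [levelEnd, h0]

/-- Mass is preserved up to an error of `1 / 2` for a short time, when tested against a cutoff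
whose energy density is bounded in `L^p`. -/
theorem exists_avg_mul_sub_le {p Q D : ℝ} (hp : 1 < p) (hQ : 0 < Q)
    (hD : 1 ≤ D) (hPQ : D < 1 - 1 / p + Q) (S : ℝ) (hS : 0 ≤ S) (W : ℝ) (hW : 0 ≤ W) :
    ∃ ε : ℝ, 0 < ε ∧ ε ≤ 1 ∧ ∀ (V : Type) [Fintype V] (G : KilledGraph V),
      G.SobolevBound D Q S → ∀ v, G.IsDensity v → ∀ f : V → ℝ,
        avg (fun x => G.density f x ^ p) ≤ W ^ p → ∀ t : ℝ, 0 ≤ t → t ≤ ε →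
          avg (fun x => f x * v 0 x) - 1 / 2 ≤ avg (fun x => f x * v t x) := by
  set P : ℝ := 1 - 1 / p with hP
  have hp0 : 0 < p := by linarith
  have hP0 : 0 < P := by
    rw [hP, sub_pos, div_lt_one hp0]; exact hp
  have hP1 : P < 1 := by
    have : 0 < 1 / p := by positivity
    linarith
  obtain ⟨l, hl0, hl1, hl⟩ := exists_integral_level_le hP0 hP1 hQ hD hPQ
  obtain ⟨K₀, hK0, hK⟩ := hl S hS
  set K := max K₀ 1 / l ^ 2 with hKdef
  -- Intermediate rates with `l < y` and `2 * y < z < 1`, possible because `l < 1 / 2`. The energies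
  -- of the slices will sum like `z ^ i` and the cutoff terms like `θ ^ i`.
  set y := (1 + 4 * l) / 6 with hy
  set z := 2 * (1 + l) / 3 with hz
  have hz0 : 0 < z := by positivity
  have hz1 : z < 1 := by linarith
  have hly : l < y := by linarith
  have hy0 : 0 < y := hl0.trans hly
  have hy1 : y < 1 := by linarith
  set θ := 2 * y / z with hθ
  have hθ0 : 0 ≤ θ := by positivity
  have hθ1 : θ < 1 := (div_lt_one hz0).2 (by linarith)
  have h1z : 0 < 1 - z := by linarith
  have h1θ : 0 < 1 - θ := by linarith
  -- `η` and `δ` make each of the two final geometric sums at most `1 / 4`.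
  set η := (1 - z) / 2 with hη
  have hη0 : 0 < η := by positivity
  set δ := η * (1 - θ) / (2 * (W + 1)) with hδ
  have hδ0 : 0 < δ := by positivity
  obtain ⟨ε, hε0, hε1, hε⟩ := exists_min_le_geometric (K := K) hl0 hly hy1 hδ0
  refine ⟨ε, hε0, hε1, ?_⟩
  intro V _ G hG v hv f hf t ht0 htε
  set n : ℝ := (Fintype.card V : ℝ) with hn
  have hn0 : 0 ≤ n := by positivity
  set J := Fintype.card V with hJ
  set sl : ℕ → ℝ → V → ℝ := fun i s x => slice (levelEnd i) (levelEnd (i + 1)) (v s x) with hsl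
  -- A bound for the proportion above `levelEnd i`, raised to the power `P`. The shift by two arises
  -- because `levelEnd (j + 2) = 2 ^ (j + 1)` is controlled by `level j`.
  set Y : ℕ → ℝ → ℝ := fun i s => if i ≤ 1 then 1 else level (i - 2) (v s) ^ P with hY
  have hYc : ∀ i, Continuous (Y i) := by
    intro i
    by_cases h : i ≤ 1
    · simp only [hY, h, if_true]; fun_prop
    · simp only [hY, h, if_false]
      exact continuous_level_rpow _ hv.continuous hP0.le
  have hY1 : ∀ i s, Y i s ≤ 1 := by
    intro i s
    simp only [hY]
    split_ifs
    · exact le_rfl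
    · exact Real.rpow_le_one (level_nonneg _ _) (level_le_one _ _) hP0.le
  have hYi : ∀ i, ∫ s in (0 : ℝ)..t, Y i s ≤ δ * y ^ i := by
    intro i
    refine le_trans (le_min ?_ ?_) (hε i)
    · calc ∫ s in (0 : ℝ)..t, Y i s ≤ ∫ _s in (0 : ℝ)..t, (1 : ℝ) :=
            intervalIntegral.integral_mono_on ht0 ((hYc i).intervalIntegrable _ _) (by simp)
              fun s _ => hY1 i s
        _ ≤ ε := by simpa using htε
    · have hK1 : 1 ≤ max K₀ 1 := le_max_right _ _
      by_cases h : i ≤ 1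
      · simp only [hY, h, if_true]
        have h1 : l ^ 2 ≤ l ^ i := pow_le_pow_of_le_one hl0.le (by linarith) (by omega)
        have h2 : 1 ≤ K * l ^ i := by
          rw [hKdef, div_mul_eq_mul_div, le_div_iff₀ (by positivity), one_mul]
          nlinarith [pow_pos hl0 i]
        simpa using (htε.trans hε1).trans h2
      · obtain ⟨j, rfl⟩ : ∃ j, i = j + 2 := ⟨i - 2, by omega⟩
        simp only [hY, h, if_false, Nat.add_sub_cancel]
        refine (hK V G hG v hv j t ht0 (by linarith)).trans ?_
        have e : K * l ^ (j + 2) = max K₀ 1 * l ^ j := by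
          rw [hKdef, pow_add]; field_simp
        rw [e]
        gcongr
        exact le_max_left _ _
  have hslc : ∀ i, Continuous (sl i) := fun i =>
    continuous_pi fun x => (continuous_slice _ _).comp (hv.isHeat.continuous_apply x)
  have hEi : ∀ i, ∫ s in (0 : ℝ)..t, G.form (sl i s) (sl i s) / n ≤ 2 ^ i := fun i =>
    (hv.isHeat.integral_form_slice_le hv.init_nonneg hv.init_avg (levelEnd_nonneg i)
      (levelEnd_le_succ i) ht0).trans (levelEnd_succ_sub_le i)
  have hind : ∀ i s, 0 ≤ s → avg ({x | levelEnd i < v s x}.indicator (G.density f)) ≤ W * Y i s := by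
    intro i s hs
    have e : ({x | levelEnd i < v s x}.indicator (G.density f)) =
        fun x => {x | levelEnd i < v s x}.indicator 1 x * G.density f x := by
      funext x
      by_cases h : levelEnd i < v s x <;> simp [h]
    rw [e]
    refine (avg_mul_le hp (fun x => Set.indicator_nonneg (by simp) x)
      (fun x => Set.indicator_apply_le' (by simp) (by simp)) (G.density_nonneg f) hW hf).trans ?_
    rw [mul_comm]
    refine mul_le_mul_of_nonneg_left ?_ hW
    by_cases h : i ≤ 1
    · simp only [hY, h, if_true]
      exact Real.rpow_le_one (frac_nonneg _) (frac_le_one _) hP0.le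
    · obtain ⟨j, rfl⟩ : ∃ j, i = j + 2 := ⟨i - 2, by omega⟩
      simp only [hY, h, if_false, Nat.add_sub_cancel]
      refine Real.rpow_le_rpow (frac_nonneg _) (le_trans (frac_mono fun x hx => ?_)
        (frac_le_level j (v s))) hP0.le
      rw [mem_ofPred_eq, levelEnd_succ] at hx
      exact le_of_lt hx
  -- Young's parameter for slice `i`: multiplied by the energy bound `2 ^ i` it leaves `η * z ^ i`.
  have hs0 : ∀ i : ℕ, 0 < η * (z / 2) ^ i := fun i => by positivity
  have hform : ∀ s, 0 ≤ s → G.form f (v s) / n ≤ ∑ i ∈ Finset.range (J + 1),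
      (η * (z / 2) ^ i / 2 * (G.form (sl i s) (sl i s) / n) +
        W / (2 * (η * (z / 2) ^ i)) * Y i s) := by
    intro s hs
    have e : v s = fun x => ∑ i ∈ Finset.range (J + 1), sl i s x := by
      funext x
      exact eq_sum_slice_levelEnd (hv.nonneg hs x)
        (le_two_pow_card (hv.nonneg hs) (hv.avg_le hs) x)
    conv_lhs => rw [e]
    rw [G.form_sum, Finset.sum_div]
    refine Finset.sum_le_sum fun i _ => ?_
    have h1 := G.form_le (hs0 i) f (sl i s) {x | levelEnd i < v s x} fun x hx =>
      slice_of_le (levelEnd_le_succ i) (not_lt.1 hx)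
    have h2 := hind i s hs
    calc G.form f (sl i s) / n ≤ _ := div_le_div_of_nonneg_right h1 hn0
      _ = η * (z / 2) ^ i / 2 * (G.form (sl i s) (sl i s) / n) + 1 / (2 * (η * (z / 2) ^ i)) *
            avg ({x | levelEnd i < v s x}.indicator (G.density f)) := by
          rw [avg]; ring
      _ ≤ η * (z / 2) ^ i / 2 * (G.form (sl i s) (sl i s) / n) + 1 / (2 * (η * (z / 2) ^ i)) *
            (W * Y i s) := by
          have := hs0 i
          gcongr
      _ = _ := by ring
  have hcE : ∀ i, Continuous fun s => G.form (sl i s) (sl i s) / n := fun i =>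
    (continuous_form (hslc i) (hslc i)).div_const _
  have hd : ∀ s, HasDerivAt (fun s => avg (fun x => f x * v s x)) (-G.form f (v s) / n) s :=
    fun s => (hv.isHeat.hasDerivAt_sum_mul f s).div_const _
  have hfc : Continuous fun s => G.form f (v s) / n :=
    (continuous_form continuous_const hv.continuous).div_const _
  have hfc' : Continuous fun s => -G.form f (v s) / n := by
    simp only [neg_div]
    exact hfc.neg
  have hF := intervalIntegral.integral_eq_sub_of_hasDerivAt (a := 0) (b := t) (fun s _ => hd s)
    (hfc'.intervalIntegrable _ _)
  simp only [neg_div, intervalIntegral.integral_neg] at hF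
  have hcE' : ∀ i, IntervalIntegrable (fun s => η * (z / 2) ^ i / 2 *
      (G.form (sl i s) (sl i s) / n)) volume 0 t :=
    fun i => ((hcE i).const_mul _).intervalIntegrable _ _
  have hcY' : ∀ i, IntervalIntegrable (fun s => W / (2 * (η * (z / 2) ^ i)) * Y i s) volume 0 t :=
    fun i => ((hYc i).const_mul _).intervalIntegrable _ _
  have hcsum : Continuous fun s => ∑ i ∈ Finset.range (J + 1),
      (η * (z / 2) ^ i / 2 * (G.form (sl i s) (sl i s) / n) +
        W / (2 * (η * (z / 2) ^ i)) * Y i s) :=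
    continuous_finsetSum _ fun i _ => ((hcE i).const_mul _).add ((hYc i).const_mul _)
  have hI : ∫ s in (0 : ℝ)..t, G.form f (v s) / n ≤ 1 / 2 := by
    calc ∫ s in (0 : ℝ)..t, G.form f (v s) / n ≤ _ :=
          intervalIntegral.integral_mono_on ht0 (hfc.intervalIntegrable _ _)
            (hcsum.intervalIntegrable _ _) fun s hs => hform s hs.1
      _ = ∑ i ∈ Finset.range (J + 1), (η * (z / 2) ^ i / 2 *
            (∫ s in (0 : ℝ)..t, G.form (sl i s) (sl i s) / n) +
            W / (2 * (η * (z / 2) ^ i)) * ∫ s in (0 : ℝ)..t, Y i s) := by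
          rw [intervalIntegral.integral_finsetSum fun i _ => (hcE' i).add (hcY' i)]
          refine Finset.sum_congr rfl fun i _ => ?_
          rw [intervalIntegral.integral_add (hcE' i) (hcY' i),
            intervalIntegral.integral_const_mul, intervalIntegral.integral_const_mul]
      _ ≤ ∑ i ∈ Finset.range (J + 1), (η / 2 * z ^ i + W * δ / (2 * η) * θ ^ i) := by
          refine Finset.sum_le_sum fun i _ => ?_
          have h1 := hEi i
          have h2 := hYi i
          have := hs0 i
          calc _ ≤ η * (z / 2) ^ i / 2 * 2 ^ i + W / (2 * (η * (z / 2) ^ i)) * (δ * y ^ i) := by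
                gcongr
            _ = _ := by
                have e1 : θ ^ i = 2 ^ i * y ^ i / z ^ i := by rw [hθ, div_pow, mul_pow]
                rw [e1, div_pow z 2 i]
                have hzi : 0 < z ^ i := by positivity
                generalize z ^ i = zi at hzi
                field_simp
      _ ≤ η / 2 * (1 / (1 - z)) + W * δ / (2 * η) * (1 / (1 - θ)) := by
          rw [Finset.sum_add_distrib, ← Finset.mul_sum, ← Finset.mul_sum]
          gcongr
          · exact geom_sum_range_le hz0.le hz1 _
          · exact geom_sum_range_le hθ0 hθ1 _
      _ ≤ 1 / 4 + 1 / 4 := by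
          refine add_le_add ?_ ?_
          · rw [hη]; field_simp; norm_num
          · have : W * δ / (2 * η) * (1 / (1 - θ)) = W / (W + 1) * (1 / 4) := by
              rw [hδ]; field_simp; norm_num
            rw [this]
            have : W / (W + 1) ≤ 1 := by rw [div_le_one (by positivity)]; linarith
            linarith
      _ = 1 / 2 := by norm_num
  linarith

end KilledGraph

/-! ### Inequalities for the logarithm and choice of a good time. -/

theorem sq_log_le {s : ℝ} (hs : 0 < s) : Real.log s ^ 2 ≤ s + 1 / s - 2 := by
  -- With `s = exp (2 * x)` the right-hand side is `4 * sinh x ^ 2`, and `|x| ≤ |sinh x|`.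
  set x := Real.log s / 2 with hx
  have h1 : x ^ 2 ≤ Real.sinh x ^ 2 := by
    rcases le_total 0 x with h | h
    · exact pow_le_pow_left₀ h (Real.self_le_sinh_iff.2 h) 2
    · have := Real.sinh_le_self_iff.2 h
      nlinarith
  have e1 : Real.exp x * Real.exp x = s := by
    rw [← Real.exp_add, hx, add_halves, Real.exp_log hs]
  have hp := Real.exp_pos x
  have e2 : s + 1 / s - 2 = 4 * Real.sinh x ^ 2 := by
    rw [Real.sinh_eq, Real.exp_neg, ← e1]
    field_simp
    ring
  rw [e2]
  have : Real.log s = 2 * x := by rw [hx]; ring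
  rw [this]
  nlinarith

/-- The elementary inequality behind the energy estimate for the logarithm. -/
theorem log_energy_le {a b : ℝ} (ha : 0 < a) (hb : 0 < b) {α β : ℝ} (hα : 0 ≤ α) (hβ : 0 ≤ β) :
    (a - b) * (α ^ 2 / a - β ^ 2 / b) ≤
      3 * (α - β) ^ 2 - 1 / 2 * (min α β ^ 2 * (Real.log a - Real.log b) ^ 2) := by
  have key : ∀ a b α β : ℝ, 0 < a → 0 < b → 0 ≤ β → β ≤ α →
      (a - b) * (α ^ 2 / a - β ^ 2 / b) ≤
        3 * (α - β) ^ 2 - 1 / 2 * (β ^ 2 * (Real.log a - Real.log b) ^ 2) := by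
    intro a b α β ha hb hβ hαβ
    set s := a / b with hs
    have hs0 : 0 < s := by positivity
    have h1 : (a - b) * (α ^ 2 / a - β ^ 2 / b) = α ^ 2 + β ^ 2 - β ^ 2 * s - α ^ 2 * (1 / s) := by
      rw [hs]; field_simp; ring
    have h2 : Real.log a - Real.log b = Real.log s := by rw [hs, Real.log_div ha.ne' hb.ne']
    rw [h1, h2]
    have h3 := mul_le_mul_of_nonneg_left (sq_log_le hs0) (sq_nonneg β)
    obtain ⟨γ, rfl⟩ : ∃ γ, α = β + γ := ⟨α - β, by ring⟩
    have hγ : 0 ≤ γ := by linarith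
    set r := 1 / s with hr
    have hr0 : 0 < r := by positivity
    have hrs : r * s = 1 := by rw [hr]; field_simp
    suffices h : 0 ≤ 1 / 2 * (β ^ 2 * (s + r - 2)) + 2 * (β * γ) * (r - 1) + 2 * γ ^ 2 by
      nlinarith [mul_nonneg (sq_nonneg γ) hr0.le]
    rcases le_total s 1 with h | h
    · have : 1 ≤ r := by rw [hr, le_div_iff₀ hs0]; linarith
      have h5 : 0 ≤ s + r - 2 := (sq_nonneg _).trans (sq_log_le hs0)
      have h6 : 0 ≤ 2 * (β * γ) * (r - 1) := mul_nonneg (by positivity) (by linarith)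
      positivity
    · have hr1 : r ≤ 1 := by rw [hr, div_le_one hs0]; exact h
      -- Since `r * s = 1`, one has `s + r - 2 = s * (1 - r) ^ 2`. With this lower bound the claim
      -- becomes half the square of `β * (1 - r) - 2 * γ`.
      have h5 : (1 - r) ^ 2 ≤ s + r - 2 := by
        have e : s + r - 2 - (1 - r) ^ 2 = (s - 1) * (1 - r) ^ 2 + (r * s - 1) * (3 - r - s + s * 0)
            + (s * r - 1) * (s - 1 - 1 + r) := by
          ring_nf
          nlinarith
        nlinarith [mul_nonneg (sub_nonneg.2 h) (sq_nonneg (1 - r))]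
      have h6 := mul_le_mul_of_nonneg_left h5 (sq_nonneg β)
      nlinarith [sq_nonneg (β * (1 - r) - 2 * γ)]
  rcases le_total β α with h | h
  · rw [min_eq_right h]
    exact key a b α β ha hb hβ h
  · rw [min_eq_left h]
    have := key b a β α hb ha hα h
    nlinarith

/-- Otherwise `f / A + g / B` is at least `3 / ε` throughout and has integral at least 3, while the
hypotheses bound it by 2. -/
theorem exists_le_of_integral_le {f g : ℝ → ℝ} {ε A B : ℝ} (hε : 0 < ε) (hA : 0 < A) (hB : 0 < B)
    (hf : ContinuousOn f (Icc 0 ε)) (hg : ContinuousOn g (Icc 0 ε))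
    (hf0 : ∀ t ∈ Icc 0 ε, 0 ≤ f t) (hg0 : ∀ t ∈ Icc 0 ε, 0 ≤ g t)
    (hfA : ∫ t in (0 : ℝ)..ε, f t ≤ A) (hgB : ∫ t in (0 : ℝ)..ε, g t ≤ B) :
    ∃ t ∈ Icc 0 ε, f t ≤ 3 * A / ε ∧ g t ≤ 3 * B / ε := by
  by_contra! h
  have hfi : IntervalIntegrable f volume 0 ε := by
    apply ContinuousOn.intervalIntegrable; rwa [uIcc_of_le hε.le]
  have hgi : IntervalIntegrable g volume 0 ε := by
    apply ContinuousOn.intervalIntegrable; rwa [uIcc_of_le hε.le]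
  have h1 : ∫ _t in (0 : ℝ)..ε, 3 / ε ≤ ∫ t in (0 : ℝ)..ε, (f t / A + g t / B) := by
    refine intervalIntegral.integral_mono_on hε.le (by simp)
      ((hfi.div_const _).add (hgi.div_const _)) fun t ht => ?_
    have hfa : 0 ≤ f t / A := div_nonneg (hf0 t ht) hA.le
    have hgb : 0 ≤ g t / B := div_nonneg (hg0 t ht) hB.le
    by_cases hc : f t ≤ 3 * A / ε
    · have := h t ht hc
      have : 3 / ε ≤ g t / B := by
        rw [le_div_iff₀ hB]
        calc 3 / ε * B = 3 * B / ε := by ring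
          _ ≤ g t := this.le
      linarith
    · push Not at hc
      have : 3 / ε ≤ f t / A := by
        rw [le_div_iff₀ hA]
        calc 3 / ε * A = 3 * A / ε := by ring
          _ ≤ f t := hc.le
      linarith
  rw [intervalIntegral.integral_add (hfi.div_const _) (hgi.div_const _),
    intervalIntegral.integral_const, sub_zero, smul_eq_mul, mul_div_cancel₀ _ hε.ne',
    intervalIntegral.integral_div, intervalIntegral.integral_div] at h1
  have h2 : (∫ t in (0 : ℝ)..ε, f t) / A ≤ 1 := by rwa [div_le_one hA]
  have h3 : (∫ t in (0 : ℝ)..ε, g t) / B ≤ 1 := by rwa [div_le_one hB]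
  linarith

/-! ### Logarithmic energy and lower bounds for densities. -/

namespace KilledGraph

variable {V : Type*} [Fintype V] {G : KilledGraph V}

/-- The energy of `g` weighted by a cutoff `f`. -/
def cutoffEnergy (G : KilledGraph V) (f g : V → ℝ) : ℝ :=
  (∑ x, ∑ y, G.c x y * (min (f x) (f y) ^ 2 * (g x - g y) ^ 2)) / Fintype.card V

theorem cutoffEnergy_nonneg (f g : V → ℝ) : 0 ≤ G.cutoffEnergy f g :=
  div_nonneg (Finset.sum_nonneg fun x _ => Finset.sum_nonneg fun y _ =>
    mul_nonneg (G.c_nonneg x y) (by positivity)) (Nat.cast_nonneg _)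

theorem cutoffEnergy_mono (f : V → ℝ) {g h : V → ℝ} (hgh : ∀ x y, |g x - g y| ≤ |h x - h y|) :
    G.cutoffEnergy f g ≤ G.cutoffEnergy f h := by
  refine div_le_div_of_nonneg_right (Finset.sum_le_sum fun x _ => Finset.sum_le_sum fun y _ =>
    mul_le_mul_of_nonneg_left (mul_le_mul_of_nonneg_left ?_ (sq_nonneg _)) (G.c_nonneg x y))
    (Nat.cast_nonneg _)
  exact sq_le_sq.2 (hgh x y)

variable {v : ℝ → V → ℝ}

theorem IsDensity.continuousOn_log (hv : G.IsDensity v) {δ : ℝ} (hδ : 0 < δ) (x : V) :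
    ContinuousOn (fun t => Real.log (v t x + δ)) (Ici 0) :=
  ContinuousOn.log ((hv.isHeat.continuous_apply x).continuousOn.add continuousOn_const)
    fun _ ht => (add_pos_of_nonneg_of_pos (hv.nonneg ht x) hδ).ne'

theorem IsDensity.continuousOn_cutoffEnergy (hv : G.IsDensity v) {δ : ℝ} (hδ : 0 < δ)
    (f : V → ℝ) :
    ContinuousOn (fun t => G.cutoffEnergy f fun x => Real.log (v t x + δ)) (Ici 0) :=
  (continuousOn_finsetSum _ fun x _ => continuousOn_finsetSum _ fun y _ =>
    continuousOn_const.mul (continuousOn_const.mul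
      (((hv.continuousOn_log hδ x).sub (hv.continuousOn_log hδ y)).pow 2))).div_const _

/-- The test function is `f ^ 2 / (u + δ)`: edges are treated by `log_energy_le`, and killing costs
at most `f ^ 2` per unit rate. The shift `δ` keeps the logarithm finite where `u` vanishes. -/
theorem neg_form_log_ge (f u : V → ℝ) (hf : ∀ x, 0 ≤ f x) (hu : ∀ x, 0 ≤ u x) {δ : ℝ}
    (hδ : 0 < δ) :
    1 / 4 * G.cutoffEnergy f (fun x => Real.log (u x + δ)) - 3 / 2 * avg (G.density f) ≤
      -G.form u (fun x => f x ^ 2 / (u x + δ)) / Fintype.card V := by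
  unfold cutoffEnergy avg form density
  rw [mul_div_assoc', mul_div_assoc', ← sub_div]
  refine div_le_div_of_nonneg_right ?_ (Nat.cast_nonneg _)
  have hp : ∀ x, 0 < u x + δ := fun x => add_pos_of_nonneg_of_pos (hu x) hδ
  have h1 : ∑ x, ∑ y, G.c x y * ((u x - u y) * (f x ^ 2 / (u x + δ) - f y ^ 2 / (u y + δ))) ≤
      3 * ∑ x, ∑ y, G.c x y * (f x - f y) ^ 2 - 1 / 2 * ∑ x, ∑ y, G.c x y *
        (min (f x) (f y) ^ 2 * (Real.log (u x + δ) - Real.log (u y + δ)) ^ 2) := by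
    simp only [Finset.mul_sum, ← Finset.sum_sub_distrib]
    refine Finset.sum_le_sum fun x _ => Finset.sum_le_sum fun y _ => ?_
    have := mul_le_mul_of_nonneg_left (log_energy_le (hp x) (hp y) (hf x) (hf y)) (G.c_nonneg x y)
    rw [add_sub_add_right_eq_sub] at this
    linarith
  have h2 : ∑ x, G.k x * (u x * (f x ^ 2 / (u x + δ))) ≤ ∑ x, G.k x * f x ^ 2 := by
    refine Finset.sum_le_sum fun x _ => mul_le_mul_of_nonneg_left ?_ (G.k_nonneg x)
    rw [mul_div_assoc', div_le_iff₀ (hp x), mul_comm]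
    exact mul_le_mul_of_nonneg_left (by linarith) (sq_nonneg _)
  have h3 : 0 ≤ ∑ x, G.k x * f x ^ 2 :=
    Finset.sum_nonneg fun x _ => mul_nonneg (G.k_nonneg x) (sq_nonneg _)
  rw [Finset.sum_add_distrib]
  linarith

/-- Energy estimate for the logarithm of a density. -/
theorem IsDensity.integral_cutoffEnergy_le (hv : G.IsDensity v) {f : V → ℝ} (hf : ∀ x, 0 ≤ f x)
    {W : ℝ} (hW : avg (G.density f) ≤ W) {δ : ℝ} (hδ : 0 < δ) {s t : ℝ} (hs : 0 ≤ s)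
    (hst : s ≤ t) :
    1 / 4 * (∫ r in s..t, G.cutoffEnergy f fun x => Real.log (v r x + δ)) ≤
      avg (fun x => f x ^ 2 * Real.log (v t x + δ)) -
        avg (fun x => f x ^ 2 * Real.log (v s x + δ)) + 3 / 2 * W * (t - s) := by
  have hsub : uIcc s t ⊆ Ici 0 := by
    rw [uIcc_of_le hst]; exact fun r hr => hs.trans hr.1
  have hp : ∀ r ∈ Ici (0 : ℝ), ∀ x, 0 < v r x + δ := fun r hr x =>
    add_pos_of_nonneg_of_pos (hv.nonneg hr x) hδ
  have hd : ∀ r ∈ uIcc s t, HasDerivAt (fun r => avg (fun x => f x ^ 2 * Real.log (v r x + δ)))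
      (-G.form (v r) (fun x => f x ^ 2 / (v r x + δ)) / Fintype.card V) r := by
    intro r hr
    rw [← sum_mul_gen]
    refine HasDerivAt.div_const (HasDerivAt.fun_sum fun x _ => ?_) _
    have := (((hv.isHeat r x).add_const δ).log (hp r (hsub hr) x).ne').const_mul (f x ^ 2)
    exact this.congr_deriv (by ring)
  have hc : ContinuousOn (fun r => -G.form (v r) (fun x => f x ^ 2 / (v r x + δ)) /
      Fintype.card V) (Ici 0) := by
    refine ContinuousOn.div_const (ContinuousOn.neg ?_) _
    have hq : ∀ x, ContinuousOn (fun r => f x ^ 2 / (v r x + δ)) (Ici 0) := fun x =>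
      continuousOn_const.div ((hv.isHeat.continuous_apply x).continuousOn.add continuousOn_const)
        fun r hr => (hp r hr x).ne'
    have hvx := fun x => (hv.isHeat.continuous_apply x).continuousOn (s := Ici 0)
    exact ((continuousOn_finsetSum _ fun x _ => continuousOn_finsetSum _ fun y _ =>
      continuousOn_const.mul (((hvx x).sub (hvx y)).mul ((hq x).sub (hq y)))).div_const _).add
      (continuousOn_finsetSum _ fun x _ => continuousOn_const.mul ((hvx x).mul (hq x)))
  have hE := hv.continuousOn_cutoffEnergy hδ f
  have hEi := (hE.mono hsub).intervalIntegrable (μ := volume)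
  rw [← intervalIntegral.integral_eq_sub_of_hasDerivAt hd (hc.mono hsub).intervalIntegrable]
  have e : ∫ r in s..t, (1 / 4 * (G.cutoffEnergy f fun x => Real.log (v r x + δ)) - 3 / 2 * W) =
      1 / 4 * (∫ r in s..t, G.cutoffEnergy f fun x => Real.log (v r x + δ)) -
        3 / 2 * W * (t - s) := by
    rw [intervalIntegral.integral_sub (hEi.const_mul _) (by simp),
      intervalIntegral.integral_const_mul, intervalIntegral.integral_const, smul_eq_mul]
    ring
  have m := intervalIntegral.integral_mono_on (μ := volume) hst
    ((hEi.const_mul (1 / 4)).sub (by simp : IntervalIntegrable (fun _ => 3 / 2 * W) volume s t))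
    (hc.mono hsub).intervalIntegrable fun r hr => by
      have := neg_form_log_ge (G := G) f (v r) hf (hv.nonneg (hs.trans hr.1)) hδ
      have h2 : 1 / 4 * (G.cutoffEnergy f fun x => Real.log (v r x + δ)) - 3 / 2 * W ≤
        1 / 4 * (G.cutoffEnergy f fun x => Real.log (v r x + δ)) - 3 / 2 * avg (G.density f) := by
          linarith
      exact h2.trans this
  rw [e] at m
  linarith

/-- Cutoff functions `f ≤ g` adapted to `U ⊆ I`, with energy densities bounded in `L^p` by `W`, and
a Poincaré inequality on `I` with constant `A`. -/
structure Localized (G : KilledGraph V) (U I : Set V) (f g : V → ℝ) (p W A β : ℝ) : Prop where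
  f_nonneg : ∀ x, 0 ≤ f x
  f_le_one : ∀ x, f x ≤ 1
  g_nonneg : ∀ x, 0 ≤ g x
  g_le_one : ∀ x, g x ≤ 1
  f_eq_one : ∀ x ∈ U, f x = 1
  f_eq_zero : ∀ x, x ∉ I → f x = 0
  density_f : avg (fun x => G.density f x ^ p) ≤ W ^ p
  density_g : avg (fun x => G.density g x ^ p) ≤ W ^ p
  poincare : ∀ h : V → ℝ, avg (fun x => avg fun z => I.indicator 1 x * (I.indicator 1 z *
    |h x - h z|)) ^ 2 ≤ A * G.cutoffEnergy g h
  frac_ge : β ≤ frac U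

theorem avg_density_le {p : ℝ} (hp : 1 < p) {f : V → ℝ} {W : ℝ} (hW : 0 ≤ W)
    (h : avg (fun x => G.density f x ^ p) ≤ W ^ p) : avg (G.density f) ≤ W := by
  have h1 := avg_mul_le hp (a := fun _ : V => 1) (fun _ => zero_le_one) (fun _ => le_rfl)
    (G.density_nonneg f) hW h
  simp only [one_mul] at h1
  refine h1.trans (mul_le_of_le_one_left hW ?_)
  refine Real.rpow_le_one (avg_nonneg fun _ => zero_le_one) (avg_le_one fun _ => le_rfl) ?_
  rw [sub_nonneg, div_le_one (by linarith)]
  exact hp.le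

theorem mul_log_le {a s : ℝ} (ha0 : 0 ≤ a) (ha1 : a ≤ 1) (hs : 0 < s) : a ^ 2 * Real.log s ≤ s := by
  have h1 := Real.log_le_sub_one_of_pos hs
  have h2 : a ^ 2 ≤ 1 := pow_le_one₀ ha0 ha1
  rcases le_total 0 (Real.log s) with h | h
  · nlinarith
  · nlinarith [sq_nonneg a]

/-- A density started in `U` charges a definite proportion of `I`. -/
theorem IsDensity.le_frac (hv : G.IsDensity v) {U I : Set V} {f g : V → ℝ} {p W A β B : ℝ}
    (hp : 1 < p) (hG : G.Localized U I f g p W A β) (hB : 0 < B) {t : ℝ} (ht : 0 ≤ t)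
    (hm : 1 / 2 ≤ avg (fun x => f x * v t x))
    (hd : dualBound (Fintype.card V) (1 - 1 / p) (v t) ≤ B) :
    (1 / (4 * B)) ^ p ≤ frac {x | x ∈ I ∧ 1 / 4 < v t x} := by
  classical
  have hp0 : 0 < p := by linarith
  set E : Set V := {x | x ∈ I ∧ 1 / 4 < v t x} with hE
  have hV : Nonempty V := by
    by_contra hne
    rw [not_nonempty_iff] at hne
    simp [avg] at hm
    norm_num at hm
  have hvn := hv.nonneg ht
  have hEn := frac_nonneg E
  -- Values at most `1 / 4` carry at most `1 / 4` of the mass, so `E` carries the rest. The dual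
  -- bound against the indicator of `E` then prevents `E` from being small.
  have h1 : avg (fun x => f x * v t x) ≤ 1 / 4 + avg (fun x => v t x * E.indicator 1 x) := by
    rw [← avg_const (V := V) (1 / 4), ← avg_add]
    refine avg_mono fun x => ?_
    have h0 := hvn x
    by_cases hx : x ∈ I
    · by_cases h4 : 1 / 4 < v t x
      · have : x ∈ E := ⟨hx, h4⟩
        simp only [this, indicator_of_mem, Pi.one_apply, mul_one]
        have := mul_le_mul_of_nonneg_right (hG.f_le_one x) h0
        linarith
      · have : x ∉ E := fun h => h4 h.2
        simp only [this, not_false_eq_true, indicator_of_notMem, mul_zero, add_zero]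
        have := mul_le_mul_of_nonneg_right (hG.f_le_one x) h0
        linarith
    · have : x ∉ E := fun h => hx h.1
      rw [hG.f_eq_zero x hx]
      simp [this]
  have h2 := avg_mul_le_dualBound hp hvn (hv.avg_le ht) (g := E.indicator 1)
    (fun x => Set.indicator_nonneg (by simp) x) (F := frac E ^ (1 / p)) (by positivity) (by
      rw [← Real.rpow_mul hEn, one_div_mul_cancel hp0.ne', Real.rpow_one]
      refine le_of_eq (congrArg avg (funext fun x => ?_))
      by_cases hx : x ∈ E
      · simp [hx]
      · simp [hx, hp0.ne'])
  have h3 : 1 / (4 * B) ≤ frac E ^ (1 / p) := by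
    rw [div_le_iff₀ (by positivity)]
    have h4 := mul_le_mul_of_nonneg_right hd (by positivity : 0 ≤ frac E ^ (1 / p))
    linarith
  calc (1 / (4 * B)) ^ p ≤ (frac E ^ (1 / p)) ^ p := Real.rpow_le_rpow (by positivity) h3 hp0.le
    _ = frac E := by rw [← Real.rpow_mul hEn, one_div_mul_cancel hp0.ne', Real.rpow_one]

/-- From a definite proportion of `I` where `u` is not small, the Poincaré inequality controls the
negative part of `log u` on all of `I`. -/
theorem Localized.sq_avg_log_le {U I : Set V} {f g : V → ℝ} {p W A β : ℝ}
    (hG : G.Localized U I f g p W A β) {κ : ℝ} (hκ : 0 < κ) {u : V → ℝ}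
    {δ : ℝ} (hδ : 0 < δ) (hE : κ ≤ frac {x | x ∈ I ∧ 1 / 4 < u x}) :
    (κ * avg (I.indicator fun x => max (Real.log (1 / 4) - Real.log (u x + δ)) 0)) ^ 2 ≤
      A * G.cutoffEnergy g fun x => Real.log (u x + δ) := by
  classical
  set E : Set V := {x | x ∈ I ∧ 1 / 4 < u x} with hEdef
  set h : V → ℝ := fun x => max (Real.log (1 / 4) - Real.log (u x + δ)) 0 with hh
  have hh0 : ∀ x, 0 ≤ h x := fun x => le_max_right _ _
  have hA : 0 ≤ A * G.cutoffEnergy g h := (sq_nonneg _).trans (hG.poincare h)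
  have hIh : 0 ≤ avg (I.indicator h) := avg_nonneg fun x => Set.indicator_nonneg (fun x _ => hh0 x) x
  -- As `h` vanishes on `E`, the pairs `(x, z)` with `x ∈ E` contribute `h z` itself to the Poincaré
  -- integral.
  have hEz : ∀ x ∈ E, h x = 0 := by
    intro x hx
    refine max_eq_right (sub_nonpos.2 (Real.log_le_log (by norm_num) ?_))
    linarith [hx.2]
  have h1 : κ * avg (I.indicator h) ≤ avg (fun x => avg fun z => I.indicator 1 x *
      (I.indicator 1 z * |h x - h z|)) := by
    calc κ * avg (I.indicator h) ≤ frac E * avg (I.indicator h) := by gcongr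
      _ = avg fun x => avg (I.indicator h) * E.indicator 1 x := by
          rw [avg_const_mul, frac, mul_comm]
      _ ≤ _ := by
          refine avg_mono fun x => ?_
          by_cases hx : x ∈ E
          · rw [indicator_of_mem hx, Pi.one_apply, mul_one]
            refine avg_mono fun z => ?_
            rw [hEz x hx, indicator_of_mem hx.1, zero_sub, abs_neg, abs_of_nonneg (hh0 z)]
            by_cases hz : z ∈ I <;> simp [hz]
          · rw [indicator_of_notMem hx, mul_zero]
            exact avg_nonneg fun z => mul_nonneg (Set.indicator_nonneg (by simp) x)
              (mul_nonneg (Set.indicator_nonneg (by simp) z) (abs_nonneg _))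
  have hmono : G.cutoffEnergy g h ≤ G.cutoffEnergy g fun x => Real.log (u x + δ) := by
    refine cutoffEnergy_mono g fun x y => ?_
    refine (abs_max_sub_max_le_abs _ _ _).trans (le_of_eq ?_)
    rw [sub_sub_sub_cancel_left, abs_sub_comm]
  have hc := cutoffEnergy_nonneg (G := G) g fun x => Real.log (u x + δ)
  have h2 : (κ * avg (I.indicator h)) ^ 2 ≤ A * G.cutoffEnergy g h :=
    (pow_le_pow_left₀ (by positivity) h1 2).trans (hG.poincare h)
  rcases le_or_gt 0 A with hA0 | hA0
  · exact h2.trans (mul_le_mul_of_nonneg_left hmono hA0)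
  · have hz := cutoffEnergy_nonneg (G := G) g h
    have h3 : 0 ≤ A * G.cutoffEnergy g fun x => Real.log (u x + δ) := by
      have := hG.poincare fun x => Real.log (u x + δ)
      exact (sq_nonneg _).trans this
    nlinarith

set_option maxHeartbeats 800000 in
/-- A density started in `U` is bounded below on most of `U` at all times in `[1, 4]`. -/
theorem exists_frac_lt_le {p Q D : ℝ} (hp : 1 < p) (hQ : 0 < Q) (hD : 1 ≤ D)
    (hPQ : D < 1 - 1 / p + Q) {S W A β : ℝ} (hS : 0 ≤ S) (hW : 0 ≤ W) (hA : 0 ≤ A) (hβ : 0 < β) :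
    ∃ h : ℝ, 0 < h ∧ ∀ (V : Type) [Fintype V] (G : KilledGraph V) (U I : Set V) (f g : V → ℝ),
      G.SobolevBound D Q S → G.Localized U I f g p W A β → ∀ v, G.IsDensity v →
        1 ≤ avg (fun x => f x * v 0 x) → ∀ t : ℝ, 1 ≤ t → t ≤ 4 →
          frac {x | x ∈ U ∧ v t x < h} ≤ β / 4 := by
  have hp0 : 0 < p := by linarith
  have hP0 : 0 < 1 - 1 / p := by rw [sub_pos, div_lt_one hp0]; exact hp
  have hP1 : 1 - 1 / p < 1 := by
    have : 0 < 1 / p := by positivity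
    linarith
  obtain ⟨ε, hε0, hε1, hε⟩ := exists_avg_mul_sub_le hp hQ hD hPQ S hS W hW
  obtain ⟨C, hC0, hC⟩ := exists_integral_dualBound_le hP0 hP1 hQ hD hPQ S hS
  set B := 3 * C / ε with hB
  have hB0 : 0 < B := by positivity
  set κ := (1 / (4 * B)) ^ p with hκ
  have hκ0 : 0 < κ := by positivity
  set Y : ℝ := 2 + Real.log 4 + 6 * W + κ⁻¹ * √(A * (3 * (4 * (3 + 2 * W)) / ε)) with hY
  have hlog4 : 0 ≤ Real.log 4 := Real.log_nonneg (by norm_num)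
  have hY0 : 0 < Y := by positivity
  -- The scale of the argument. With `δ = exp (-m ^ 2)` one has `log (v + δ) ≥ -m ^ 2`, so the
  -- log-energy over a short time is `O(m ^ 2)` and Poincaré makes the mean of the negative part of
  -- the logarithm `O(m)`. Each point with `v < exp (-m ^ 2 / 2) - δ` costs `m ^ 2 / 2`, so the
  -- proportion of such points is `O(1 / m)`.
  set m := max 1 (8 * Y / β) with hm
  have hm1 : 1 ≤ m := le_max_left _ _
  have hm0 : 0 < m := by linarith
  have hmY : 8 * Y ≤ m * β := by rw [← div_le_iff₀ hβ]; exact le_max_right _ _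
  set L := m ^ 2 with hL
  have hL1 : 1 ≤ L := one_le_pow₀ hm1
  set δ := Real.exp (-L) with hδ
  have hδ0 : 0 < δ := Real.exp_pos _
  have hδ1 : δ ≤ 1 := Real.exp_le_one_iff.2 (by linarith)
  refine ⟨Real.exp (-(L / 2)) - δ, sub_pos.2 (Real.exp_lt_exp.2 (by linarith)), ?_⟩
  intro V _ G U I f g hG hloc v hv hstart t ht1 ht4
  have hV : Nonempty V := by
    by_contra hne
    rw [not_nonempty_iff] at hne
    simp [avg] at hstart
    norm_num at hstart
  have hVp : ∀ s, 0 ≤ s → ∀ x, 0 < v s x + δ := fun s hs x =>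
    add_pos_of_nonneg_of_pos (hv.nonneg hs x) hδ0
  have hlogδ : ∀ s, 0 ≤ s → ∀ x, -L ≤ Real.log (v s x + δ) := fun s hs x => by
    rw [Real.le_log_iff_exp_le (hVp s hs x)]
    linarith [hv.nonneg hs x]
  have hup : ∀ s, 0 ≤ s → avg (fun x => v s x + δ) ≤ 2 := fun s hs => by
    rw [avg_add, avg_const]
    linarith [hv.avg_le hs]
  have hEint : ∫ s in (0 : ℝ)..ε, G.cutoffEnergy g (fun x => Real.log (v s x + δ)) ≤
      4 * (3 + 2 * W) * L := by
    have h1 := hv.integral_cutoffEnergy_le hloc.g_nonneg (avg_density_le hp hW hloc.density_g) hδ0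
      le_rfl hε0.le
    have h2 : avg (fun x => g x ^ 2 * Real.log (v ε x + δ)) ≤ 2 :=
      (avg_mono fun x => mul_log_le (hloc.g_nonneg x) (hloc.g_le_one x)
        (hVp ε hε0.le x)).trans (hup ε hε0.le)
    have h3 : -L ≤ avg (fun x => g x ^ 2 * Real.log (v 0 x + δ)) := by
      rw [← avg_const (V := V) (-L)]
      refine avg_mono fun x => ?_
      have a1 := hlogδ 0 le_rfl x
      have a2 : g x ^ 2 ≤ 1 := pow_le_one₀ (hloc.g_nonneg x) (hloc.g_le_one x)
      have a3 := sq_nonneg (g x)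
      have a4 := mul_le_mul_of_nonneg_left a1 a3
      nlinarith
    have h4 : 3 / 2 * W * (ε - 0) ≤ 2 * W * 1 := by
      rw [sub_zero]; gcongr; norm_num
    nlinarith
  have hdualc := continuous_dualBound (Fintype.card V) hP0.le hv.continuous
  -- A time at which both the log-energy and the dual bound are of the size of their means.
  obtain ⟨s, ⟨hs0, hsε⟩, hsE, hsB⟩ := exists_le_of_integral_le hε0
    (by positivity : 0 < 4 * (3 + 2 * W) * L) hC0
    ((hv.continuousOn_cutoffEnergy hδ0 g).mono fun _ hr => hr.1) hdualc.continuousOn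
    (fun _ _ => cutoffEnergy_nonneg _ _) (fun _ _ => zero_le_one.trans (dualBound_nonneg _ _ _))
    hEint (hC V G hG v hv ε hε0.le (by linarith))
  have hmass : 1 / 2 ≤ avg (fun x => f x * v s x) := by
    have := hε V G hG v hv f hloc.density_f s hs0 hsε
    linarith
  have hκle := hv.le_frac hp hloc hB0 hs0 hmass hsB
  set N := avg (I.indicator fun x => max (Real.log (1 / 4) - Real.log (v s x + δ)) 0) with hN
  have hNle : N ≤ κ⁻¹ * √(A * (3 * (4 * (3 + 2 * W)) / ε)) * m := by
    have h1 := hloc.sq_avg_log_le hκ0 hδ0 hκle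
    have h2 : (κ * N) ^ 2 ≤ A * (3 * (4 * (3 + 2 * W)) / ε) * m ^ 2 := by
      refine h1.trans ?_
      calc _ ≤ A * (3 * (4 * (3 + 2 * W) * L) / ε) := mul_le_mul_of_nonneg_left hsE hA
        _ = _ := by rw [hL]; ring
    have h3 : κ * N ≤ √(A * (3 * (4 * (3 + 2 * W)) / ε)) * m := by
      have h4 := Real.le_sqrt_of_sq_le h2
      rwa [Real.sqrt_mul' _ (by positivity), Real.sqrt_sq hm0.le] at h4
    rw [mul_assoc, ← div_eq_inv_mul, le_div_iff₀' hκ0]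
    exact h3
  have hlow : -(Real.log 4) - N ≤ avg (fun x => f x ^ 2 * Real.log (v s x + δ)) := by
    rw [← avg_const (V := V) (-(Real.log 4)), hN, ← avg_sub]
    refine avg_mono fun x => ?_
    by_cases hx : x ∈ I
    · rw [indicator_of_mem hx]
      have h14 : Real.log (1 / 4) = -Real.log 4 := by rw [one_div, Real.log_inv]
      have a0 := le_max_left (Real.log (1 / 4) - Real.log (v s x + δ)) 0
      have a1 := le_max_right (Real.log (1 / 4) - Real.log (v s x + δ)) 0
      rw [h14] at a0 a1 ⊢
      set M := max (-Real.log 4 - Real.log (v s x + δ)) 0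
      have a2 : f x ^ 2 ≤ 1 := pow_le_one₀ (hloc.f_nonneg x) (hloc.f_le_one x)
      have a3 := sq_nonneg (f x)
      have a4 : -Real.log 4 - M ≤ Real.log (v s x + δ) := by linarith
      have a5 := mul_le_mul_of_nonneg_left a4 a3
      have a6 : 0 ≤ (1 - f x ^ 2) * (Real.log 4 + M) := mul_nonneg (by linarith) (by linarith)
      linarith
    · rw [indicator_of_notMem hx, hloc.f_eq_zero x hx]
      simp [hlog4]
  have hst : s ≤ t := by linarith
  have ht0 : 0 ≤ t := by linarith
  -- From `s` on, the weighted mean of the logarithm can decrease only through the energy of the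
  -- cutoff, by at most `6 * W` up to time 4.
  have hprop : avg (fun x => f x ^ 2 * Real.log (v s x + δ)) - 6 * W ≤
      avg (fun x => f x ^ 2 * Real.log (v t x + δ)) := by
    have h1 := hv.integral_cutoffEnergy_le hloc.f_nonneg (avg_density_le hp hW hloc.density_f) hδ0
      hs0 hst
    have h2 : 0 ≤ ∫ r in s..t, G.cutoffEnergy f (fun x => Real.log (v r x + δ)) :=
      intervalIntegral.integral_nonneg hst fun _ _ => cutoffEnergy_nonneg _ _
    have h3 : 3 / 2 * W * (t - s) ≤ 3 / 2 * W * 4 := by gcongr; linarith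
    linarith
  set Z : Set V := {x | x ∈ U ∧ v t x < Real.exp (-(L / 2)) - δ} with hZ
  have hupper : avg (fun x => f x ^ 2 * Real.log (v t x + δ)) ≤ 2 - L / 2 * frac Z := by
    calc _ ≤ avg (fun x => v t x + δ - L / 2 * Z.indicator 1 x) := by
          refine avg_mono fun x => ?_
          by_cases hx : x ∈ Z
          · rw [hloc.f_eq_one x hx.1, indicator_of_mem hx]
            have h1 : Real.log (v t x + δ) ≤ -(L / 2) := by
              rw [Real.log_le_iff_le_exp (hVp t ht0 x)]
              linarith [hx.2]
            have := hVp t ht0 x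
            simp only [Pi.one_apply]
            linarith
          · rw [indicator_of_notMem hx, mul_zero, sub_zero]
            exact mul_log_le (hloc.f_nonneg x) (hloc.f_le_one x) (hVp t ht0 x)
      _ = avg (fun x => v t x + δ) - L / 2 * frac Z := by
          rw [avg_sub, avg_const_mul, frac]
      _ ≤ _ := by linarith [hup t ht0]
  have hfin : L / 2 * frac Z ≤ Y * m := by
    have h1 : L / 2 * frac Z ≤ 2 + Real.log 4 + 6 * W + N := by linarith
    have h2 : 2 + Real.log 4 + 6 * W ≤ (2 + Real.log 4 + 6 * W) * m :=
      le_mul_of_one_le_right (by positivity) hm1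
    rw [hY, add_mul]
    linarith
  have hfZ := frac_nonneg Z
  have h5 : m * frac Z ≤ 2 * Y := by
    refine le_of_mul_le_mul_left ?_ hm0
    calc m * (m * frac Z) = 2 * (L / 2 * frac Z) := by rw [hL]; ring
      _ ≤ 2 * (Y * m) := mul_le_mul_of_nonneg_left hfin zero_le_two
      _ = m * (2 * Y) := by ring
  have h6 : m * frac Z ≤ m * (β / 4) := by linarith
  exact le_of_mul_le_mul_left h6 hm0

/-- Near-diagonal lower bound for densities. -/
theorem exists_le_density {p Q D : ℝ} (hp : 1 < p) (hQ : 0 < Q) (hD : 1 ≤ D)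
    (hPQ : D < 1 - 1 / p + Q) {S W A β : ℝ} (hS : 0 ≤ S) (hW : 0 ≤ W) (hA : 0 ≤ A) (hβ : 0 < β) :
    ∃ c : ℝ, 0 < c ∧ ∀ (V : Type) [Fintype V] [DecidableEq V] (G : KilledGraph V) (U I : Set V)
      (f g : V → ℝ),
      G.SobolevBound D Q S → G.Localized U I f g p W A β → ∀ x ∈ U, ∀ y ∈ U, ∀ v, G.IsHeat v →
        v 0 = Pi.single x (Fintype.card V : ℝ) → ∀ t : ℝ, 2 ≤ t → t ≤ 4 → c ≤ v t y := by
  obtain ⟨h, hh0, hh⟩ := exists_frac_lt_le hp hQ hD hPQ hS hW hA hβ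
  refine ⟨h ^ 2 * (β / 2), by positivity, ?_⟩
  intro V _ _ G U I f g hG hloc x hx y hy v hv hv0 t ht2 ht4
  have hV : Nonempty V := ⟨x⟩
  have hn : (Fintype.card V : ℝ) ≠ 0 := by positivity
  have havg : ∀ (z : V) (u : V → ℝ),
      avg (fun a => u a * (Pi.single z (Fintype.card V : ℝ) : V → ℝ) a) = u z := by
    intro z u
    rw [avg, Finset.sum_eq_single z]
    · simp [hn]
    · intro b _ hb; simp [hb]
    · simp
  obtain ⟨w, hw, hw0⟩ := G.exists_isHeat (Pi.single y (Fintype.card V : ℝ))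
  have hdens : ∀ (z : V) (u : ℝ → V → ℝ), G.IsHeat u → u 0 = Pi.single z (Fintype.card V : ℝ) →
      G.IsDensity u := by
    intro z u hu hu0
    refine ⟨hu, fun a => ?_, ?_⟩
    · rw [hu0]
      by_cases h : a = z
      · subst h; simp
      · simp [h]
    · have := havg z fun _ => 1
      simp only [one_mul] at this
      rw [hu0]
      exact this.le
  have hvd := hdens x v hv hv0
  have hwd := hdens y w hw hw0
  have hv1 := hh V G U I f g hG hloc v hvd (by rw [hv0, havg x f, hloc.f_eq_one x hx]) (t / 2)
    (by linarith) (by linarith)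
  have hw1 := hh V G U I f g hG hloc w hwd (by rw [hw0, havg y f, hloc.f_eq_one y hy]) (t / 2)
    (by linarith) (by linarith)
  -- Duality with the solution `w` started at `y`, at half the time. The bad sets of `v` and `w`
  -- fill at most `β / 4` each, so both solutions exceed `h` on a proportion at least `β / 2`.
  have hconst : avg (fun a => v (t / 2) a * w (t / 2) a) = v t y := by
    rw [← havg y (v t), ← hw0]
    have := hv.sum_mul_const hw t (t / 2)
    rw [sub_half] at this
    simp only [avg, this]
  rw [← hconst]
  have ht0 : 0 ≤ t / 2 := by linarith
  set Zv : Set V := {a | a ∈ U ∧ v (t / 2) a < h}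
  set Zw : Set V := {a | a ∈ U ∧ w (t / 2) a < h}
  calc h ^ 2 * (β / 2) ≤ h ^ 2 * (frac U - frac Zv - frac Zw) := by
        gcongr
        linarith [hloc.frac_ge]
    _ = avg (fun a => h ^ 2 * (U.indicator 1 a - Zv.indicator 1 a - Zw.indicator 1 a)) := by
        rw [avg_const_mul, avg_sub, avg_sub]; rfl
    _ ≤ _ := by
        classical
        refine avg_mono fun a => ?_
        have a1 := hvd.nonneg ht0 a
        have a2 := hwd.nonneg ht0 a
        have a3 : 0 ≤ v (t / 2) a * w (t / 2) a := mul_nonneg a1 a2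
        have h2 : 0 < h ^ 2 := by positivity
        simp only [indicator_apply, Pi.one_apply]
        by_cases hU : a ∈ U
        · by_cases hz1 : a ∈ Zv
          · simp only [hU, hz1, if_true]
            split_ifs <;> nlinarith
          · by_cases hz2 : a ∈ Zw
            · simp only [hU, hz1, hz2, if_true, if_false]
              nlinarith
            · have b1 : h ≤ v (t / 2) a := by
                by_contra hlt; exact hz1 ⟨hU, not_le.1 hlt⟩
              have b2 : h ≤ w (t / 2) a := by
                by_contra hlt; exact hz2 ⟨hU, not_le.1 hlt⟩
              simp only [hU, hz1, hz2, if_true, if_false]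
              nlinarith
        · have hz1 : a ∉ Zv := fun hz => hU hz.1
          have hz2 : a ∉ Zw := fun hz => hU hz.1
          simp only [hU, hz1, hz2, if_false]
          simpa using a3

/-- Duhamel's formula for supersolutions with a source bounded in `L^∞_t L^p_x`. -/
theorem exists_avg_sub_le {p Q D : ℝ} (hp : 1 < p) (hQ : 0 < Q) (hD : 1 ≤ D)
    (hPQ : D < 1 - 1 / p + Q) {S : ℝ} (hS : 0 ≤ S) :
    ∃ K : ℝ, 0 < K ∧ ∀ (V : Type) [Fintype V] [DecidableEq V] (G : KilledGraph V),
      G.SobolevBound D Q S → ∀ x v, G.IsHeat v → v 0 = Pi.single x (Fintype.card V : ℝ) →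
        ∀ (T H : ℝ) (u d F : ℝ → V → ℝ), 0 ≤ T → T ≤ 4 → 0 ≤ H →
          (∀ y, ContinuousOn (fun s => u s y) (Icc 0 T)) →
          (∀ s ∈ Ioo 0 T, ∀ y, HasDerivAt (fun s => u s y) (d s y) s) →
          (∀ s ∈ Ioo 0 T, ∀ y, G.gen (u s) y - F s y ≤ d s y) →
          (∀ s ∈ Ioo 0 T, ∀ y, 0 ≤ F s y) →
          (∀ s ∈ Ioo 0 T, avg (fun y => F s y ^ p) ≤ H ^ p) →
            avg (fun y => v T y * u 0 y) - K * H ≤ u T x := by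
  have hp0 : 0 < p := by linarith
  have hP0 : 0 < 1 - 1 / p := by rw [sub_pos, div_lt_one hp0]; exact hp
  have hP1 : 1 - 1 / p < 1 := by
    have : 0 < 1 / p := by positivity
    linarith
  obtain ⟨K, hK0, hK⟩ := exists_integral_dualBound_le hP0 hP1 hQ hD hPQ S hS
  refine ⟨K, hK0, ?_⟩
  intro V _ _ G hG x v hv hv0 T H u d F hT0 hT4 hH huc hud hdF hF0 hFH
  have hV : Nonempty V := ⟨x⟩
  have hn : (Fintype.card V : ℝ) ≠ 0 := by positivity
  have havg : ∀ (u : V → ℝ), avg (fun a => (Pi.single x (Fintype.card V : ℝ) : V → ℝ) a * u a) =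
      u x := by
    intro u
    rw [avg, Finset.sum_eq_single x]
    · simp [hn]
    · intro b _ hb; simp [hb]
    · simp
  have hvd : G.IsDensity v := by
    refine ⟨hv, fun a => ?_, ?_⟩
    · rw [hv0]
      by_cases h : a = x
      · subst h; simp
      · simp [h]
    · have := havg fun _ => 1
      simp only [mul_one] at this
      rw [hv0]
      exact this.le
  set b : ℝ → ℝ := fun s => dualBound (Fintype.card V) (1 - 1 / p) (v (T - s)) with hb
  have hbc : Continuous b := (continuous_dualBound _ hP0.le hvd.continuous).comp (by fun_prop)
  -- The pairing of `u` with the time-reversed kernel can decrease only through the source, at rate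
  -- at most `H * b`; adding the integral of this rate makes `Θ` nondecreasing.
  set Θ : ℝ → ℝ := fun s => avg (fun y => v (T - s) y * u s y) + H * ∫ r in (0 : ℝ)..s, b r
  have hΘc : ContinuousOn Θ (Icc 0 T) := by
    refine ContinuousOn.add (ContinuousOn.div_const (continuousOn_finsetSum _ fun y _ =>
      ContinuousOn.mul ?_ (huc y)) _) (continuousOn_const.mul ?_)
    · exact ((hv.continuous_apply y).comp (by fun_prop)).continuousOn
    · exact (continuous_prim hbc).continuousOn
  have hΘd : ∀ s ∈ Ioo 0 T, HasDerivAt Θ (avg (fun y => v (T - s) y * (d s y - G.gen (u s) y)) +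
      H * b s) s := by
    intro s hs
    have h1 : ∀ y, HasDerivAt (fun s => v (T - s) y) (-(G.gen (v (T - s)) y)) s :=
      fun y => (hv (T - s) y).comp_const_sub T s
    have h2 := HasDerivAt.fun_sum (u := Finset.univ) fun y _ => (h1 y).fun_mul (hud s hs y)
    refine ((h2.div_const _).congr_deriv ?_).add ((hasDerivAt_prim hbc s).const_mul H)
    rw [avg]
    congr 1
    have e1 := G.sum_mul_gen (v (T - s)) (u s)
    have e2 := G.sum_mul_gen (u s) (v (T - s))
    rw [form_comm] at e2
    simp only [mul_sub, Finset.sum_sub_distrib, Finset.sum_add_distrib, neg_mul,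
      Finset.sum_neg_distrib, mul_comm (G.gen _ _) (u _ _)]
    linarith
  have hmono : MonotoneOn Θ (Icc 0 T) := by
    refine monotoneOn_of_deriv_nonneg (convex_Icc 0 T) hΘc ?_ ?_
    · rw [interior_Icc]
      exact fun s hs => (hΘd s hs).differentiableAt.differentiableWithinAt
    · rw [interior_Icc]
      intro s hs
      rw [(hΘd s hs).deriv]
      have hTs : 0 ≤ T - s := by linarith [hs.2]
      have h1 := avg_mul_le_dualBound hp (hvd.nonneg hTs) (hvd.avg_le hTs) (hF0 s hs) hH (hFH s hs)
      have h2 : avg (fun y => (-1) * (v (T - s) y * F s y)) ≤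
          avg (fun y => v (T - s) y * (d s y - G.gen (u s) y)) := avg_mono fun y => by
        have := mul_le_mul_of_nonneg_left (hdF s hs y) (hvd.nonneg hTs y)
        linarith
      rw [avg_const_mul] at h2
      linarith
  have hfin := hmono (left_mem_Icc.2 hT0) (right_mem_Icc.2 hT0) hT0
  simp only [Θ, sub_zero, sub_self, intervalIntegral.integral_same, mul_zero, add_zero] at hfin
  rw [hv0, havg] at hfin
  have hbi : ∫ r in (0 : ℝ)..T, b r ≤ K := by
    rw [hb, intervalIntegral.integral_comp_sub_left
      (fun r => dualBound (Fintype.card V) (1 - 1 / p) (v r)), sub_self, sub_zero]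
    exact hK V G hG v hvd T hT0 hT4
  have := mul_le_mul_of_nonneg_left hbi hH
  linarith

end KilledGraph

/-! ### The Sobolev inequality on the lattice. -/

namespace LRRW

variable {d : ℕ}

theorem pi_count : Measure.pi (fun _ : Fin d => (Measure.count : Measure ℤ)) = Measure.count := by
  refine Measure.ext_of_singleton fun x => ?_
  rw [Measure.pi_singleton]
  simp

/-- The difference of `f` in direction `i`. -/
def diff (f : Site d → ℝ) (i : Fin d) (x : Site d) : ℝ := f (x + Pi.single i 1) - f x

theorem abs_le_sum_diff_add (f : Site d → ℝ) (i : Fin d) (x : Site d) (m : ℕ) :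
    ENNReal.ofReal |f x| ≤
      ∑ s ∈ Finset.range m, ENNReal.ofReal |diff f i (x + Pi.single i (s : ℤ))| +
        ENNReal.ofReal |f (x + Pi.single i (m : ℤ))| := by
  induction m with
  | zero => simp
  | succ m ih =>
    refine ih.trans ?_
    rw [Finset.sum_range_succ, add_assoc]
    gcongr
    rw [← ENNReal.ofReal_add (abs_nonneg _) (abs_nonneg _)]
    refine ENNReal.ofReal_le_ofReal ?_
    have e : x + Pi.single i ((m + 1 : ℕ) : ℤ) = x + Pi.single i (m : ℤ) + Pi.single i 1 := by
      rw [add_assoc, ← Pi.single_add]; push_cast; rfl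
    rw [e, diff]
    set a := f (x + Pi.single i (m : ℤ) + Pi.single i 1)
    have := abs_sub_abs_le_abs_sub (f (x + Pi.single i (m : ℤ))) a
    rw [abs_sub_comm] at this
    linarith

/-- Telescoping from `x` in direction `i` until the finite support has been left. -/
theorem abs_le_tsum_diff {f : Site d → ℝ} (hf : f.support.Finite) (i : Fin d) (x : Site d) :
    ENNReal.ofReal |f x| ≤ ∑' s : ℤ, ENNReal.ofReal |diff f i (Function.update x i s)| := by
  have hinj : Function.Injective fun m : ℕ => x + Pi.single i (m : ℤ) := by
    intro a b hab
    have := congrFun hab i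
    simpa using this
  obtain ⟨m, hm⟩ : ∃ m : ℕ, f (x + Pi.single i (m : ℤ)) = 0 := by
    by_contra! h
    exact Set.infinite_of_injective_forall_mem hinj (fun m => h m) hf
  have h := abs_le_sum_diff_add f i x m
  rw [hm, abs_zero, ENNReal.ofReal_zero, add_zero] at h
  refine h.trans ?_
  have hinj2 : Function.Injective fun s : ℕ => x i + (s : ℤ) := fun a b hab => by simpa using hab
  calc _ = ∑ s ∈ (Finset.range m).map ⟨_, hinj2⟩,
        ENNReal.ofReal |diff f i (Function.update x i s)| := by
        rw [Finset.sum_map]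
        refine Finset.sum_congr rfl fun s _ => ?_
        congr 3
        funext j
        by_cases hj : j = i
        · subst hj; simp
        · simp [hj]
    _ ≤ _ := ENNReal.sum_le_tsum _

/-- The Gagliardo–Nirenberg–Sobolev inequality on `ℤ^d`. -/
theorem tsum_rpow_le_tsum_diff_rpow (hd : 2 ≤ d) {f : Site d → ℝ} (hf : f.support.Finite) :
    ∑' x, ENNReal.ofReal |f x| ^ ((d : ℝ) / (d - 1)) ≤
      (∑' x, ∑ i, ENNReal.ofReal |diff f i x|) ^ ((d : ℝ) / (d - 1)) := by
  have hd1 : (1 : ℝ) < d := by exact_mod_cast hd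
  have hc : Real.HolderConjugate (Fintype.card (Fin d)) ((d : ℝ) / (d - 1)) := by
    rw [Fintype.card_fin]
    exact Real.HolderConjugate.conjExponent hd1
  have key := lintegral_prod_lintegral_pow_le (fun _ : Fin d => (Measure.count : Measure ℤ)) hc
    (f := fun x => ∑ i, ENNReal.ofReal |diff f i x|) Measurable.of_discrete
  rw [pi_count, lintegral_count, lintegral_count, Fintype.card_fin] at key
  refine le_trans (ENNReal.tsum_le_tsum fun x => ?_) key
  -- The power `d / (d - 1)` is a product of one factor per direction, each bounded by the sum along
  -- its line; the product inequality `key` for counting measure integrates these line sums.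
  have h1 : ∀ i, ENNReal.ofReal |f x| ^ ((1 : ℝ) / (d - 1)) ≤
      (∫⁻ s, ∑ j, ENNReal.ofReal |diff f j (Function.update x i s)| ∂Measure.count) ^
        ((1 : ℝ) / (d - 1)) := by
    intro i
    refine ENNReal.rpow_le_rpow ?_ (by rw [one_div, inv_nonneg]; linarith)
    rw [lintegral_count]
    exact (abs_le_tsum_diff hf i x).trans (ENNReal.tsum_le_tsum fun s =>
      Finset.single_le_sum (f := fun j => ENNReal.ofReal |diff f j (Function.update x i s)|)
        (fun _ _ => zero_le) (Finset.mem_univ i))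
  calc ENNReal.ofReal |f x| ^ ((d : ℝ) / (d - 1))
      = ∏ _i : Fin d, ENNReal.ofReal |f x| ^ ((1 : ℝ) / (d - 1)) := by
        rw [Finset.prod_const, Finset.card_univ, Fintype.card_fin, ← ENNReal.rpow_mul_natCast]
        congr 1
        ring
    _ ≤ _ := Finset.prod_le_prod' fun i _ => h1 i

/-! ### Balls, cubes and cutoff functions. -/

theorem euclid_sq (x : Site d) : euclid x ^ 2 = ∑ i, (x i : ℝ) ^ 2 := by
  rw [euclid, EuclideanSpace.norm_sq_eq]
  simp

theorem euclid_nonneg (x : Site d) : 0 ≤ euclid x := norm_nonneg _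

theorem abs_apply_le_euclid (x : Site d) (i : Fin d) : |(x i : ℝ)| ≤ euclid x :=
  PiLp.norm_apply_le (WithLp.toLp 2 (fun i => (x i : ℝ)) : EuclideanSpace ℝ (Fin d)) i

theorem euclid_add_le (x y : Site d) : euclid (x + y) ≤ euclid x + euclid y := by
  have h : (WithLp.toLp 2 (fun i => ((x + y) i : ℝ)) : EuclideanSpace ℝ (Fin d)) =
      WithLp.toLp 2 (fun i => (x i : ℝ)) + WithLp.toLp 2 (fun i => (y i : ℝ)) := by
    ext i; simp
  unfold euclid
  rw [h]
  exact norm_add_le _ _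

theorem euclid_neg (x : Site d) : euclid (-x) = euclid x := by
  have h : (WithLp.toLp 2 (fun i => ((-x) i : ℝ)) : EuclideanSpace ℝ (Fin d)) =
      -WithLp.toLp 2 (fun i => (x i : ℝ)) := by
    ext i; simp
  unfold euclid
  rw [h, norm_neg]

theorem euclid_single (i : Fin d) : euclid (Pi.single i (1 : ℤ) : Site d) = 1 := by
  have h : euclid (Pi.single i (1 : ℤ) : Site d) ^ 2 = 1 := by
    rw [euclid_sq, Finset.sum_eq_single i]
    · simp
    · intro j _ hj; simp [hj]
    · simp
  have := euclid_nonneg (Pi.single i (1 : ℤ) : Site d)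
  nlinarith

theorem abs_euclid_sub_le (x y : Site d) : |euclid x - euclid y| ≤ euclid (x - y) := by
  rw [abs_sub_le_iff]
  have h1 := euclid_add_le (x - y) y
  have h2 := euclid_add_le (y - x) x
  rw [sub_add_cancel] at h1 h2
  rw [← neg_sub x y, euclid_neg] at h2
  constructor <;> linarith

/-- The cube `[-m, m]^d`. -/
def cube (d : ℕ) (m : ℤ) : Finset (Site d) := Fintype.piFinset fun _ => Finset.Icc (-m) m

theorem mem_cube {m : ℤ} {x : Site d} : x ∈ cube d m ↔ ∀ i, -m ≤ x i ∧ x i ≤ m := by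
  simp [cube]

theorem card_cube {m : ℤ} (hm : 0 ≤ m) : ((cube d m).card : ℝ) = (2 * m + 1) ^ d := by
  rw [cube, Fintype.card_piFinset, Finset.prod_const, Finset.card_univ, Fintype.card_fin,
    Int.card_Icc]
  push_cast
  congr 1
  have : ((m + 1 - -m).toNat : ℤ) = m + 1 - -m := Int.toNat_of_nonneg (by linarith)
  have h2 : (((m + 1 - -m).toNat : ℤ) : ℝ) = ((m + 1 - -m : ℤ) : ℝ) := by rw [this]
  push_cast at h2
  linarith

theorem ball_subset_cube (r : ℝ) : ball d r ⊆ cube d ⌊r⌋ := by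
  intro x hx
  rw [mem_ball] at hx
  rw [mem_cube]
  intro i
  have h := abs_le.1 ((abs_apply_le_euclid x i).trans hx)
  constructor
  · have : -(x i) ≤ ⌊r⌋ := Int.le_floor.2 (by push_cast; linarith)
    linarith
  · exact Int.le_floor.2 h.2

theorem card_ball_le {r : ℝ} (hr : 1 ≤ r) : ((ball d r).card : ℝ) ≤ (3 * r) ^ d := by
  have hf : 0 ≤ ⌊r⌋ := Int.floor_nonneg.2 (by linarith)
  calc ((ball d r).card : ℝ) ≤ (cube d ⌊r⌋).card := by
        exact_mod_cast Finset.card_le_card (ball_subset_cube r)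
    _ = (2 * ⌊r⌋ + 1) ^ d := card_cube hf
    _ ≤ (3 * r) ^ d := by
        have h1 : (⌊r⌋ : ℝ) ≤ r := Int.floor_le r
        have h2 : (0 : ℝ) ≤ ⌊r⌋ := by exact_mod_cast hf
        gcongr
        linarith

/-- The cube of half-side `r / √d` is contained in the ball. -/
theorem le_card_ball (hd : 0 < d) {r : ℝ} (hr : 0 ≤ r) :
    (r / √d) ^ d ≤ ((ball d r).card : ℝ) := by
  have hd0 : (0 : ℝ) < d := by exact_mod_cast hd
  have hs : 0 < √(d : ℝ) := Real.sqrt_pos.2 hd0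
  set s := r / √d with hsdef
  have hs0 : 0 ≤ s := by positivity
  have hf : 0 ≤ ⌊s⌋ := Int.floor_nonneg.2 hs0
  have hsub : cube d ⌊s⌋ ⊆ ball d r := by
    intro x hx
    rw [mem_cube] at hx
    rw [mem_ball]
    refine le_of_sq_le_sq ?_ hr
    rw [euclid_sq]
    have hi : ∀ i, (x i : ℝ) ^ 2 ≤ s ^ 2 := by
      intro i
      rw [sq_le_sq, abs_of_nonneg hs0, abs_le]
      have h1 : ((-⌊s⌋ : ℤ) : ℝ) ≤ x i := by exact_mod_cast (hx i).1
      have h2 : (x i : ℝ) ≤ ⌊s⌋ := by exact_mod_cast (hx i).2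
      have h3 := Int.floor_le s
      push_cast at h1
      constructor <;> linarith
    calc ∑ i, (x i : ℝ) ^ 2 ≤ ∑ _i : Fin d, s ^ 2 := Finset.sum_le_sum fun i _ => hi i
      _ = r ^ 2 := by
        rw [Finset.sum_const, Finset.card_univ, Fintype.card_fin, nsmul_eq_mul, hsdef, div_pow,
          Real.sq_sqrt hd0.le]
        field_simp
  calc s ^ d ≤ (2 * ⌊s⌋ + 1) ^ d := by
        have h1 := Int.lt_floor_add_one s
        have h2 : (0 : ℝ) ≤ ⌊s⌋ := by exact_mod_cast hf
        gcongr
        linarith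
    _ = (cube d ⌊s⌋).card := (card_cube hf).symm
    _ ≤ _ := by exact_mod_cast Finset.card_le_card hsub

/-- The lattice points of norm `1`. -/
def units (d : ℕ) : Finset (Site d) := (ball d 1).filter fun z => euclid z = 1

theorem mem_units {z : Site d} : z ∈ units d ↔ euclid z = 1 := by
  simp only [units, Finset.mem_filter, mem_ball]
  exact ⟨fun h => h.2, fun h => ⟨h.le, h⟩⟩

theorem sum_single_le_sum_units {F : Site d → ℝ} (hF : ∀ z, 0 ≤ F z) :
    ∑ i, F (Pi.single i 1) ≤ ∑ z ∈ units d, F z := by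
  have hinj : Function.Injective fun i : Fin d => (Pi.single i 1 : Site d) := by
    intro i j h
    by_contra hne
    have := congrFun h i
    simp [hne] at this
  calc ∑ i, F (Pi.single i 1) = ∑ z ∈ Finset.univ.map ⟨_, hinj⟩, F z := by
        rw [Finset.sum_map]; rfl
    _ ≤ _ := Finset.sum_le_sum_of_subset_of_nonneg (by
        intro z hz
        simp only [Finset.mem_map, Finset.mem_univ, true_and] at hz
        obtain ⟨i, rfl⟩ := hz
        exact mem_units.2 (euclid_single i)) fun z _ _ => hF z

theorem sum_neg_single_le_sum_units {F : Site d → ℝ} (hF : ∀ z, 0 ≤ F z) :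
    ∑ i, F (-Pi.single i 1) ≤ ∑ z ∈ units d, F z := by
  refine (sum_single_le_sum_units (F := fun z => F (-z)) fun z => hF _).trans (le_of_eq ?_)
  refine Finset.sum_nbij' (fun z => -z) (fun z => -z) ?_ ?_ ?_ ?_ ?_ <;>
    simp [mem_units, euclid_neg]

/-- A weak form of the Sobolev inequality, with the gradient restricted to the support. -/
theorem mul_card_rpow_le (hd : 2 ≤ d) {D : Finset (Site d)} {f : Site d → ℝ} (hf0 : ∀ x, 0 ≤ f x)
    (hfD : ∀ x, x ∉ D → f x = 0) {h : ℝ} (hh : 0 < h) :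
    h * ((D.filter fun x => h ≤ f x).card : ℝ) ^ (1 - 1 / (d : ℝ)) ≤
      2 * ∑ x ∈ D.filter fun x => 0 < f x, ∑ z ∈ units d, |f (x + z) - f x| := by
  have hd1 : (1 : ℝ) < d := by exact_mod_cast hd
  have hd1' : (0 : ℝ) < d - 1 := by linarith
  set κ : ℝ := (d : ℝ) / (d - 1) with hκ
  have hκ0 : 0 < κ := by positivity
  set A := D.filter fun x => h ≤ f x with hA
  set D' := D.filter fun x => 0 < f x with hD'
  have hsupp : f.support.Finite := D.finite_toSet.subset fun x hx => by
    by_contra hn; exact hx (hfD x hn)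
  have key := tsum_rpow_le_tsum_diff_rpow hd hsupp
  set N : ℝ≥0∞ := ∑' x, ∑ i, ENNReal.ofReal |diff f i x| with hN
  have h1 : (A.card : ℝ≥0∞) * ENNReal.ofReal h ^ κ ≤ N ^ κ := by
    refine le_trans ?_ key
    calc (A.card : ℝ≥0∞) * ENNReal.ofReal h ^ κ = ∑ x ∈ A, ENNReal.ofReal h ^ κ := by
          rw [Finset.sum_const, nsmul_eq_mul]
      _ ≤ ∑ x ∈ A, ENNReal.ofReal |f x| ^ κ := by
          refine Finset.sum_le_sum fun x hx => ?_
          refine ENNReal.rpow_le_rpow (ENNReal.ofReal_le_ofReal ?_) hκ0.le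
          rw [abs_of_nonneg (hf0 x)]
          exact (Finset.mem_filter.1 hx).2
      _ ≤ _ := ENNReal.sum_le_tsum _
  set P : Site d → ℝ := fun x => ∑ z ∈ units d, |f (x + z) - f x| with hP
  have hP0 : ∀ x, 0 ≤ P x := fun x => Finset.sum_nonneg fun z _ => abs_nonneg _
  have hsum : ∀ F : Site d → ℝ≥0∞, (∑' x, if 0 < f x then F x else 0) = ∑ x ∈ D', F x := by
    intro F
    rw [tsum_eq_sum (s := D')]
    · exact Finset.sum_congr rfl fun x hx => by rw [if_pos (Finset.mem_filter.1 hx).2]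
    · intro x hx
      rw [if_neg]
      intro hpos
      refine hx (Finset.mem_filter.2 ⟨?_, hpos⟩)
      by_contra hn
      rw [hfD x hn] at hpos
      exact lt_irrefl _ hpos
  have h2 : N ≤ ENNReal.ofReal (2 * ∑ x ∈ D', P x) := by
    -- An edge on which `f` varies has an endpoint with `f > 0`, to which it is charged. The two
    -- possible endpoints account for the factor 2.
    have step : ∀ x, ∑ i, ENNReal.ofReal |diff f i x| ≤
        (∑ i, if 0 < f x then ENNReal.ofReal |f (x + Pi.single i 1) - f x| else 0) +
          ∑ i, if 0 < f (x + Pi.single i 1) then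
            ENNReal.ofReal |f (x + Pi.single i 1) - f x| else 0 := by
      intro x
      rw [← Finset.sum_add_distrib]
      refine Finset.sum_le_sum fun i _ => ?_
      rw [diff]
      split_ifs with a b b
      · exact le_self_add
      · simp
      · simp
      · have e1 := le_antisymm (not_lt.1 a) (hf0 x)
        have e2 := le_antisymm (not_lt.1 b) (hf0 _)
        simp [e1, e2]
    have s1 : ∑' x, (∑ i, if 0 < f x then ENNReal.ofReal |f (x + Pi.single i 1) - f x| else 0) ≤
        ENNReal.ofReal (∑ x ∈ D', P x) := by
      have : ∀ x, (∑ i, if 0 < f x then ENNReal.ofReal |f (x + Pi.single i 1) - f x| else 0) =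
          if 0 < f x then ∑ i, ENNReal.ofReal |f (x + Pi.single i 1) - f x| else 0 := by
        intro x; split_ifs <;> simp
      simp only [this]
      rw [hsum, ENNReal.ofReal_sum_of_nonneg fun x _ => hP0 x]
      refine Finset.sum_le_sum fun x _ => ?_
      rw [← ENNReal.ofReal_sum_of_nonneg fun i _ => abs_nonneg _]
      exact ENNReal.ofReal_le_ofReal
        (sum_single_le_sum_units (F := fun z => |f (x + z) - f x|) fun _ => abs_nonneg _)
    have s2 : ∑' x, (∑ i, if 0 < f (x + Pi.single i 1) then
        ENNReal.ofReal |f (x + Pi.single i 1) - f x| else 0) ≤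
        ENNReal.ofReal (∑ x ∈ D', P x) := by
      rw [Summable.tsum_finsetSum fun i _ => ENNReal.summable]
      have shift : ∀ i : Fin d, (∑' x, if 0 < f (x + Pi.single i 1) then
          ENNReal.ofReal |f (x + Pi.single i 1) - f x| else 0) =
          ∑ x ∈ D', ENNReal.ofReal |f (x + -Pi.single i 1) - f x| := by
        intro i
        rw [← hsum]
        refine Eq.trans (tsum_congr fun x => ?_)
          ((Equiv.addRight (Pi.single i (1 : ℤ) : Site d)).tsum_eq fun x : Site d =>
            if 0 < f x then ENNReal.ofReal |f (x + -Pi.single i 1) - f x| else 0)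
        simp only [Equiv.coe_addRight, add_neg_cancel_right]
        rw [abs_sub_comm]
      simp only [shift]
      rw [Finset.sum_comm, ENNReal.ofReal_sum_of_nonneg fun x _ => hP0 x]
      refine Finset.sum_le_sum fun x _ => ?_
      rw [← ENNReal.ofReal_sum_of_nonneg fun i _ => abs_nonneg _]
      exact ENNReal.ofReal_le_ofReal
        (sum_neg_single_le_sum_units (F := fun z => |f (x + z) - f x|) fun _ => abs_nonneg _)
    calc N ≤ _ := ENNReal.tsum_le_tsum step
      _ ≤ ENNReal.ofReal (∑ x ∈ D', P x) + ENNReal.ofReal (∑ x ∈ D', P x) := by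
          rw [ENNReal.tsum_add]
          exact add_le_add s1 s2
      _ = _ := by
          have : 0 ≤ ∑ x ∈ D', P x := Finset.sum_nonneg fun x _ => hP0 x
          rw [← ENNReal.ofReal_add this this, two_mul]
  have hRHS : 0 ≤ 2 * ∑ x ∈ D', P x :=
    mul_nonneg zero_le_two (Finset.sum_nonneg fun x _ => hP0 x)
  set T := 2 * ∑ x ∈ D', P x
  have h3 : ENNReal.ofReal ((A.card : ℝ) * h ^ κ) ≤ ENNReal.ofReal (T ^ κ) := by
    rw [ENNReal.ofReal_mul (Nat.cast_nonneg _), ENNReal.ofReal_natCast,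
      ← ENNReal.ofReal_rpow_of_pos hh, ← ENNReal.ofReal_rpow_of_nonneg hRHS hκ0.le]
    exact h1.trans (ENNReal.rpow_le_rpow h2 hκ0.le)
  have h4 := (ENNReal.ofReal_le_ofReal_iff (by positivity)).1 h3
  have h5 := Real.rpow_le_rpow (by positivity) h4 (by positivity : 0 ≤ 1 / κ)
  rw [Real.mul_rpow (Nat.cast_nonneg _) (by positivity), ← Real.rpow_mul hh.le,
    ← Real.rpow_mul hRHS, mul_one_div_cancel hκ0.ne', Real.rpow_one, Real.rpow_one] at h5
  have h6 : 1 / κ = 1 - 1 / (d : ℝ) := by rw [hκ]; field_simp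
  rw [h6, mul_comm] at h5
  exact h5

/-- The radial cutoff that is `1` on the ball of radius `a` and `0` off the ball of radius `b`. -/
def cutoff (a b : ℝ) (x : Site d) : ℝ := max 0 (min 1 ((b - euclid x) / (b - a)))

theorem cutoff_nonneg (a b : ℝ) (x : Site d) : 0 ≤ cutoff a b x := le_max_left _ _

theorem cutoff_le_one (a b : ℝ) (x : Site d) : cutoff a b x ≤ 1 :=
  max_le zero_le_one (min_le_left _ _)

theorem cutoff_eq_one {a b : ℝ} (hab : a < b) {x : Site d} (hx : euclid x ≤ a) :
    cutoff a b x = 1 := by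
  have : 1 ≤ (b - euclid x) / (b - a) := by rw [le_div_iff₀ (by linarith)]; linarith
  rw [cutoff, min_eq_left this, max_eq_right zero_le_one]

theorem cutoff_eq_zero {a b : ℝ} (hab : a < b) {x : Site d} (hx : b ≤ euclid x) :
    cutoff a b x = 0 := by
  have : (b - euclid x) / (b - a) ≤ 0 := div_nonpos_of_nonpos_of_nonneg (by linarith) (by linarith)
  rw [cutoff, max_eq_left ((min_le_right _ _).trans this)]

theorem abs_cutoff_sub_le {a b : ℝ} (hab : a < b) (x y : Site d) :
    |cutoff a b x - cutoff a b y| ≤ euclid (y - x) / (b - a) := by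
  have hba : 0 < b - a := by linarith
  calc |cutoff a b x - cutoff a b y| ≤
        |(b - euclid x) / (b - a) - (b - euclid y) / (b - a)| := by
        have h : ∀ s t : ℝ, |max 0 (min 1 s) - max 0 (min 1 t)| ≤ |s - t| := by
          intro s t; grind
        exact h _ _
    _ = |euclid y - euclid x| / (b - a) := by
        rw [← sub_div, abs_div, abs_of_pos hba]
        congr 2; ring
    _ ≤ _ := div_le_div_of_nonneg_right (abs_euclid_sub_le y x) hba.le

/-! ### The Poincaré inequality along coordinate paths. -/

theorem abs_sub_le_sum_Ico (F : ℤ → ℝ) (a b : ℤ) :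
    |F a - F b| ≤ ∑ s ∈ Finset.Ico (min a b) (max a b), |F (s + 1) - F s| := by
  have key : ∀ (a : ℤ) (n : ℕ), |F a - F (a + n)| ≤ ∑ s ∈ Finset.Ico a (a + n),
      |F (s + 1) - F s| := by
    intro a n
    induction n with
    | zero => simp
    | succ n ih =>
      have e : Finset.Ico a (a + (n + 1 : ℕ)) = insert (a + n) (Finset.Ico a (a + n)) := by
        ext s
        simp only [Finset.mem_Ico, Finset.mem_insert]
        push_cast
        omega
      rw [e, Finset.sum_insert (by simp)]
      have h := abs_sub_le (F a) (F (a + n)) (F (a + (n + 1 : ℕ)))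
      have e2 : a + ((n + 1 : ℕ) : ℤ) = a + n + 1 := by push_cast; ring
      rw [e2] at h ⊢
      rw [abs_sub_comm (F (a + n))] at h
      linarith
  rcases le_total a b with h | h
  · obtain ⟨n, rfl⟩ := Int.le.dest h
    rw [min_eq_left h, max_eq_right h]
    exact key a n
  · obtain ⟨n, rfl⟩ := Int.le.dest h
    rw [min_eq_right h, max_eq_left h, abs_sub_comm]
    exact key b n

/-- The point with the first `i` coordinates of `z` and the remaining coordinates of `x`. -/
def mix (i : ℕ) (x z : Site d) : Site d := fun j => if j.val < i then z j else x j

theorem mix_mem_cube {m : ℤ} {x z : Site d} (hx : x ∈ cube d m) (hz : z ∈ cube d m) (i : ℕ) :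
    mix i x z ∈ cube d m := by
  rw [mem_cube] at *
  intro j
  unfold mix
  split_ifs
  · exact hz j
  · exact hx j

theorem mix_mix (i : ℕ) (x z : Site d) : mix i (mix i x z) (mix i z x) = x := by
  funext j; unfold mix; split_ifs <;> rfl

/-- Exchanging the first `i` coordinates is an involution on pairs of points of the cube, so
intermediate path points are uniformly distributed. -/
theorem sum_mix (i : ℕ) (m : ℤ) (F : Site d → ℝ) :
    ∑ x ∈ cube d m, ∑ z ∈ cube d m, F (mix i x z) =
      (cube d m).card * ∑ x ∈ cube d m, F x := by
  rw [← Finset.sum_product']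
  calc ∑ a ∈ cube d m ×ˢ cube d m, F (mix i a.1 a.2) =
      ∑ a ∈ cube d m ×ˢ cube d m, F a.1 := by
        refine Finset.sum_nbij' (fun a => (mix i a.1 a.2, mix i a.2 a.1))
          (fun a => (mix i a.1 a.2, mix i a.2 a.1)) ?_ ?_ ?_ ?_ ?_
        · intro a ha
          rw [Finset.mem_product] at ha ⊢
          exact ⟨mix_mem_cube ha.1 ha.2 i, mix_mem_cube ha.2 ha.1 i⟩
        · intro a ha
          rw [Finset.mem_product] at ha ⊢
          exact ⟨mix_mem_cube ha.1 ha.2 i, mix_mem_cube ha.2 ha.1 i⟩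
        · intro a _; simp [mix_mix]
        · intro a _; simp [mix_mix]
        · intro a _; rfl
    _ = _ := by
        rw [Finset.sum_product, Finset.mul_sum]
        simp

theorem update_mem_cube {m : ℤ} {y : Site d} (hy : y ∈ cube d m) (i : Fin d) {s : ℤ}
    (hs : s ∈ Finset.Icc (-m) m) : Function.update y i s ∈ cube d m := by
  rw [mem_cube] at *
  intro j
  by_cases h : j = i
  · subst h; simpa using hs
  · simpa [h] using hy j

/-- Exchanging `s` with the `i`-th coordinate of `y` is again an involution. -/
theorem sum_update (i : Fin d) {m : ℤ} (hm : 0 ≤ m) (F : Site d → ℝ) :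
    ∑ y ∈ cube d m, ∑ s ∈ Finset.Icc (-m) m, F (Function.update y i s) =
      (2 * m + 1) * ∑ y ∈ cube d m, F y := by
  rw [← Finset.sum_product']
  calc ∑ a ∈ cube d m ×ˢ Finset.Icc (-m) m, F (Function.update a.1 i a.2) =
      ∑ a ∈ cube d m ×ˢ Finset.Icc (-m) m, F a.1 := by
        refine Finset.sum_nbij' (fun a => (Function.update a.1 i a.2, a.1 i))
          (fun a => (Function.update a.1 i a.2, a.1 i)) ?_ ?_ ?_ ?_ ?_
        · intro a ha
          rw [Finset.mem_product] at ha ⊢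
          exact ⟨update_mem_cube ha.1 i ha.2, Finset.mem_Icc.2 (mem_cube.1 ha.1 i)⟩
        · intro a ha
          rw [Finset.mem_product] at ha ⊢
          exact ⟨update_mem_cube ha.1 i ha.2, Finset.mem_Icc.2 (mem_cube.1 ha.1 i)⟩
        · intro a _; simp
        · intro a _; simp
        · intro a _; rfl
    _ = _ := by
        rw [Finset.sum_product, Finset.mul_sum]
        refine Finset.sum_congr rfl fun y _ => ?_
        simp only [Finset.sum_const, nsmul_eq_mul, Int.card_Icc]
        congr 1
        have : ((m + 1 - -m).toNat : ℤ) = m + 1 - -m := Int.toNat_of_nonneg (by linarith)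
        have h2 : (((m + 1 - -m).toNat : ℤ) : ℝ) = ((m + 1 - -m : ℤ) : ℝ) := by rw [this]
        push_cast at h2
        linarith

/-- The coordinatewise condition holds along the coordinate paths between `x` and `z`, which
therefore stay in the ball enlarged by the factor `√2`. -/
theorem mem_ball_of_sq_le {ρ σ : ℝ} (hσ : 0 ≤ σ) (h : 2 * ρ ^ 2 ≤ σ ^ 2)
    {x z y : Site d} (hx : x ∈ ball d ρ) (hz : z ∈ ball d ρ)
    (hy : ∀ j, y j ^ 2 ≤ x j ^ 2 + z j ^ 2) : y ∈ ball d σ := by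
  rw [mem_ball] at *
  refine le_of_sq_le_sq ?_ hσ
  have h1 : euclid x ^ 2 ≤ ρ ^ 2 := pow_le_pow_left₀ (euclid_nonneg x) hx 2
  have h2 : euclid z ^ 2 ≤ ρ ^ 2 := pow_le_pow_left₀ (euclid_nonneg z) hz 2
  have h3 : euclid y ^ 2 ≤ euclid x ^ 2 + euclid z ^ 2 := by
    rw [euclid_sq, euclid_sq, euclid_sq, ← Finset.sum_add_distrib]
    exact Finset.sum_le_sum fun j _ => by exact_mod_cast hy j
  linarith

/-- The gradient of `H` in direction `i`, restricted to edges within the ball of radius `σ`. -/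
def innerDiff (σ : ℝ) (H : Site d → ℝ) (i : Fin d) (y : Site d) : ℝ :=
  if y ∈ ball d σ ∧ y + Pi.single i 1 ∈ ball d σ then |diff H i y| else 0

theorem innerDiff_nonneg (σ : ℝ) (H : Site d → ℝ) (i : Fin d) (y : Site d) :
    0 ≤ innerDiff σ H i y := by
  unfold innerDiff; split_ifs <;> positivity

theorem sq_le_of_mem_Icc_min_max {a b s : ℤ} (h1 : min a b ≤ s) (h2 : s ≤ max a b) :
    s ^ 2 ≤ a ^ 2 + b ^ 2 := by
  rcases le_total a b with h | h
  · rw [min_eq_left h] at h1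
    rw [max_eq_right h] at h2
    nlinarith [sq_nonneg a, sq_nonneg b, mul_nonneg (sub_nonneg.2 h1) (sub_nonneg.2 h2),
      sq_nonneg (a + b - s)]
  · rw [min_eq_right h] at h1
    rw [max_eq_left h] at h2
    nlinarith [sq_nonneg a, sq_nonneg b, mul_nonneg (sub_nonneg.2 h1) (sub_nonneg.2 h2),
      sq_nonneg (a + b - s)]

theorem abs_sub_mix_le {ρ σ : ℝ} (hσ : 0 ≤ σ) (h : 2 * ρ ^ 2 ≤ σ ^ 2)
    (H : Site d → ℝ) {x z : Site d} (hx : x ∈ ball d ρ) (hz : z ∈ ball d ρ) (i : Fin d) :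
    |H (mix i x z) - H (mix (i + 1) x z)| ≤ ∑ s ∈ Finset.Icc (-⌊ρ⌋) ⌊ρ⌋,
      innerDiff σ H i (Function.update (mix i x z) i s) := by
  set y := mix i x z with hy
  have e1 : y = Function.update y i (x i) := by
    funext j
    by_cases hj : j = i
    · subst hj; simp [hy, mix]
    · simp [hj]
  have e2 : mix (i + 1) x z = Function.update y i (z i) := by
    funext j
    by_cases hj : j = i
    · subst hj; simp [mix]
    · have : j.val ≠ i.val := fun h => hj (Fin.ext h)
      simp only [hy, mix, ne_eq, hj, not_false_eq_true, Function.update_of_ne]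
      have : (j.val < i.val + 1) = (j.val < i.val) := by
        simp only [eq_iff_iff]; omega
      simp only [this]
  have hxc := mem_cube.1 (ball_subset_cube ρ hx) i
  have hzc := mem_cube.1 (ball_subset_cube ρ hz) i
  have hmem : ∀ s : ℤ, min (x i) (z i) ≤ s → s ≤ max (x i) (z i) →
      Function.update y i s ∈ ball d σ := by
    intro s h1 h2
    refine mem_ball_of_sq_le hσ h hx hz fun j => ?_
    by_cases hj : j = i
    · subst hj
      simpa using sq_le_of_mem_Icc_min_max h1 h2
    · simp only [hj, ne_eq, not_false_eq_true, Function.update_of_ne, hy, mix]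
      split_ifs
      · nlinarith [sq_nonneg (x j)]
      · nlinarith [sq_nonneg (z j)]
  calc |H y - H (mix (i + 1) x z)|
      = |H (Function.update y i (x i)) - H (Function.update y i (z i))| := by rw [← e1, e2]
    _ ≤ ∑ s ∈ Finset.Ico (min (x i) (z i)) (max (x i) (z i)),
          |H (Function.update y i (s + 1)) - H (Function.update y i s)| :=
        abs_sub_le_sum_Ico (fun s => H (Function.update y i s)) _ _
    _ = ∑ s ∈ Finset.Ico (min (x i) (z i)) (max (x i) (z i)),
          innerDiff σ H i (Function.update y i s) := by
        refine Finset.sum_congr rfl fun s hs => ?_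
        rw [Finset.mem_Ico] at hs
        have e3 : Function.update y i s + Pi.single i 1 = Function.update y i (s + 1) := by
          funext j
          by_cases hj : j = i
          · subst hj; simp
          · simp [hj]
        rw [innerDiff, if_pos, diff, e3]
        rw [e3]
        exact ⟨hmem s hs.1 hs.2.le, hmem (s + 1) (by omega) (by omega)⟩
    _ ≤ _ := by
        refine Finset.sum_le_sum_of_subset_of_nonneg ?_ fun s _ _ => innerDiff_nonneg _ _ _ _
        intro s hs
        rw [Finset.mem_Ico] at hs
        rw [Finset.mem_Icc]
        omega

/-- An `L^1` Poincaré inequality on balls, by coordinate paths. -/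
theorem sum_abs_sub_le {ρ σ : ℝ} (hρ : 0 ≤ ρ) (hσ : 0 ≤ σ) (h : 2 * ρ ^ 2 ≤ σ ^ 2)
    (H : Site d → ℝ) :
    ∑ x ∈ ball d ρ, ∑ z ∈ ball d ρ, |H x - H z| ≤
      (2 * ⌊ρ⌋ + 1) ^ (d + 1) * ∑ i, ∑ y ∈ ball d σ, innerDiff σ H i y := by
  have hm : 0 ≤ ⌊ρ⌋ := Int.floor_nonneg.2 hρ
  set m := ⌊ρ⌋
  have hm' : (0 : ℝ) ≤ m := by exact_mod_cast hm
  have tele : ∀ x z : Site d, |H x - H z| ≤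
      ∑ i : Fin d, |H (mix i x z) - H (mix (i + 1) x z)| := by
    intro x z
    have e := Finset.sum_range_sub' (fun i => H (mix i x z)) d
    have e0 : mix 0 x z = x := by funext j; simp [mix]
    have ed : mix d x z = z := by funext j; simp [mix]
    rw [e0, ed] at e
    rw [← e, ← Finset.sum_range fun i => |H (mix i x z) - H (mix (i + 1) x z)|]
    exact Finset.abs_sum_le_sum_abs _ _
  have hin : ∀ i, ∑ y ∈ cube d m, innerDiff σ H i y ≤ ∑ y ∈ ball d σ, innerDiff σ H i y := by
    intro i
    have : ∀ y, y ∉ ball d σ → innerDiff σ H i y = 0 := fun y hy =>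
      if_neg fun h => hy h.1
    calc ∑ y ∈ cube d m, innerDiff σ H i y ≤ ∑ y ∈ cube d m ∪ ball d σ, innerDiff σ H i y :=
          Finset.sum_le_sum_of_subset_of_nonneg Finset.subset_union_left
            fun y _ _ => innerDiff_nonneg _ _ _ _
      _ = _ := (Finset.sum_subset Finset.subset_union_right fun y _ hy => this y hy).symm
  set Φ : Fin d → Site d → ℝ := fun i y => ∑ s ∈ Finset.Icc (-m) m,
    innerDiff σ H i (Function.update y i s) with hΦ
  have hΦ0 : ∀ i y, 0 ≤ Φ i y := fun i y => Finset.sum_nonneg fun s _ => innerDiff_nonneg _ _ _ _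
  calc ∑ x ∈ ball d ρ, ∑ z ∈ ball d ρ, |H x - H z|
      ≤ ∑ x ∈ ball d ρ, ∑ z ∈ ball d ρ, ∑ i, Φ i (mix i x z) :=
        Finset.sum_le_sum fun x hx => Finset.sum_le_sum fun z hz => (tele x z).trans
          (Finset.sum_le_sum fun i _ => abs_sub_mix_le hσ h H hx hz i)
    _ ≤ ∑ x ∈ cube d m, ∑ z ∈ cube d m, ∑ i, Φ i (mix i x z) := by
        have hn : ∀ x z, 0 ≤ ∑ i, Φ i (mix i x z) :=
          fun x z => Finset.sum_nonneg fun i _ => hΦ0 _ _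
        refine (Finset.sum_le_sum fun x _ => Finset.sum_le_sum_of_subset_of_nonneg
          (ball_subset_cube ρ) fun z _ _ => hn x z).trans ?_
        exact Finset.sum_le_sum_of_subset_of_nonneg (ball_subset_cube ρ)
          fun x _ _ => Finset.sum_nonneg fun z _ => hn x z
    _ = ∑ i, ∑ x ∈ cube d m, ∑ z ∈ cube d m, Φ i (mix i x z) := by
        symm
        rw [Finset.sum_comm]
        exact Finset.sum_congr rfl fun x _ => Finset.sum_comm
    _ = ∑ i, (2 * m + 1) ^ (d + 1) * ∑ y ∈ cube d m, innerDiff σ H i y := by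
        refine Finset.sum_congr rfl fun i _ => ?_
        rw [sum_mix, hΦ, sum_update i hm, card_cube hm]
        ring
    _ ≤ _ := by
        rw [← Finset.mul_sum]
        exact mul_le_mul_of_nonneg_left (Finset.sum_le_sum fun i _ => hin i) (by positivity)

/-! ### The killed walk on a ball: Sobolev, Poincaré and cutoffs. -/

section KilledWalk

/-- Symmetric nonnegative summable conductances. -/
structure IsConductance (c : Site d → Site d → ℝ) : Prop where
  nonneg : ∀ x y, 0 ≤ c x y
  symm : ∀ x y, c x y = c y x
  summable : ∀ x, Summable (c x)

/-- The second moment `∑_y |y - x|² c(x, y)`. -/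
def muAt (c : Site d → Site d → ℝ) (x : Site d) : ℝ≥0∞ :=
  ∑' y, ENNReal.ofReal (euclid (y - x) ^ 2 * c x y)

/-- The sum of the resistances of the nearest-neighbour edges at `x`. -/
def nuAt (c : Site d → Site d → ℝ) (x : Site d) : ℝ≥0∞ :=
  ∑ z ∈ units d, (ENNReal.ofReal (c x (x + z)))⁻¹

variable {c : Site d → Site d → ℝ}

/-- The walk killed upon leaving `D`, with time measured in units of `r ^ 2`. -/
def killedWalk (hc : IsConductance c) (r : ℝ) (D : Finset (Site d)) : KilledGraph D where
  c x y := r ^ 2 * c x y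
  k x := r ^ 2 * ∑' y : {y // y ∉ D}, c x y
  c_symm x y := by rw [hc.symm]
  c_nonneg x y := mul_nonneg (sq_nonneg r) (hc.nonneg _ _)
  k_nonneg x := mul_nonneg (sq_nonneg r) (tsum_nonneg fun y => hc.nonneg _ _)

theorem avg_coe {D : Finset (Site d)} (F : Site d → ℝ) :
    avg (fun x : D => F x) = (∑ x ∈ D, F x) / D.card := by
  rw [avg, Finset.sum_coe_sort D F, Fintype.card_coe]

theorem frac_coe {D : Finset (Site d)} (P : Site d → Prop) [DecidablePred P] :
    frac {x : D | P x} = ((D.filter P).card : ℝ) / D.card := by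
  have h : ({x : D | P x}.indicator 1 : D → ℝ) = fun x : D => if P x then (1 : ℝ) else 0 := by
    funext x
    by_cases hx : P x <;> simp [hx]
  rw [frac, h, avg_coe (fun x => if P x then (1 : ℝ) else 0), Finset.sum_boole]

theorem summable_mul_sq_sub (hc : IsConductance c) {D : Finset (Site d)} {F : Site d → ℝ}
    (hF : ∀ x, x ∉ D → F x = 0) (x : Site d) : Summable fun y => c x y * (F x - F y) ^ 2 := by
  refine (D.summable_compl_iff).1 ?_
  have : (fun y : {y // y ∉ D} => c x y * (F x - F y) ^ 2) = fun y : {y // y ∉ D} =>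
      c x y * F x ^ 2 := by
    funext y
    rw [hF y y.2, sub_zero]
  rw [this]
  exact ((hc.summable x).mul_right _).subtype _

/-- Killing at the total rate of jumps out of `D` is the energy of the edges to points where `F`
vanishes, so the density sees the whole lattice. -/
theorem killedWalk_density (hc : IsConductance c) (r : ℝ) {D : Finset (Site d)} {F : Site d → ℝ}
    (hF : ∀ x, x ∉ D → F x = 0) (x : D) :
    (killedWalk hc r D).density (fun x : D => F x) x =
      r ^ 2 * ∑' y, c x y * (F x - F y) ^ 2 := by
  rw [← (summable_mul_sq_sub hc hF x).sum_add_tsum_subtype_compl D, mul_add,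
    KilledGraph.density]
  congr 1
  · rw [Finset.mul_sum, ← Finset.sum_coe_sort D]
    exact Finset.sum_congr rfl fun y _ => mul_assoc _ _ _
  · simp only [killedWalk]
    rw [mul_assoc, ← tsum_mul_right]
    congr 1
    refine tsum_congr fun y => ?_
    rw [hF y y.2, sub_zero]

/-- Here the second moment enters: for a cutoff of slope of order `1 / r` the factors of `r` cancel
and a multiple of `muAt` remains. -/
theorem killedWalk_density_le (hc : IsConductance c) (r : ℝ) {D : Finset (Site d)}
    {F : Site d → ℝ} (hF : ∀ x, x ∉ D → F x = 0) {L : ℝ}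
    (hLip : ∀ x y, |F x - F y| ≤ euclid (y - x) * L) (x : D) (hmu : muAt c x ≠ ∞) :
    (killedWalk hc r D).density (fun x : D => F x) x ≤ r ^ 2 * L ^ 2 * (muAt c x).toReal := by
  have hn : ∀ y : Site d, 0 ≤ euclid (y - (x : Site d)) ^ 2 * c x y := fun y =>
    mul_nonneg (sq_nonneg _) (hc.nonneg _ _)
  have hs : Summable fun y : Site d => euclid (y - (x : Site d)) ^ 2 * c x y := by
    have h := ENNReal.summable_toReal hmu
    refine h.congr fun y => ?_
    rw [ENNReal.toReal_ofReal (hn y)]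
  have e : (muAt c x).toReal = ∑' y : Site d, euclid (y - (x : Site d)) ^ 2 * c x y := by
    rw [muAt, ← ENNReal.ofReal_tsum_of_nonneg hn hs, ENNReal.toReal_ofReal (tsum_nonneg hn)]
  rw [killedWalk_density hc r hF, e, mul_assoc]
  refine mul_le_mul_of_nonneg_left ?_ (sq_nonneg r)
  rw [← tsum_mul_left]
  refine (summable_mul_sq_sub hc hF x).tsum_le_tsum (fun y => ?_) (hs.mul_left _)
  have h1 : (F x - F y) ^ 2 ≤ (euclid (y - (x : Site d)) * L) ^ 2 := by
    rw [← sq_abs (F x - F y)]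
    exact pow_le_pow_left₀ (abs_nonneg _) (hLip _ _) 2
  calc c x y * (F x - F y) ^ 2 ≤ c x y * (euclid (y - (x : Site d)) * L) ^ 2 :=
        mul_le_mul_of_nonneg_left h1 (hc.nonneg _ _)
    _ = _ := by ring

theorem sum_units_le_density (hc : IsConductance c) (r : ℝ) {D : Finset (Site d)}
    {F : Site d → ℝ} (hF : ∀ x, x ∉ D → F x = 0) (x : D) :
    r ^ 2 * ∑ z ∈ units d, c x (x + z) * (F (x + z) - F x) ^ 2 ≤
      (killedWalk hc r D).density (fun x : D => F x) x := by
  rw [killedWalk_density hc r hF]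
  refine mul_le_mul_of_nonneg_left ?_ (sq_nonneg r)
  calc ∑ z ∈ units d, c x (x + z) * (F (x + z) - F x) ^ 2
      = ∑ y ∈ (units d).map (addLeftEmbedding (x : Site d)), c x y * (F x - F y) ^ 2 := by
        rw [Finset.sum_map]
        refine Finset.sum_congr rfl fun z _ => ?_
        simp only [addLeftEmbedding_apply]
        ring
    _ ≤ _ := (summable_mul_sq_sub hc hF x).sum_le_tsum _ fun y _ =>
        mul_nonneg (hc.nonneg _ _) (sq_nonneg _)

theorem pos_of_nuAt_ne_top {x : Site d} (h : nuAt c x ≠ ∞) {z : Site d} (hz : z ∈ units d) :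
    0 < c x (x + z) := by
  have h1 := ENNReal.sum_ne_top.1 h z hz
  rw [ENNReal.inv_ne_top] at h1
  exact ENNReal.ofReal_pos.1 (pos_iff_ne_zero.2 h1)

theorem sum_inv_eq_nuAt {x : Site d} (h : nuAt c x ≠ ∞) :
    ∑ z ∈ units d, (c x (x + z))⁻¹ = (nuAt c x).toReal := by
  rw [nuAt, ENNReal.toReal_sum fun z hz => ENNReal.sum_ne_top.1 h z hz]
  refine Finset.sum_congr rfl fun z hz => ?_
  rw [ENNReal.toReal_inv, ENNReal.toReal_ofReal (pos_of_nuAt_ne_top h hz).le]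

theorem card_ball_pos {r : ℝ} (hr : 0 ≤ r) : 0 < (ball d r).card := by
  refine Finset.card_pos.2 ⟨0, ?_⟩
  rw [mem_ball]
  simp [euclid, ← Pi.zero_def, hr]

theorem exists_extension {D : Finset (Site d)} (f : D → ℝ) :
    ∃ F : Site d → ℝ, (∀ x, x ∉ D → F x = 0) ∧ f = fun x : D => F x := by
  classical
  exact ⟨fun x => if hx : x ∈ D then f ⟨x, hx⟩ else 0, fun x hx => by simp [hx],
    by funext x; simp⟩

set_option maxHeartbeats 800000 in
/-- The weak Sobolev inequality for the killed walk. -/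
theorem killedWalk_sobolevBound (hd : 2 ≤ d) (hc : IsConductance c) {r : ℝ} (hr : 1 ≤ r)
    {D : Finset (Site d)} (hDpos : 0 < D.card) (hDcard : (D.card : ℝ) ≤ (6 * r) ^ d)
    {q N : ℝ} (hq : 1 < q) (hN : 0 ≤ N) (hnu : ∀ x ∈ D, nuAt c x ≠ ∞)
    (hnuN : avg (fun x : D => (nuAt c x).toReal ^ q) ≤ N ^ q) :
    (killedWalk hc r D).SobolevBound (2 - 2 / d) (1 - 1 / q) (288 * N) := by
  classical
  intro f hf h hh
  obtain ⟨F, hFD, rfl⟩ := exists_extension f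
  have hd0 : (0 : ℝ) < d := by exact_mod_cast (by omega : 0 < d)
  set G := killedWalk hc r D with hG
  set n : ℝ := (Fintype.card D : ℝ) with hn
  have hnD : n = (D.card : ℝ) := by rw [hn, Fintype.card_coe]
  have hn0 : 0 < n := by rw [hnD]; exact_mod_cast hDpos
  have hF0 : ∀ x, 0 ≤ F x := fun x => by
    by_cases hx : x ∈ D
    · exact hf ⟨x, hx⟩
    · exact (hFD x hx).ge
  have key := mul_card_rpow_le hd hF0 hFD hh
  set A : ℝ := ((D.filter fun x => h ≤ F x).card : ℝ) with hA
  set D' := D.filter fun x => 0 < F x with hD'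
  have hfrA : frac {x : D | h ≤ F x} = A / n := by
    rw [hnD, hA, ← frac_coe (D := D) (fun x => h ≤ F x)]
  have hfrD' : frac {x : D | 0 < F x} = (D'.card : ℝ) / n := by
    rw [hnD, hD', ← frac_coe (D := D) (fun x => 0 < F x)]
  set T := ∑ x ∈ D', ∑ z ∈ units d, |F (x + z) - F x| with hT
  have hD'D : ∀ x ∈ D', x ∈ D := fun x hx => (Finset.mem_filter.1 hx).1
  set X := ∑ x ∈ D', ∑ z ∈ units d, c x (x + z) * (F (x + z) - F x) ^ 2 with hX
  set Y := ∑ x ∈ D', ∑ z ∈ units d, (c x (x + z))⁻¹ with hY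
  -- Cauchy–Schwarz between conductances and resistances of nearest-neighbour edges.
  have hTXY : T ^ 2 ≤ X * Y := by
    rw [hT, hX, hY, ← Finset.sum_product', ← Finset.sum_product', ← Finset.sum_product']
    refine Finset.sum_sq_le_sum_mul_sum_of_sq_le_mul _ (fun a _ =>
      mul_nonneg (hc.nonneg _ _) (sq_nonneg _)) (fun a _ => inv_nonneg.2 (hc.nonneg _ _)) ?_
    intro a ha
    rw [Finset.mem_product] at ha
    have := pos_of_nuAt_ne_top (hnu a.1 (hD'D _ ha.1)) ha.2
    rw [sq_abs]
    refine le_of_eq ?_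
    field_simp
  have hXle : r ^ 2 * X ≤ 2 * G.form (fun x => F x) (fun x => F x) := by
    refine le_trans ?_ (G.sum_density_le _)
    rw [hX, Finset.mul_sum]
    calc ∑ x ∈ D', r ^ 2 * ∑ z ∈ units d, c x (x + z) * (F (x + z) - F x) ^ 2
        ≤ ∑ x ∈ D, r ^ 2 * ∑ z ∈ units d, c x (x + z) * (F (x + z) - F x) ^ 2 :=
          Finset.sum_le_sum_of_subset_of_nonneg (Finset.filter_subset _ _) fun x _ _ =>
            mul_nonneg (sq_nonneg _) (Finset.sum_nonneg fun z _ =>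
              mul_nonneg (hc.nonneg _ _) (sq_nonneg _))
      _ = ∑ x : D, r ^ 2 * ∑ z ∈ units d, c x (x + z) * (F (x + z) - F x) ^ 2 :=
          (Finset.sum_coe_sort D fun x : Site d =>
            r ^ 2 * ∑ z ∈ units d, c x (x + z) * (F (x + z) - F x) ^ 2).symm
      _ ≤ _ := by
          refine Finset.sum_le_sum fun x _ => ?_
          exact sum_units_le_density hc r hFD x
  set φ := (D'.card : ℝ) / n with hφ
  have hφ0 : 0 ≤ φ := by positivity
  -- Hölder against the indicator of the support yields the power `1 - 1 / q` of its proportion.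
  have hYle : Y ≤ n * (φ ^ (1 - 1 / q) * N) := by
    have h1 : Y = ∑ x ∈ D', (nuAt c x).toReal :=
      Finset.sum_congr rfl fun x hx => sum_inv_eq_nuAt (hnu x (hD'D x hx))
    have h2 : Y = n * avg (fun x : D => {x : D | 0 < F x}.indicator 1 x * (nuAt c x).toReal) := by
      have e : (fun x : D => ({x : D | 0 < F x}.indicator 1 x : ℝ) * (nuAt c x).toReal) =
          fun x : D => if 0 < F x then (nuAt c x).toReal else 0 := by
        funext x
        by_cases hx : 0 < F x <;> simp [hx]
      rw [e, avg_coe fun x => if 0 < F x then (nuAt c x).toReal else 0, ← hnD,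
        mul_div_cancel₀ _ hn0.ne', h1, hD', Finset.sum_filter]
    rw [h2]
    refine mul_le_mul_of_nonneg_left ?_ hn0.le
    have h3 := avg_mul_le hq (a := {x : D | 0 < F x}.indicator 1)
      (fun x => Set.indicator_nonneg (by simp) x)
      (fun x => Set.indicator_apply_le' (by simp) (by simp))
      (fun x : D => ENNReal.toReal_nonneg (a := nuAt c x)) hN hnuN
    refine h3.trans (le_of_eq ?_)
    have h4 : avg ({x : D | 0 < F x}.indicator 1) = φ := by
      rw [← hfrD']; rfl
    rw [h4]
  have hA0 : 0 ≤ A := by positivity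
  have hY0 : 0 ≤ Y := Finset.sum_nonneg fun x _ => Finset.sum_nonneg fun z _ =>
    inv_nonneg.2 (hc.nonneg _ _)
  have hsq : (h * A ^ (1 - 1 / (d : ℝ))) ^ 2 ≤ 4 * (X * Y) := by
    calc (h * A ^ (1 - 1 / (d : ℝ))) ^ 2 ≤ (2 * T) ^ 2 :=
          pow_le_pow_left₀ (by positivity) key 2
      _ ≤ 4 * (X * Y) := by nlinarith
  have hE0 := G.form_nonneg (fun x => F x)
  have hr0 : 0 < r := by linarith
  have hmain : r ^ 2 * (h ^ 2 * A ^ (2 - 2 / (d : ℝ))) ≤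
      8 * G.form (fun x => F x) (fun x => F x) * (n * (φ ^ (1 - 1 / q) * N)) := by
    have e : (h * A ^ (1 - 1 / (d : ℝ))) ^ 2 = h ^ 2 * A ^ (2 - 2 / (d : ℝ)) := by
      rw [mul_pow, ← Real.rpow_mul_natCast hA0]
      congr 2
      push_cast
      ring
    rw [← e]
    calc r ^ 2 * (h * A ^ (1 - 1 / (d : ℝ))) ^ 2 ≤ r ^ 2 * (4 * (X * Y)) := by gcongr
      _ = 4 * ((r ^ 2 * X) * Y) := by ring
      _ ≤ 4 * ((2 * G.form (fun x => F x) (fun x => F x)) * Y) := by gcongr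
      _ ≤ 4 * ((2 * G.form (fun x => F x) (fun x => F x)) * (n * (φ ^ (1 - 1 / q) * N))) := by gcongr
      _ = _ := by ring
  -- Diffusive scaling: the factor `r ^ 2` in the rates compensates the volume power. The constant
  -- is `288 = 8 * 36`.
  have hvol : n ^ (2 / (d : ℝ)) ≤ 36 * r ^ 2 := by
    have h1 : n ≤ (6 * r) ^ d := by rwa [hnD]
    calc n ^ (2 / (d : ℝ)) ≤ ((6 * r) ^ d) ^ (2 / (d : ℝ)) :=
          Real.rpow_le_rpow hn0.le h1 (by positivity)
      _ = (6 * r) ^ (2 : ℝ) := by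
          rw [← Real.rpow_natCast_mul (by positivity)]
          congr 1
          field_simp
      _ = 36 * r ^ 2 := by rw [Real.rpow_two]; ring
  rw [hfrA, hfrD', Real.div_rpow hA0 hn0.le]
  have hnn : n ^ (2 - 2 / (d : ℝ)) * n ^ (2 / (d : ℝ)) = n ^ 2 := by
    rw [← Real.rpow_add hn0, sub_add_cancel, Real.rpow_two]
  have hnpos : 0 < n ^ (2 - 2 / (d : ℝ)) := by positivity
  rw [mul_div_assoc', div_le_iff₀ hnpos]
  set E := G.form (fun x => F x) (fun x => F x)
  set ψ := φ ^ (1 - 1 / q) with hψ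
  have hψ0 : 0 ≤ ψ := by positivity
  have hfin : h ^ 2 * A ^ (2 - 2 / (d : ℝ)) * r ^ 2 * n ≤ 8 * N * (E * ψ) * n ^ 2 := by
    calc h ^ 2 * A ^ (2 - 2 / (d : ℝ)) * r ^ 2 * n = r ^ 2 * (h ^ 2 * A ^ (2 - 2 / (d : ℝ))) * n := by
          ring
      _ ≤ 8 * E * (n * (ψ * N)) * n := mul_le_mul_of_nonneg_right hmain hn0.le
      _ = _ := by ring
  have h3 : 8 * N * (E * ψ) * n ^ 2 ≤ 8 * N * (E * ψ) * (n ^ (2 - 2 / (d : ℝ)) * (36 * r ^ 2)) := by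
    rw [← hnn]
    exact mul_le_mul_of_nonneg_left (mul_le_mul_of_nonneg_left hvol hnpos.le) (by positivity)
  have h4 : (h ^ 2 * A ^ (2 - 2 / (d : ℝ))) * (r ^ 2 * n) ≤
      (288 * N * (E / n) * ψ * n ^ (2 - 2 / (d : ℝ))) * (r ^ 2 * n) := by
    have e : (288 * N * (E / n) * ψ * n ^ (2 - 2 / (d : ℝ))) * (r ^ 2 * n) =
        8 * N * (E * ψ) * (n ^ (2 - 2 / (d : ℝ)) * (36 * r ^ 2)) := by
      field_simp
      ring
    rw [e]
    linarith
  exact le_of_mul_le_mul_right h4 (by positivity)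

theorem ball_mono {a b : ℝ} (h : a ≤ b) : ball d a ⊆ ball d b := fun x hx => by
  rw [mem_ball] at hx ⊢
  exact hx.trans h

/-- The value 25 is the squared slope, in units of `1 / r`, of the steeper of the two cutoffs used,
whose annulus has width `r / 5`. -/
theorem avg_density_cutoff_le (hc : IsConductance c) {r a b p M : ℝ} (hab : a < b)
    (hb : b ≤ 2 * r) (hL : r ^ 2 * (1 / (b - a)) ^ 2 ≤ 25) (hp : 0 ≤ p)
    (hM : 0 ≤ M) (hmu : ∀ x ∈ ball d (2 * r), muAt c x ≠ ∞)
    (hmuM : avg (fun x : ball d (2 * r) => (muAt c x).toReal ^ p) ≤ M ^ p) :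
    avg (fun x => (killedWalk hc r (ball d (2 * r))).density
      (fun x : ball d (2 * r) => cutoff a b (x : Site d)) x ^ p) ≤ (25 * M) ^ p := by
  calc _ ≤ avg (fun x : ball d (2 * r) => 25 ^ p * (muAt c x).toReal ^ p) := by
        refine avg_mono fun x => ?_
        rw [← Real.mul_rpow (by norm_num) ENNReal.toReal_nonneg]
        refine Real.rpow_le_rpow (KilledGraph.density_nonneg _ _ _) ?_ hp
        refine (killedWalk_density_le hc r (L := 1 / (b - a)) (fun y hy => ?_) (fun y z => ?_) x
          (hmu x x.2)).trans (mul_le_mul_of_nonneg_right hL ENNReal.toReal_nonneg)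
        · rw [mem_ball, not_le] at hy
          exact cutoff_eq_zero hab (by linarith)
        · rw [mul_one_div]
          exact abs_cutoff_sub_le hab y z
    _ ≤ _ := by
        rw [avg_const_mul, Real.mul_rpow (by norm_num) hM]
        exact mul_le_mul_of_nonneg_left hmuM (by positivity)

theorem avg_avg_indicator {D B : Finset (Site d)} (hBD : B ⊆ D) (φ : Site d → Site d → ℝ) :
    avg (fun x : D => avg fun z : D => {x : D | (x : Site d) ∈ B}.indicator 1 x *
      ({x : D | (x : Site d) ∈ B}.indicator 1 z * φ x z)) =
      (∑ x ∈ B, ∑ z ∈ B, φ x z) / (D.card : ℝ) ^ 2 := by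
  classical
  have key : ∀ ψ : Site d → ℝ, avg (fun x : D => {x : D | (x : Site d) ∈ B}.indicator 1 x * ψ x) =
      (∑ x ∈ B, ψ x) / D.card := by
    intro ψ
    have e : (fun x : D => ({x : D | (x : Site d) ∈ B}.indicator 1 x : ℝ) * ψ x) =
        fun x : D => (fun x => if x ∈ B then ψ x else 0) (x : Site d) := by
      funext x
      by_cases hx : (x : Site d) ∈ B <;> simp [hx]
    rw [e, avg_coe fun x => if x ∈ B then ψ x else 0, ← Finset.sum_filter, Finset.filter_mem_eq_inter,
      Finset.inter_eq_right.2 hBD]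
  simp only [avg_const_mul]
  have e : ∀ x : D, avg (fun z : D => ({x : D | (x : Site d) ∈ B}.indicator 1 z : ℝ) * φ x z) =
      (fun x => (∑ z ∈ B, φ x z) / D.card) (x : Site d) := fun x => key _
  simp only [e]
  rw [key fun x => (∑ z ∈ B, φ x z) / D.card, ← Finset.sum_div, div_div, sq]

theorem sum_nuAt_le {D : Finset (Site d)} (hDpos : 0 < D.card) {q N : ℝ} (hq : 1 < q) (hN : 0 ≤ N)
    (hnuN : avg (fun x : D => (nuAt c x).toReal ^ q) ≤ N ^ q) :
    ∑ x ∈ D, (nuAt c x).toReal ≤ D.card * N := by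
  have h1 := avg_mul_le hq (a := fun _ : D => 1) (fun _ => zero_le_one) (fun _ => le_rfl)
    (fun x : D => ENNReal.toReal_nonneg (a := nuAt c x)) hN hnuN
  have : Nonempty D := (Finset.card_pos.1 hDpos).to_subtype
  rw [avg_const, Real.one_rpow, one_mul] at h1
  simp only [one_mul] at h1
  rw [avg_coe fun x => (nuAt c x).toReal] at h1
  have h2 : (0 : ℝ) < D.card := by exact_mod_cast hDpos
  rw [div_le_iff₀ h2] at h1
  linarith

/-- Cauchy–Schwarz between conductances and resistances. The cutoff `g` is 1 on the ball, so the
weight of the energy is 1 on the edges used. -/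
theorem sum_innerDiff_sq_le (hc : IsConductance c) {σ : ℝ} {D : Finset (Site d)}
    (hσ : ball d σ ⊆ D) {g : Site d → ℝ} (hg : ∀ x ∈ ball d σ, g x = 1)
    (hnu : ∀ x ∈ D, nuAt c x ≠ ∞) (H : Site d → ℝ) :
    (∑ i, ∑ y ∈ ball d σ, innerDiff σ H i y) ^ 2 ≤
      (∑ x ∈ D, ∑ y ∈ D, c x y * (min (g x) (g y) ^ 2 * (H x - H y) ^ 2)) *
        ∑ x ∈ D, (nuAt c x).toReal := by
  classical
  rw [Finset.sum_comm]
  set a : Site d → Fin d → ℝ := fun y i =>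
    if y + Pi.single i 1 ∈ ball d σ then
      c y (y + Pi.single i 1) * (H y - H (y + Pi.single i 1)) ^ 2 else 0 with ha
  set b : Site d → Fin d → ℝ := fun y i => (c y (y + Pi.single i 1))⁻¹ with hb
  have hab : (∑ y ∈ ball d σ, ∑ i, innerDiff σ H i y) ^ 2 ≤
      (∑ y ∈ ball d σ, ∑ i, a y i) * ∑ y ∈ ball d σ, ∑ i, b y i := by
    rw [← Finset.sum_product', ← Finset.sum_product', ← Finset.sum_product']
    refine Finset.sum_sq_le_sum_mul_sum_of_sq_le_mul _ (fun x _ => ?_)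
      (fun x _ => inv_nonneg.2 (hc.nonneg _ _)) ?_
    · simp only [ha]
      split_ifs
      · exact mul_nonneg (hc.nonneg _ _) (sq_nonneg _)
      · exact le_rfl
    · rintro ⟨y, i⟩ hy
      rw [Finset.mem_product] at hy
      have hpos := pos_of_nuAt_ne_top (hnu y (hσ hy.1)) (mem_units.2 (euclid_single i))
      simp only [ha, hb, innerDiff, hy.1, true_and]
      split_ifs
      · rw [sq_abs, diff]
        refine le_of_eq ?_
        field_simp
        ring
      · simp
  refine hab.trans (mul_le_mul ?_ ?_ (Finset.sum_nonneg fun y _ => Finset.sum_nonneg fun i _ =>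
    inv_nonneg.2 (hc.nonneg _ _)) (Finset.sum_nonneg fun y _ => Finset.sum_nonneg fun i _ =>
      mul_nonneg (hc.nonneg _ _) (by positivity)))
  · refine (Finset.sum_le_sum fun y hy => ?_).trans (Finset.sum_le_sum_of_subset_of_nonneg hσ
      fun y _ _ => Finset.sum_nonneg fun i _ => mul_nonneg (hc.nonneg _ _) (by positivity))
    have h0 : ∀ z : Site d, 0 ≤ if y + z ∈ ball d σ then
        c y (y + z) * (H y - H (y + z)) ^ 2 else 0 := fun z => by
      split_ifs
      · exact mul_nonneg (hc.nonneg _ _) (sq_nonneg _)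
      · exact le_rfl
    calc ∑ i, a y i ≤ ∑ z ∈ units d, if y + z ∈ ball d σ then
          c y (y + z) * (H y - H (y + z)) ^ 2 else 0 := sum_single_le_sum_units h0
      _ = ∑ z ∈ (units d).map (addLeftEmbedding y), if z ∈ ball d σ then
          c y z * (H y - H z) ^ 2 else 0 := by
          rw [Finset.sum_map]
          rfl
      _ = ∑ z ∈ ((units d).map (addLeftEmbedding y)).filter (· ∈ ball d σ),
          c y z * (min (g y) (g z) ^ 2 * (H y - H z) ^ 2) := by
          rw [← Finset.sum_filter]
          refine Finset.sum_congr rfl fun z hz => ?_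
          rw [hg y hy, hg z (Finset.mem_filter.1 hz).2, min_self, one_pow, one_mul]
      _ ≤ _ := Finset.sum_le_sum_of_subset_of_nonneg
          (fun z hz => hσ (Finset.mem_filter.1 hz).2)
          fun z _ _ => mul_nonneg (hc.nonneg _ _) (by positivity)
  · refine (Finset.sum_le_sum fun y hy => ?_).trans (Finset.sum_le_sum_of_subset_of_nonneg hσ
      fun y _ _ => ENNReal.toReal_nonneg)
    rw [← sum_inv_eq_nuAt (hnu y (hσ hy))]
    exact sum_single_le_sum_units fun z => inv_nonneg.2 (hc.nonneg _ _)

/-- The L¹ inequality along paths followed by Cauchy–Schwarz. The powers of `r` cancel because the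
cardinality of the ball is comparable to `r ^ d`. -/
theorem killedWalk_poincare (hd : 0 < d) (hc : IsConductance c) {r : ℝ} (hr : 2 ≤ r)
    {q N : ℝ} (hq : 1 < q) (hN : 0 ≤ N) (hnu : ∀ x ∈ ball d (2 * r), nuAt c x ≠ ∞)
    (hnuN : avg (fun x : ball d (2 * r) => (nuAt c x).toReal ^ q) ≤ N ^ q)
    (h : ball d (2 * r) → ℝ) :
    avg (fun x : ball d (2 * r) => avg fun z : ball d (2 * r) =>
      {x : ball d (2 * r) | (x : Site d) ∈ ball d (6 / 5 * r)}.indicator 1 x *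
      ({x : ball d (2 * r) | (x : Site d) ∈ ball d (6 / 5 * r)}.indicator 1 z *
        |h x - h z|)) ^ 2 ≤
      9 * N * (3 * √d / 2) ^ (2 * d) * (killedWalk hc r (ball d (2 * r))).cutoffEnergy
        (fun x => cutoff (17 / 10 * r) (2 * r) (x : Site d)) h := by
  obtain ⟨H, -, rfl⟩ := exists_extension h
  set D := ball d (2 * r) with hD
  have hDpos : 0 < D.card := card_ball_pos (by linarith)
  set n : ℝ := (D.card : ℝ) with hn
  have hn0 : 0 < n := by rw [hn]; exact_mod_cast hDpos
  set g : Site d → ℝ := cutoff (17 / 10 * r) (2 * r) with hg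
  rw [avg_avg_indicator (D := D) (ball_mono (by linarith)) fun x z => |H x - H z|]
  set X := ∑ x ∈ D, ∑ y ∈ D, c x y * (min (g x) (g y) ^ 2 * (H x - H y) ^ 2) with hX
  have hX0 : 0 ≤ X := Finset.sum_nonneg fun y _ => Finset.sum_nonneg fun i _ =>
    mul_nonneg (hc.nonneg _ _) (by positivity)
  have hCE : (killedWalk hc r D).cutoffEnergy (fun x : D => g x) (fun x : D => H x) =
      r ^ 2 * X / n := by
    rw [KilledGraph.cutoffEnergy, Fintype.card_coe, hX, ← Finset.sum_coe_sort D, Finset.mul_sum]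
    congr 1
    refine Finset.sum_congr rfl fun x _ => ?_
    rw [← Finset.sum_coe_sort D, Finset.mul_sum]
    exact Finset.sum_congr rfl fun y _ => mul_assoc _ _ _
  rw [hCE]
  -- The radii fit since `2 * (6 / 5) ^ 2 = 2.88 ≤ 2.89 = (17 / 10) ^ 2`, with room left below `2 *
  -- r` for the cutoff `g`.
  have h1 := sum_abs_sub_le (d := d) (ρ := 6 / 5 * r) (σ := 17 / 10 * r) (by linarith)
    (by linarith) (by nlinarith) H
  have h2 := sum_innerDiff_sq_le hc (σ := 17 / 10 * r) (D := D) (ball_mono (by linarith)) (g := g)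
    (fun x hx => cutoff_eq_one (by linarith) (mem_ball.1 hx)) hnu H
  have h3 := sum_nuAt_le hDpos hq hN hnuN
  set T := ∑ i, ∑ y ∈ ball d (17 / 10 * r), innerDiff (17 / 10 * r) H i y with hT
  set Z := ∑ x ∈ ball d (6 / 5 * r), ∑ z ∈ ball d (6 / 5 * r), |H x - H z|
  have hT0 : 0 ≤ T := Finset.sum_nonneg fun i _ => Finset.sum_nonneg fun y _ =>
    innerDiff_nonneg _ _ _ _
  have hZ0 : 0 ≤ Z := Finset.sum_nonneg fun i _ => Finset.sum_nonneg fun y _ => abs_nonneg _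
  have hfl : 2 * (⌊6 / 5 * r⌋ : ℝ) + 1 ≤ 3 * r := by
    have := Int.floor_le (6 / 5 * r)
    linarith
  have hfl0 : 0 ≤ 2 * (⌊6 / 5 * r⌋ : ℝ) + 1 := by
    have : (0 : ℝ) ≤ ⌊6 / 5 * r⌋ := by exact_mod_cast Int.floor_nonneg.2 (by linarith)
    linarith
  have hZT : Z ≤ (3 * r) ^ (d + 1) * T :=
    h1.trans (mul_le_mul_of_nonneg_right (pow_le_pow_left₀ hfl0 hfl _) hT0)
  have hZ2 : Z ^ 2 ≤ (3 * r) ^ (2 * d + 2) * (X * (n * N)) := by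
    calc Z ^ 2 ≤ ((3 * r) ^ (d + 1) * T) ^ 2 := pow_le_pow_left₀ hZ0 hZT 2
      _ = (3 * r) ^ (2 * d + 2) * T ^ 2 := by ring
      _ ≤ _ := by
          refine mul_le_mul_of_nonneg_left (h2.trans ?_) (by positivity)
          exact mul_le_mul_of_nonneg_left h3 hX0
  have hvol : (2 * r) ^ (2 * d) ≤ n ^ 2 * √d ^ (2 * d) := by
    have hs : 0 < √(d : ℝ) := Real.sqrt_pos.2 (by exact_mod_cast hd)
    have h4 := le_card_ball hd (r := 2 * r) (by linarith)
    rw [div_pow, div_le_iff₀ (by positivity)] at h4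
    calc (2 * r) ^ (2 * d) = ((2 * r) ^ d) ^ 2 := by ring
      _ ≤ (n * √d ^ d) ^ 2 := pow_le_pow_left₀ (by positivity) h4 2
      _ = _ := by ring
  have hr0 : 0 < r := by linarith
  rw [div_pow, div_le_iff₀ (by positivity)]
  refine hZ2.trans ?_
  have e1 : (3 * r) ^ (2 * d + 2) * (X * (n * N)) =
      (9 * N * X * r ^ 2 * n * (3 / 2) ^ (2 * d)) * (2 * r) ^ (2 * d) := by
    have : 3 * r = 3 / 2 * (2 * r) := by ring
    rw [pow_add, this, mul_pow]
    ring
  have e2 : 9 * N * (3 * √d / 2) ^ (2 * d) * (r ^ 2 * X / n) * (n ^ 2) ^ 2 =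
      (9 * N * X * r ^ 2 * n * (3 / 2) ^ (2 * d)) * (n ^ 2 * √d ^ (2 * d)) := by
    have : 3 * √(d : ℝ) / 2 = 3 / 2 * √d := by ring
    rw [this, mul_pow]
    field_simp
  rw [e1, e2]
  exact mul_le_mul_of_nonneg_left hvol (by positivity)

theorem killedWalk_localized (hd : 0 < d) (hc : IsConductance c) {r : ℝ} (hr : 2 ≤ r)
    {p q M : ℝ} (hp : 1 < p) (hq : 1 < q) (hM : 0 ≤ M)
    (hmu : ∀ x ∈ ball d (2 * r), muAt c x ≠ ∞) (hnu : ∀ x ∈ ball d (2 * r), nuAt c x ≠ ∞)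
    (hmuM : avg (fun x : ball d (2 * r) => (muAt c x).toReal ^ p) ≤ M ^ p)
    (hnuM : avg (fun x : ball d (2 * r) => (nuAt c x).toReal ^ q) ≤ M ^ q) :
    (killedWalk hc r (ball d (2 * r))).Localized {x | (x : Site d) ∈ ball d r}
      {x | (x : Site d) ∈ ball d (6 / 5 * r)} (fun x => cutoff r (6 / 5 * r) (x : Site d))
      (fun x => cutoff (17 / 10 * r) (2 * r) (x : Site d)) p (25 * M) (9 * M * (3 * √d / 2) ^ (2 * d))
      ((1 / (6 * √d)) ^ d) where
  f_nonneg x := cutoff_nonneg _ _ _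
  f_le_one x := cutoff_le_one _ _ _
  g_nonneg x := cutoff_nonneg _ _ _
  g_le_one x := cutoff_le_one _ _ _
  f_eq_one x hx := cutoff_eq_one (by linarith) (mem_ball.1 hx)
  f_eq_zero x hx := by
    rw [Set.mem_ofPred_eq, mem_ball, not_le] at hx
    exact cutoff_eq_zero (by linarith) hx.le
  density_f := by
    refine avg_density_cutoff_le hc (by linarith) (by linarith) ?_ (by linarith) hM hmu hmuM
    have : 6 / 5 * r - r = r / 5 := by ring
    rw [this]
    field_simp
    norm_num
  density_g := by
    refine avg_density_cutoff_le hc (by linarith) (by linarith) ?_ (by linarith) hM hmu hmuM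
    have : 2 * r - 17 / 10 * r = r * (3 / 10) := by ring
    rw [this]
    field_simp
    norm_num
  poincare h := killedWalk_poincare hd hc hr hq hM hnu hnuM h
  frac_ge := by
    classical
    rw [frac_coe (D := ball d (2 * r)) (fun x => x ∈ ball d r), Finset.filter_mem_eq_inter,
      Finset.inter_eq_right.2 (ball_mono (by linarith))]
    have hpos : (0 : ℝ) < (ball d (2 * r)).card := by
      exact_mod_cast card_ball_pos (by linarith)
    have hs : 0 < √(d : ℝ) := Real.sqrt_pos.2 (by exact_mod_cast hd)
    rw [le_div_iff₀ hpos]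
    calc (1 / (6 * √d)) ^ d * ((ball d (2 * r)).card : ℝ)
        ≤ (1 / (6 * √d)) ^ d * (3 * (2 * r)) ^ d :=
          mul_le_mul_of_nonneg_left (card_ball_le (by linarith)) (by positivity)
      _ = (r / √d) ^ d := by
          rw [← mul_pow]
          congr 1
          field_simp
          norm_num
      _ ≤ _ := le_card_ball hd (by linarith)

end KilledWalk

/-! ### The weak Harnack inequality in a fixed environment. -/

/-- The weak Harnack inequality for supersolutions of the killed equation. -/
theorem exists_sum_le_of_gen_sub_le (hd : 2 ≤ d) {p q M : ℝ} (hp : 1 < p) (hq : 1 < q)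
    (hpq : 1 / p + 1 / q < 2 / d) (hM : 0 ≤ M) :
    ∃ K : ℝ, 0 < K ∧ ∀ (c : Site d → Site d → ℝ) (hc : IsConductance c) (r : ℝ), 2 ≤ r →
      (∀ x ∈ ball d (2 * r), muAt c x ≠ ∞) → (∀ x ∈ ball d (2 * r), nuAt c x ≠ ∞) →
      avg (fun x : ball d (2 * r) => (muAt c x).toReal ^ p) ≤ M ^ p →
      avg (fun x : ball d (2 * r) => (nuAt c x).toReal ^ q) ≤ M ^ q →
      ∀ (T H : ℝ) (u e F : ℝ → ball d (2 * r) → ℝ), 2 ≤ T → T ≤ 4 → 0 ≤ H →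
        (∀ y, ContinuousOn (fun s => u s y) (Icc 0 T)) →
        (∀ s ∈ Ioo 0 T, ∀ y, HasDerivAt (fun s => u s y) (e s y) s) →
        (∀ s ∈ Ioo 0 T, ∀ y, (killedWalk hc r (ball d (2 * r))).gen (u s) y - F s y ≤ e s y) →
        (∀ s ∈ Ioo 0 T, ∀ y, 0 ≤ F s y) →
        (∀ s ∈ Ioo 0 T, avg (fun y => F s y ^ p) ≤ H ^ p) → (∀ y, 0 ≤ u 0 y) →
        ∀ x : ball d (2 * r), (x : Site d) ∈ ball d r → 0 ≤ u T x →
          avg (fun y => {y : ball d (2 * r) | (y : Site d) ∈ ball d r}.indicator 1 y * u 0 y) ≤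
            K * (u T x + H) := by
  have hd0 : (0 : ℝ) < d := by exact_mod_cast (by omega : 0 < d)
  have hd2 : (2 : ℝ) ≤ d := by exact_mod_cast hd
  have hQ : 0 < 1 - 1 / q := by rw [sub_pos, div_lt_one (by linarith)]; exact hq
  have hD : 1 ≤ 2 - 2 / (d : ℝ) := by
    have : 2 / (d : ℝ) ≤ 1 := by rw [div_le_one hd0]; exact hd2
    linarith
  -- With `D = 2 - 2 / d` and the two Hölder exponents, the closing condition of the recursion is `1
  -- / p + 1 / q < 2 / d`.
  have hPQ : 2 - 2 / (d : ℝ) < 1 - 1 / p + (1 - 1 / q) := by linarith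
  have hs : 0 < √(d : ℝ) := Real.sqrt_pos.2 hd0
  obtain ⟨a, ha0, ha⟩ := KilledGraph.exists_le_density hp hQ hD hPQ (S := 288 * M) (W := 25 * M)
    (A := 9 * M * (3 * √d / 2) ^ (2 * d)) (β := (1 / (6 * √d)) ^ d) (by positivity)
    (by positivity) (by positivity) (by positivity)
  obtain ⟨K, hK0, hK⟩ := KilledGraph.exists_avg_sub_le hp hQ hD hPQ (S := 288 * M) (by positivity)
  refine ⟨(1 + K) / a, by positivity, ?_⟩
  intro c hc r hr hmu hnu hmuM hnuM T H u e F hT2 hT4 hH hcont hder hgen hF0 hFH hu0 x hx hux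
  have hsob := killedWalk_sobolevBound hd hc (r := r) (D := ball d (2 * r)) (by linarith)
    (card_ball_pos (by linarith))
    ((card_ball_le (by linarith)).trans (le_of_eq (by ring))) hq hM hnu hnuM
  have hloc := killedWalk_localized (by omega) hc hr hp hq hM hmu hnu hmuM hnuM
  obtain ⟨v, hv, hv0⟩ := (killedWalk hc r (ball d (2 * r))).exists_isHeat
    (Pi.single x (Fintype.card (ball d (2 * r)) : ℝ))
  have h1 := hK _ _ hsob x v hv hv0 T H u e F (by linarith) hT4 hH hcont hder hgen hF0 hFH
  have hvn : ∀ y, 0 ≤ v T y := fun y => hv.nonneg (fun z => by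
    rw [hv0, Pi.single_apply]
    split_ifs <;> positivity) (by linarith) y
  have h2 : a * avg (fun y => {y : ball d (2 * r) | (y : Site d) ∈ ball d r}.indicator 1 y *
      u 0 y) ≤ avg (fun y => v T y * u 0 y) := by
    rw [← avg_const_mul]
    refine avg_mono fun y => ?_
    by_cases hy : (y : Site d) ∈ ball d r
    · have := ha _ _ _ _ _ _ hsob hloc x hx y hy v hv hv0 T hT2 hT4
      simpa [hy] using mul_le_mul_of_nonneg_right this (hu0 y)
    · simpa [hy] using mul_nonneg (hvn y) (hu0 y)
  have hlow : 0 ≤ avg (fun y => v T y * u 0 y) := avg_nonneg fun y => mul_nonneg (hvn y) (hu0 y)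
  rw [div_mul_eq_mul_div, le_div_iff₀ ha0]
  have h3 := mul_nonneg hK0.le hux
  linarith

theorem summable_negPart (c : Site d → Site d → ℝ) {f : Site d → ℝ} {x : Site d}
    (hc : IsConductance c) (h : Summable fun y => (f y - f x) * c x y) :
    Summable fun y => max (-f y) 0 * c x y := by
  have h1 : Summable fun y => f y * c x y := by
    refine (h.add ((hc.summable x).mul_left (f x))).congr fun y => ?_
    ring
  refine h1.abs.of_nonneg_of_le (fun y => mul_nonneg (le_max_right _ _) (hc.nonneg _ _)) fun y => ?_
  rw [abs_mul, abs_of_nonneg (hc.nonneg _ _)]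
  exact mul_le_mul_of_nonneg_right (max_le (neg_le_abs _) (abs_nonneg _)) (hc.nonneg _ _)

theorem toReal_tailNeg {c : Site d → Site d → ℝ} {f : Site d → ℝ} {x : Site d}
    (hc : IsConductance c) (h : Summable fun y => (f y - f x) * c x y) (R : ℝ) :
    tailNeg c f R x = ENNReal.ofReal
      (R ^ 2 * ∑' y : {y // y ∉ ball d R}, max (-f y) 0 * c x y) := by
  rw [tailNeg, ENNReal.ofReal_mul (sq_nonneg R), ENNReal.ofReal_tsum_of_nonneg
    (fun y => mul_nonneg (le_max_right _ _) (hc.nonneg _ _))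
    ((summable_negPart c hc h).subtype _)]

/-- The killed generator treats `f` as 0 off `D`. Inside the large ball this discards nonnegative
terms; outside it the loss is at most the negative part, which is the tail. The factor `R ^ 2` in
`tailNeg` turns `r ^ 2` into `(r / R) ^ 2`. -/
theorem gen_sub_tail_le {c : Site d → Site d → ℝ} {f : Site d → ℝ} (hc : IsConductance c)
    {r R : ℝ} (hR : R ≠ 0) {D : Finset (Site d)} (hf : ∀ y ∈ ball d R, 0 ≤ f y) (x : D)
    (h : Summable fun y => (f y - f x) * c x y) :
    (killedWalk hc r D).gen (fun y => f y) x -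
      (r / R) ^ 2 * (tailNeg c f R x).toReal ≤ r ^ 2 * ∑' y, (f y - f x) * c x y := by
  have hneg := summable_negPart c hc h
  have hneg0 : ∀ y, 0 ≤ max (-f y) 0 * c x y := fun y =>
    mul_nonneg (le_max_right _ _) (hc.nonneg _ _)
  rw [toReal_tailNeg hc h, ENNReal.toReal_ofReal (mul_nonneg (sq_nonneg _)
    (tsum_nonneg fun y : {y // y ∉ ball d R} => hneg0 y)), ← h.sum_add_tsum_subtype_compl D]
  have e1 : (r / R) ^ 2 * (R ^ 2 * ∑' y : {y // y ∉ ball d R}, max (-f y) 0 * c x y) =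
      r ^ 2 * ∑' y : {y // y ∉ ball d R}, max (-f y) 0 * c x y := by
    field_simp
  have e2 : (killedWalk hc r D).gen (fun y => f y) x =
      r ^ 2 * (∑ y ∈ D, (f y - f x) * c x y) - r ^ 2 * ((∑' y : {y // y ∉ D}, c x y) * f x) := by
    rw [KilledGraph.gen, Finset.mul_sum, ← Finset.sum_coe_sort D]
    simp only [killedWalk]
    rw [← mul_assoc]
    congr 1
    exact Finset.sum_congr rfl fun y _ => by ring
  rw [e1, e2, ← mul_sub, ← mul_sub]
  refine mul_le_mul_of_nonneg_left ?_ (sq_nonneg r)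
  rw [sub_sub]
  suffices hs : 0 ≤ ∑' y : {y // y ∉ D}, (f y - f x) * c x y +
      ((∑' y : {y // y ∉ D}, c x y) * f x + ∑' y : {y // y ∉ ball d R}, max (-f y) 0 * c x y) by
    linarith
  have hle : ∑' y : {y // y ∉ D}, (((ball d R : Set (Site d))ᶜ).indicator
      (fun y => max (-f y) 0 * c x y) (y : Site d)) ≤
      ∑' y : {y // y ∉ ball d R}, max (-f y) 0 * c x y := by
    have e3 : ∑' y : {y // y ∉ ball d R}, max (-f y) 0 * c x y =
        ∑' y, ((ball d R : Set (Site d))ᶜ).indicator (fun y => max (-f y) 0 * c x y) y :=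
      tsum_subtype ((ball d R : Set (Site d))ᶜ) fun y => max (-f y) 0 * c x y
    rw [e3]
    exact (hneg.indicator _).tsum_subtype_le _ (fun y => y ∉ D) (Set.indicator_nonneg fun y _ => hneg0 y)
  have hsum : Summable fun y : {y // y ∉ D} => ((ball d R : Set (Site d))ᶜ).indicator
      (fun y => max (-f y) 0 * c x y) (y : Site d) := (hneg.indicator _).subtype _
  have hs1 : Summable fun y : {y // y ∉ D} => (f y - f x) * c x y := h.subtype _
  have hs2 : Summable fun y : {y // y ∉ D} => c x y * f x := ((hc.summable x).mul_right _).subtype _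
  refine le_trans ?_ (add_le_add_right (add_le_add_right hle _) _)
  rw [← tsum_mul_right, ← hs2.tsum_add hsum, ← hs1.tsum_add (hs2.add hsum)]
  refine tsum_nonneg fun y => ?_
  by_cases hy : (y : Site d) ∈ ball d R
  · have : (y : Site d) ∉ ((ball d R : Set (Site d))ᶜ) := by simpa using hy
    rw [Set.indicator_of_notMem this]
    have := mul_nonneg (hf y hy) (hc.nonneg x y)
    linarith
  · have : (y : Site d) ∈ ((ball d R : Set (Site d))ᶜ) := by simpa using hy
    rw [Set.indicator_of_mem this]
    have := mul_le_mul_of_nonneg_right (le_max_left (-f y) 0) (hc.nonneg x y)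
    linarith

/-- The weak Harnack inequality between two fixed times. -/
theorem exists_sum_le_of_isCaloricOn (hd : 2 ≤ d) {p q M : ℝ} (hp : 1 < p) (hq : 1 < q)
    (hpq : 1 / p + 1 / q < 2 / d) (hM : 0 ≤ M) :
    ∃ K : ℝ, 0 < K ∧ ∀ (c : Site d → Site d → ℝ), IsConductance c → ∀ r R : ℝ, 2 ≤ r → 2 * r ≤ R →
      (∀ x ∈ ball d (2 * r), muAt c x ≠ ∞) → (∀ x ∈ ball d (2 * r), nuAt c x ≠ ∞) →
      avg (fun x : ball d (2 * r) => (muAt c x).toReal ^ p) ≤ M ^ p →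
      avg (fun x : ball d (2 * r) => (nuAt c x).toReal ^ q) ≤ M ^ q →
      ∀ (u : ℝ → Site d → ℝ) (I : Set ℝ), IsCaloricOn c u I (ball d R) →
        (∀ t ∈ I, ∀ x ∈ ball d R, 0 ≤ u t x) →
        ∀ s t : ℝ, Icc s t ⊆ I → 2 * r ^ 2 ≤ t - s → t - s ≤ 4 * r ^ 2 → ∀ S : ℝ, 0 ≤ S →
          (∀ σ ∈ Icc s t, avg (fun x : ball d (2 * r) => (tailNeg c (u σ) R x).toReal ^ p) ≤
            S ^ p) →
          ∀ x ∈ ball d r, (∑ y ∈ ball d r, u s y) / (ball d r).card ≤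
            K * (u t x + (r / R) ^ 2 * S) := by
  obtain ⟨K, hK0, hK⟩ := exists_sum_le_of_gen_sub_le hd hp hq hpq hM
  have hd0 : (0 : ℝ) < d := by exact_mod_cast (by omega : 0 < d)
  have hs : 0 < √(d : ℝ) := Real.sqrt_pos.2 hd0
  refine ⟨(6 * √d) ^ d * K, by positivity, ?_⟩
  intro c hc r R hr hrR hmu hnu hmuM hnuM u I hu hu0 s t hI hst2 hst4 S hS hSp x hx
  have hr0 : 0 < r := by linarith
  have hR0 : 0 < R := by linarith
  have hp0 : 0 < p := by linarith
  set D := ball d (2 * r) with hD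
  have hDR : D ⊆ ball d R := ball_mono hrR
  set T := (t - s) / r ^ 2 with hT
  have hT2 : 2 ≤ T := by rw [hT, le_div_iff₀ (by positivity)]; exact hst2
  have hT4 : T ≤ 4 := by rw [hT, div_le_iff₀ (by positivity)]; exact hst4
  have hTt : s + r ^ 2 * T = t := by rw [hT]; field_simp; ring
  have hmem : ∀ τ ∈ Icc 0 T, s + r ^ 2 * τ ∈ Icc s t := by
    intro τ hτ
    constructor
    · have := mul_nonneg (sq_nonneg r) hτ.1
      linarith
    · rw [← hTt]
      have := mul_le_mul_of_nonneg_left hτ.2 (sq_nonneg r)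
      linarith
  have hmemo : ∀ τ ∈ Ioo 0 T, s + r ^ 2 * τ ∈ Ioo s t := by
    intro τ hτ
    constructor
    · have := mul_pos (pow_pos hr0 2) hτ.1
      linarith
    · rw [← hTt]
      have := mul_lt_mul_of_pos_left hτ.2 (pow_pos hr0 2)
      linarith
  have hxD : x ∈ D := ball_mono (by linarith) hx
  have main := hK c hc r hr hmu hnu hmuM hnuM T ((r / R) ^ 2 * S)
    (fun τ y => u (s + r ^ 2 * τ) y)
    (fun τ y => r ^ 2 * ∑' z, (u (s + r ^ 2 * τ) z - u (s + r ^ 2 * τ) y) * c y z)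
    (fun τ y => (r / R) ^ 2 * (tailNeg c (u (s + r ^ 2 * τ)) R y).toReal) hT2 hT4 (by positivity)
    ?_ ?_ ?_ ?_ ?_ ?_ ⟨x, hxD⟩ hx ?_
  · rw [mul_zero, add_zero, hTt] at main
    have hn0 : (0 : ℝ) < D.card := by exact_mod_cast card_ball_pos (by linarith)
    have hm0 : (0 : ℝ) < (ball d r).card := by exact_mod_cast card_ball_pos hr0.le
    have e : avg (fun y : D => {y : D | (y : Site d) ∈ ball d r}.indicator 1 y * u s y) =
        (∑ y ∈ ball d r, u s y) / D.card := by
      have e1 : (fun y : D => ({y : D | (y : Site d) ∈ ball d r}.indicator 1 y : ℝ) * u s y) =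
          fun y : D => (fun y => if y ∈ ball d r then u s y else 0) (y : Site d) := by
        funext y
        by_cases hy : (y : Site d) ∈ ball d r <;> simp [hy]
      rw [e1, avg_coe fun y => if y ∈ ball d r then u s y else 0, ← Finset.sum_filter,
        Finset.filter_mem_eq_inter, Finset.inter_eq_right.2 (ball_mono (by linarith))]
    rw [e] at main
    -- Converts the average over the ball of radius `2 * r` into one over radius `r`.
    have hvol : (D.card : ℝ) ≤ (6 * √d) ^ d * (ball d r).card := by
      calc (D.card : ℝ) ≤ (3 * (2 * r)) ^ d := card_ball_le (by linarith)
        _ = (6 * √d) ^ d * (r / √d) ^ d := by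
            rw [← mul_pow]
            congr 1
            field_simp
            norm_num
        _ ≤ _ := mul_le_mul_of_nonneg_left (le_card_ball (by omega) hr0.le) (by positivity)
    have hsum0 : 0 ≤ ∑ y ∈ ball d r, u s y := Finset.sum_nonneg fun y hy =>
      hu0 s (hI ⟨le_rfl, by nlinarith⟩) y (hDR (ball_mono (by linarith) hy))
    rw [div_le_iff₀ hn0] at main
    rw [div_le_iff₀ hm0]
    have hpos : 0 ≤ K * (u t x + (r / R) ^ 2 * S) := by
      by_contra hneg
      have := mul_neg_of_neg_of_pos (not_le.1 hneg) hn0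
      linarith
    calc _ ≤ K * (u t x + (r / R) ^ 2 * S) * D.card := main
      _ ≤ K * (u t x + (r / R) ^ 2 * S) * ((6 * √d) ^ d * (ball d r).card) :=
          mul_le_mul_of_nonneg_left hvol hpos
      _ = _ := by ring
  · intro y
    have h1 : ContinuousOn (fun τ => u τ y) I := fun τ hτ =>
      (hu τ hτ y (hDR y.2)).2.continuousWithinAt
    exact h1.comp (by fun_prop) fun τ hτ => hI (hmem τ hτ)
  · intro τ hτ y
    have hτ' := hmemo τ hτ
    have h1 := (hu _ (hI (Ioo_subset_Icc_self hτ')) y (hDR y.2)).2.hasDerivAt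
      (Filter.mem_of_superset (Ioo_mem_nhds hτ'.1 hτ'.2) (Ioo_subset_Icc_self.trans hI))
    have h2 : HasDerivAt (fun τ => s + r ^ 2 * τ) (r ^ 2) τ := by
      simpa using ((hasDerivAt_id τ).const_mul (r ^ 2)).const_add s
    have h3 := h1.comp τ h2
    exact h3.congr_deriv (mul_comm _ _)
  · intro τ hτ y
    have hτ' := hI (Ioo_subset_Icc_self (hmemo τ hτ))
    exact gen_sub_tail_le hc hR0.ne' (fun z hz => hu0 _ hτ' z hz) y (hu _ hτ' y (hDR y.2)).1
  · intro τ hτ y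
    positivity
  · intro τ hτ
    have h1 := hSp _ (Ioo_subset_Icc_self (hmemo τ hτ))
    have e : ∀ y : D, ((r / R) ^ 2 * (tailNeg c (u (s + r ^ 2 * τ)) R y).toReal) ^ p =
        ((r / R) ^ 2) ^ p * (tailNeg c (u (s + r ^ 2 * τ)) R y).toReal ^ p := fun y =>
      Real.mul_rpow (by positivity) ENNReal.toReal_nonneg
    simp only [e]
    rw [avg_const_mul, Real.mul_rpow (by positivity) hS]
    exact mul_le_mul_of_nonneg_left h1 (by positivity)
  · intro y
    exact hu0 _ (hI (hmem 0 ⟨le_rfl, by linarith⟩)) y (hDR y.2)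
  · exact hu0 _ (hI (hmem T ⟨by linarith, le_rfl⟩)) x (hDR hxD)

/-! ### The maximal inequality and finiteness of the environment constant. -/

/-- Lattice cubes are closed balls of the sup metric, so Vitali's covering lemma applies to them. -/
theorem mem_closedBall_iff_sub_mem_cube {x z : Site d} {k : ℕ} :
    x ∈ Metric.closedBall z (k : ℝ) ↔ x - z ∈ cube d k := by
  rw [Metric.mem_closedBall, dist_pi_le_iff (Nat.cast_nonneg k), mem_cube]
  refine forall_congr' fun i => ?_
  rw [Int.dist_eq, ← abs_le, Pi.sub_apply]
  exact_mod_cast Iff.rfl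

theorem card_cube_mul_le (m k : ℕ) (hm : 1 ≤ m) :
    (cube d (m * k : ℕ)).card ≤ m ^ d * (cube d k).card := by
  have h : ((cube d (m * k : ℕ)).card : ℝ) ≤ (m : ℝ) ^ d * (cube d k).card := by
    rw [card_cube (Int.natCast_nonneg _), card_cube (Int.natCast_nonneg _), ← mul_pow]
    refine pow_le_pow_left₀ (by positivity) ?_ d
    push_cast
    have : (1 : ℝ) ≤ m := by exact_mod_cast hm
    linarith
  exact_mod_cast h

/-- The covering argument behind the maximal inequality. -/
theorem mul_card_filter_le (F : Site d → ℝ≥0∞) (a : ℝ≥0∞) (L N : ℕ) (Z : Finset (Site d))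
    (hZL : Z ⊆ cube d L)
    (hZ : ∀ z ∈ Z, ∃ k : ℕ, k ≤ N ∧ a * (cube d k).card ≤ ∑ x ∈ cube d k, F (x + z)) :
    a * Z.card ≤ 4 ^ d * ∑ y ∈ cube d (L + N : ℕ), F y := by
  classical
  choose! k hkN hk using hZ
  -- The enlargement factor 4 is any integer above Vitali's 3; it costs `4 ^ d` in cardinality.
  obtain ⟨u, huZ, hdisj, hcov⟩ := Vitali.exists_disjoint_subfamily_covering_enlargement_closedBall
    (Z : Set (Site d)) (fun z => z) (fun z => (k z : ℝ)) (N : ℝ)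
    (fun z hz => by exact_mod_cast hkN z hz) 4 (by norm_num)
  set U := Z.filter (· ∈ u) with hU
  have hUu : ∀ z, z ∈ U ↔ z ∈ u := fun z => by
    rw [hU, Finset.mem_filter]
    exact ⟨fun h => h.2, fun h => ⟨huZ h, h⟩⟩
  have hcard : Z.card ≤ ∑ z ∈ U, 4 ^ d * (cube d (k z)).card := by
    have hsub : Z ⊆ U.biUnion fun z => (cube d (4 * k z : ℕ)).map (addRightEmbedding z) := by
      intro y hy
      obtain ⟨b, hb, hyb⟩ := hcov y hy
      have hy1 : y ∈ Metric.closedBall b ((4 * k b : ℕ) : ℝ) := by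
        push_cast
        exact hyb (Metric.mem_closedBall_self (Nat.cast_nonneg _))
      rw [Finset.mem_biUnion]
      refine ⟨b, (hUu b).2 hb, ?_⟩
      rw [Finset.mem_map]
      exact ⟨y - b, mem_closedBall_iff_sub_mem_cube.1 hy1, by simp⟩
    refine (Finset.card_le_card hsub).trans (Finset.card_biUnion_le.trans ?_)
    refine Finset.sum_le_sum fun z _ => ?_
    rw [Finset.card_map]
    exact card_cube_mul_le 4 _ (by norm_num)
  have hdisj' : (U : Set (Site d)).PairwiseDisjoint
      fun z => (cube d (k z)).map (addRightEmbedding z) := by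
    intro z hz w hw hzw
    have h1 := hdisj ((hUu z).1 hz) ((hUu w).1 hw) hzw
    refine Finset.disjoint_left.2 fun y hy hy' => Set.disjoint_left.1 h1 (?_ : y ∈ _) ?_
    · obtain ⟨x, hx, rfl⟩ := Finset.mem_map.1 hy
      exact mem_closedBall_iff_sub_mem_cube.2 (by simpa using hx)
    · obtain ⟨x, hx, rfl⟩ := Finset.mem_map.1 hy'
      exact mem_closedBall_iff_sub_mem_cube.2 (by simpa using hx)
  calc a * Z.card ≤ a * ((∑ z ∈ U, 4 ^ d * (cube d (k z)).card : ℕ) : ℝ≥0∞) := by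
        gcongr
    _ = 4 ^ d * ∑ z ∈ U, a * (cube d (k z)).card := by
        push_cast
        rw [Finset.mul_sum, Finset.mul_sum]
        exact Finset.sum_congr rfl fun z _ => by ring
    _ ≤ 4 ^ d * ∑ z ∈ U, ∑ x ∈ cube d (k z), F (x + z) := by
        gcongr with z hz
        exact hk z (huZ ((hUu z).1 hz))
    _ = 4 ^ d * ∑ y ∈ U.biUnion fun z => (cube d (k z)).map (addRightEmbedding z), F y := by
        rw [Finset.sum_biUnion hdisj']
        simp only [Finset.sum_map, addRightEmbedding_apply]
    _ ≤ _ := by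
        gcongr
        intro y hy
        rw [Finset.mem_biUnion] at hy
        obtain ⟨z, hz, hy⟩ := hy
        obtain ⟨x, hx, rfl⟩ := Finset.mem_map.1 hy
        have hzZ := huZ ((hUu z).1 hz)
        have h1 := mem_cube.1 (hZL hzZ)
        have h2 := mem_cube.1 hx
        have h3 := hkN z hzZ
        rw [mem_cube]
        intro i
        have h4 := h1 i
        have h5 := h2 i
        simp only [addRightEmbedding_apply, Pi.add_apply]
        omega

theorem measurable_muTilde {Ω : Type*} [MeasurableSpace Ω] {C : Site d → Site d → Ω → ℝ} (hC : ∀ x y, Measurable (C x y)) :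
    Measurable (muTilde C) :=
  Measurable.tsum fun z => ((hC 0 z).const_mul _).ennreal_ofReal

theorem measurable_nuTilde {Ω : Type*} [MeasurableSpace Ω] {C : Site d → Site d → Ω → ℝ} (hC : ∀ x y, Measurable (C x y)) :
    Measurable (nuTilde C) :=
  Measurable.tsum fun z => (hC 0 z.1).ennreal_ofReal.inv

section MaximalInequality

variable {Ω : Type*} [MeasurableSpace Ω] {P : Measure Ω} [AddAction (Site d) Ω]
  [MeasurableConstVAdd (Site d) Ω] [VAddInvariantMeasure (Site d) Ω P]

/-- The weak-type maximal inequality for averages over cubes. -/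
theorem mul_measure_exists_le {f : Ω → ℝ≥0∞} (hf : Measurable f) (a : ℝ≥0∞) :
    a * P {ω | ∃ k : ℕ, a * (cube d k).card ≤ ∑ x ∈ cube d k, f (x +ᵥ ω)} ≤
      8 ^ d * ∫⁻ ω, f ω ∂P := by
  classical
  set E : ℕ → Set Ω := fun N =>
    {ω | ∃ k : ℕ, k ≤ N ∧ a * (cube d k).card ≤ ∑ x ∈ cube d k, f (x +ᵥ ω)} with hE
  have hmeas : ∀ N, MeasurableSet (E N) := by
    intro N
    have : E N = ⋃ k ∈ Finset.range (N + 1),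
        {ω | a * (cube d k).card ≤ ∑ x ∈ cube d k, f (x +ᵥ ω)} := by
      ext ω
      simp [hE]
    rw [this]
    refine Finset.measurableSet_biUnion _ fun k _ => measurableSet_le measurable_const ?_
    exact Finset.measurable_sum _ fun x _ => hf.comp (measurable_const_vadd x)
  have hmono : Monotone E := fun N N' h ω ⟨k, hk, hω⟩ => ⟨k, hk.trans h, hω⟩
  have hU : {ω | ∃ k : ℕ, a * (cube d k).card ≤ ∑ x ∈ cube d k, f (x +ᵥ ω)} = ⋃ N, E N := by
    ext ω
    simp only [mem_ofPred_eq, mem_iUnion, hE]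
    exact ⟨fun ⟨k, h⟩ => ⟨k, k, le_rfl, h⟩, fun ⟨_, k, _, h⟩ => ⟨k, h⟩⟩
  rw [hU, hmono.measure_iUnion, ENNReal.mul_iSup]
  refine iSup_le fun N => ?_
  -- Transference: the covering estimate is applied along the orbit of `ω` and integrated by
  -- invariance. Passing from the cube `N` to the cube `2N` costs `2 ^ d`, hence `8 ^ d` in total.
  have hpt : ∀ ω, ∑ z ∈ cube d N, (E N).indicator (fun _ => a) (z +ᵥ ω) ≤
      (4 : ℝ≥0∞) ^ d * ∑ y ∈ cube d (N + N : ℕ), f (y +ᵥ ω) := by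
    intro ω
    have h1 := mul_card_filter_le (fun y => f (y +ᵥ ω)) a N N
      ((cube d N).filter fun z => z +ᵥ ω ∈ E N) (Finset.filter_subset _ _) (fun z hz => by
        obtain ⟨k, hk, h⟩ := (Finset.mem_filter.1 hz).2
        refine ⟨k, hk, h.trans (le_of_eq ?_)⟩
        exact Finset.sum_congr rfl fun x _ => by rw [vadd_vadd])
    refine le_trans (le_of_eq ?_) h1
    simp only [Set.indicator_apply]
    rw [← Finset.sum_filter, Finset.sum_const, nsmul_eq_mul, mul_comm]
  have hint := lintegral_mono (μ := P) hpt
  have hsh : ∀ {g : Ω → ℝ≥0∞}, Measurable g → ∀ x : Site d, ∫⁻ ω, g (x +ᵥ ω) ∂P = ∫⁻ ω, g ω ∂P :=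
    fun hg x => (measurePreserving_vadd x P).lintegral_comp hg
  have hind : Measurable ((E N).indicator fun _ => a) := measurable_const.indicator (hmeas N)
  have hsum : ∀ {g : Ω → ℝ≥0∞}, Measurable g → ∀ A : Finset (Site d),
      ∫⁻ ω, ∑ z ∈ A, g (z +ᵥ ω) ∂P = A.card * ∫⁻ ω, g ω ∂P := fun {g} hg A => by
    rw [lintegral_finsetSum A (f := fun z ω => g (z +ᵥ ω))
      fun z _ => hg.comp (measurable_const_vadd z)]
    simp only [hsh hg, Finset.sum_const, nsmul_eq_mul]
  rw [hsum hind, lintegral_const_mul' _ _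
    (ENNReal.pow_ne_top (by norm_num)), hsum hf,
    lintegral_indicator_const (hmeas N)] at hint
  have hc : ((cube d (N + N : ℕ)).card : ℝ≥0∞) ≤ 2 ^ d * (cube d N).card := by
    rw [← two_mul]
    exact_mod_cast card_cube_mul_le 2 N (by norm_num)
  have hc0 : ((cube d N).card : ℝ≥0∞) ≠ 0 := by
    rw [Nat.cast_ne_zero, Finset.card_ne_zero]
    exact ⟨0, mem_cube.2 fun i => by simp⟩
  refine (ENNReal.mul_le_mul_iff_right hc0 (ENNReal.natCast_ne_top _)).1 (hint.trans ?_)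
  calc 4 ^ d * (((cube d (N + N : ℕ)).card : ℝ≥0∞) * ∫⁻ ω, f ω ∂P)
      ≤ 4 ^ d * ((2 ^ d * (cube d N).card) * ∫⁻ ω, f ω ∂P) := by gcongr
    _ = (cube d N).card * ((4 * 2) ^ d * ∫⁻ ω, f ω ∂P) := by rw [mul_pow]; ring
    _ = _ := by norm_num

/-- Ergodic averages of integrable functions are almost surely bounded. -/
theorem ae_exists_sum_cube_le {f : Ω → ℝ≥0∞} (hf : Measurable f) (hfi : ∫⁻ ω, f ω ∂P ≠ ∞) :
    ∀ᵐ ω ∂P, ∃ B : ℕ, ∀ k : ℕ, ∑ x ∈ cube d k, f (x +ᵥ ω) ≤ B * (cube d k).card := by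
  rw [ae_iff]
  by_contra h
  have hfin : (8 : ℝ≥0∞) ^ d * ∫⁻ ω, f ω ∂P ≠ ∞ :=
    ENNReal.mul_ne_top (ENNReal.pow_ne_top (by norm_num)) hfi
  obtain ⟨n, hn⟩ := ENNReal.exists_nat_mul_gt h hfin
  refine absurd (mul_measure_exists_le (P := P) (d := d) hf n) (not_le.2 (hn.trans_le ?_))
  refine mul_le_mul_right (measure_mono fun ω hω => ?_) _
  simp only [mem_ofPred_eq, not_exists, not_forall, not_le] at hω ⊢
  obtain ⟨k, hk⟩ := hω n
  exact ⟨k, hk.le⟩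

theorem avgNorm_top (A : Finset (Site d)) (f : Site d → ℝ≥0∞) : avgNorm ∞ A f = ⨆ x ∈ A, f x :=
  if_pos rfl

theorem avgNorm_of_ne_top {p : ℝ≥0∞} (hp : p ≠ ∞) (A : Finset (Site d)) (f : Site d → ℝ≥0∞) :
    avgNorm p A f = ((∑ x ∈ A, f x ^ p.toReal) / (A.card : ℝ≥0∞)) ^ (1 / p.toReal) :=
  if_neg hp

theorem card_cube_le_card_ball (hd : 0 < d) {k : ℕ} (hk : 1 ≤ k) :
    ((cube d k).card : ℝ≥0∞) ≤ ENNReal.ofReal ((3 * √d) ^ d) * (ball d k).card := by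
  have hs : 0 < √(d : ℝ) := Real.sqrt_pos.2 (by exact_mod_cast hd)
  have hk' : (1 : ℝ) ≤ k := by exact_mod_cast hk
  have h : ((cube d k).card : ℝ) ≤ (3 * √d) ^ d * (ball d k).card := by
    rw [card_cube (Int.natCast_nonneg _)]
    calc (2 * ((k : ℤ) : ℝ) + 1) ^ d ≤ (3 * k) ^ d := by
          refine pow_le_pow_left₀ (by positivity) ?_ d
          push_cast
          linarith
      _ = (3 * √d) ^ d * (k / √d) ^ d := by
          rw [← mul_pow]
          congr 1
          field_simp
      _ ≤ _ := mul_le_mul_of_nonneg_left (le_card_ball hd (by positivity)) (by positivity)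
  rw [← ENNReal.ofReal_natCast, ← ENNReal.ofReal_natCast (ball d k).card,
    ← ENNReal.ofReal_mul (by positivity)]
  exact ENNReal.ofReal_le_ofReal h

/-- For `p = ∞` the essential bound holds on countably many translates at once; for finite `p` the
maximal inequality is applied to the `p`-th power. -/
theorem ae_exists_avgNorm_le [IsProbabilityMeasure P] (hd : 0 < d) {p : ℝ≥0∞} (hp : 0 < p)
    {g : Ω → ℝ≥0∞} (hg : Measurable g) (hgp : MemLp g p P) :
    ∀ᵐ ω ∂P, ∃ B : ℝ≥0∞, B ≠ ∞ ∧ ∀ k : ℕ, 1 ≤ k →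
      avgNorm p (ball d k) (fun x => max (g (x +ᵥ ω)) 1) ≤ B := by
  by_cases hpt : p = ∞
  · subst hpt
    have h1 : ∀ᵐ ω ∂P, g ω ≤ eLpNormEssSup g P := by
      simpa using ae_le_eLpNormEssSup (f := g) (μ := P)
    have hfin : eLpNormEssSup g P < ∞ := by simpa using hgp.eLpNorm_lt_top
    have h2 : ∀ x : Site d, ∀ᵐ ω ∂P, g (x +ᵥ ω) ≤ eLpNormEssSup g P := fun x =>
      (measurePreserving_vadd x P).quasiMeasurePreserving.ae h1
    filter_upwards [ae_all_iff.2 h2] with ω hω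
    refine ⟨max (eLpNormEssSup g P) 1, (max_lt hfin ENNReal.one_lt_top).ne, fun k _ => ?_⟩
    rw [avgNorm_top]
    exact iSup₂_le fun x _ => max_le_max (hω x) le_rfl
  · have hp0 : 0 < p.toReal := ENNReal.toReal_pos hp.ne' hpt
    have hf : Measurable fun ω => max (g ω) 1 ^ p.toReal :=
      (hg.max measurable_const).pow_const _
    have hfi : ∫⁻ ω, max (g ω) 1 ^ p.toReal ∂P ≠ ∞ := by
      have h1 : ∫⁻ ω, g ω ^ p.toReal ∂P < ∞ := by
        simpa using lintegral_rpow_enorm_lt_top_of_eLpNorm_lt_top hp.ne' hpt hgp.eLpNorm_lt_top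
      refine ne_top_of_le_ne_top (b := ∫⁻ ω, g ω ^ p.toReal ∂P + 1) (by simpa using h1.ne) ?_
      calc ∫⁻ ω, max (g ω) 1 ^ p.toReal ∂P ≤ ∫⁻ ω, (g ω ^ p.toReal + 1) ∂P := by
            refine lintegral_mono fun ω => ?_
            rcases le_total (g ω) 1 with h | h
            · simp [max_eq_right h]
            · simp [max_eq_left h]
        _ = _ := by
            rw [lintegral_add_right _ measurable_const]
            simp
    filter_upwards [ae_exists_sum_cube_le (d := d) hf hfi] with ω ⟨B, hB⟩
    refine ⟨(B * ENNReal.ofReal ((3 * √d) ^ d)) ^ (1 / p.toReal), ?_, fun k hk => ?_⟩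
    · exact ENNReal.rpow_ne_top_of_nonneg (by positivity)
        (ENNReal.mul_ne_top (ENNReal.natCast_ne_top _) ENNReal.ofReal_ne_top)
    · rw [avgNorm_of_ne_top hpt]
      refine ENNReal.rpow_le_rpow ?_ (by positivity)
      refine ENNReal.div_le_of_le_mul ?_
      have hsub : ball d k ⊆ cube d k := by
        have := ball_subset_cube (d := d) (k : ℝ)
        rwa [Int.floor_natCast] at this
      calc ∑ x ∈ ball d k, max (g (x +ᵥ ω)) 1 ^ p.toReal
          ≤ ∑ x ∈ cube d k, max (g (x +ᵥ ω)) 1 ^ p.toReal :=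
            Finset.sum_le_sum_of_subset hsub
        _ ≤ B * (cube d k).card := hB k
        _ ≤ B * (ENNReal.ofReal ((3 * √d) ^ d) * (ball d k).card) := by
            gcongr
            exact card_cube_le_card_ball hd hk
        _ = _ := by rw [mul_assoc]

theorem ae_M0_lt_top [IsProbabilityMeasure P] (hd : 0 < d) {p q : ℝ≥0∞} (hp : 0 < p) (hq : 0 < q)
    {C : Site d → Site d → Ω → ℝ} (hC : ∀ x y, Measurable (C x y))
    (hmu : MemLp (muTilde C) p P) (hnu : MemLp (nuTilde C) q P) :
    ∀ᵐ ω ∂P, M0 C p q ω < ∞ := by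
  filter_upwards [ae_exists_avgNorm_le hd hp (measurable_muTilde hC) hmu,
    ae_exists_avgNorm_le hd hq (measurable_nuTilde hC) hnu] with ω ⟨A, hA, hA'⟩ ⟨B, hB, hB'⟩
  refine lt_of_le_of_lt (iSup₂_le fun k hk => ?_) (ENNReal.mul_lt_top hA.lt_top hB.lt_top)
  exact mul_le_mul' (hA' k hk) (hB' k hk)

end MaximalInequality

/-! ### Exponents, real radii and conclusion. -/

theorem sum_rpow_div_card_le {P : ℝ} (hP : 0 < P) {A : Finset (Site d)} {f : Site d → ℝ≥0∞}
    {S : ℝ≥0∞} (hf : ∀ x ∈ A, f x ≤ S) : (∑ x ∈ A, f x ^ P) / (A.card : ℝ≥0∞) ≤ S ^ P := by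
  refine ENNReal.div_le_of_le_mul ?_
  rw [mul_comm, ← nsmul_eq_mul]
  exact Finset.sum_le_card_nsmul _ _ _ fun x hx => ENNReal.rpow_le_rpow (hf x hx) hP.le

/-- An exponent in `(1, ∞]` can be replaced by a finite one, at an arbitrarily small cost. -/
theorem exists_exponent {p : ℝ≥0∞} (hp : 1 < p) {ε : ℝ} (hε : 0 < ε) :
    ∃ P : ℝ, 1 < P ∧ 1 / P ≤ (1 / p).toReal + ε ∧
      ∀ (d : ℕ) (A : Finset (Site d)) (f : Site d → ℝ≥0∞),
        (∑ x ∈ A, f x ^ P) / (A.card : ℝ≥0∞) ≤ avgNorm p A f ^ P := by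
  by_cases hpt : p = ∞
  · subst hpt
    -- For this exponent `1 / P = ε / (1 + ε) ≤ ε`.
    refine ⟨1 + 1 / ε, by linarith [one_div_pos.2 hε], ?_, fun d A f => ?_⟩
    · have h : 0 < 1 / ε := one_div_pos.2 hε
      rw [div_le_iff₀ (by linarith), ENNReal.div_top, ENNReal.toReal_zero, zero_add, mul_add,
        mul_one_div_cancel hε.ne']
      linarith
    · rw [avgNorm_top]
      refine sum_rpow_div_card_le (by positivity) fun x hx => ?_
      exact le_iSup₂ (f := fun x (_ : x ∈ A) => f x) x hx
  · have h1 : 1 < p.toReal := by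
      rw [← ENNReal.toReal_one]
      exact (ENNReal.toReal_lt_toReal ENNReal.one_ne_top hpt).2 hp
    refine ⟨p.toReal, h1, ?_, fun d A f => ?_⟩
    · rw [ENNReal.toReal_div, ENNReal.toReal_one]
      linarith
    · rw [avgNorm_of_ne_top hpt, ← ENNReal.rpow_mul, one_div_mul_cancel (by linarith),
        ENNReal.rpow_one]

theorem one_le_avgNorm {p : ℝ≥0∞} (hp : 0 < p) {A : Finset (Site d)} (hA : A.Nonempty)
    {f : Site d → ℝ≥0∞} (hf : ∀ x, 1 ≤ f x) : 1 ≤ avgNorm p A f := by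
  by_cases hpt : p = ∞
  · subst hpt
    obtain ⟨x, hx⟩ := hA
    rw [avgNorm_top]
    exact (hf x).trans (le_iSup₂ (f := fun x (_ : x ∈ A) => f x) x hx)
  · rw [avgNorm_of_ne_top hpt]
    have hp0 : 0 < p.toReal := ENNReal.toReal_pos hp.ne' hpt
    refine ENNReal.one_le_rpow ?_ (by positivity)
    have hA0 : (A.card : ℝ≥0∞) ≠ 0 := by exact_mod_cast hA.card_pos.ne'
    rw [ENNReal.le_div_iff_mul_le (Or.inl hA0) (Or.inl (ENNReal.natCast_ne_top _)), one_mul]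
    calc (A.card : ℝ≥0∞) = ∑ x ∈ A, 1 := by simp
      _ ≤ _ := Finset.sum_le_sum fun x _ => ENNReal.one_le_rpow (hf x) hp0

theorem avg_toReal_rpow_le {A : Finset (Site d)} (hA : 0 < A.card) {P S : ℝ} (hP : 0 < P)
    (hS : 0 ≤ S) {g : Site d → ℝ≥0∞}
    (h : (∑ x ∈ A, g x ^ P) / (A.card : ℝ≥0∞) ≤ ENNReal.ofReal S ^ P) :
    (∀ x ∈ A, g x ≠ ∞) ∧ avg (fun x : A => (g x).toReal ^ P) ≤ S ^ P := by
  have hA0 : (A.card : ℝ≥0∞) ≠ 0 := by exact_mod_cast hA.ne'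
  have hA' : (0 : ℝ) < A.card := by exact_mod_cast hA
  rw [ENNReal.div_le_iff hA0 (ENNReal.natCast_ne_top _),
    ENNReal.ofReal_rpow_of_nonneg hS hP.le] at h
  have hfin : ∀ x ∈ A, g x ^ P ≠ ∞ := ENNReal.sum_ne_top.1 (ne_top_of_le_ne_top
    (ENNReal.mul_ne_top ENNReal.ofReal_ne_top (ENNReal.natCast_ne_top _)) h)
  refine ⟨fun x hx hx' => hfin x hx (by rw [hx', ENNReal.top_rpow_of_pos hP]), ?_⟩
  rw [avg_coe fun x => (g x).toReal ^ P, div_le_iff₀ hA']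
  have h2 := ENNReal.toReal_mono
    (ENNReal.mul_ne_top ENNReal.ofReal_ne_top (ENNReal.natCast_ne_top _)) h
  rw [ENNReal.toReal_sum hfin, ENNReal.toReal_mul, ENNReal.toReal_ofReal (by positivity),
    ENNReal.toReal_natCast] at h2
  simpa only [← ENNReal.toReal_rpow] using h2

theorem card_ball_ceil_le (hd : 0 < d) {r : ℝ} (hr : 1 ≤ r) :
    ((ball d (⌈r⌉₊ : ℝ)).card : ℝ) ≤ (6 * √d) ^ d * (ball d r).card := by
  have hs : 0 < √(d : ℝ) := Real.sqrt_pos.2 (by exact_mod_cast hd)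
  have h1 : (⌈r⌉₊ : ℝ) ≤ 2 * r := by
    have := Nat.ceil_lt_add_one (show 0 ≤ r by linarith)
    linarith
  calc ((ball d (⌈r⌉₊ : ℝ)).card : ℝ) ≤ (ball d (2 * r)).card := by
        exact_mod_cast Finset.card_le_card (ball_mono h1)
    _ ≤ (3 * (2 * r)) ^ d := card_ball_le (by linarith)
    _ = (6 * √d) ^ d * (r / √d) ^ d := by
        rw [← mul_pow]
        congr 1
        field_simp
        norm_num
    _ ≤ _ := mul_le_mul_of_nonneg_left (le_card_ball hd (by linarith)) (by positivity)

/-- Passing from a ball of integer radius to a ball of real radius. -/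
theorem avg_ball_le_of_avgNorm_le (hd : 0 < d) {r : ℝ} (hr : 1 ≤ r) {p : ℝ≥0∞} {P M : ℝ}
    (hP : 1 < P) (hM : 0 ≤ M)
    (hpP : ∀ (A : Finset (Site d)) (f : Site d → ℝ≥0∞),
      (∑ x ∈ A, f x ^ P) / (A.card : ℝ≥0∞) ≤ avgNorm p A f ^ P)
    {g : Site d → ℝ≥0∞}
    (h : avgNorm p (ball d (⌈r⌉₊ : ℝ)) (fun x => max (g x) 1) ≤ ENNReal.ofReal M) :
    (∀ x ∈ ball d r, g x ≠ ∞) ∧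
      avg (fun x : ball d r => (g x).toReal ^ P) ≤ ((6 * √d) ^ d * M) ^ P := by
  have hd1 : 1 ≤ √(d : ℝ) := by
    rw [Real.one_le_sqrt]
    exact_mod_cast hd
  set V : ℝ := (6 * √d) ^ d with hV
  have hV1 : 1 ≤ V := one_le_pow₀ (by linarith)
  refine avg_toReal_rpow_le (card_ball_pos (by linarith)) (by linarith) (by positivity) ?_
  have hn0 : ((ball d r).card : ℝ≥0∞) ≠ 0 := by
    exact_mod_cast (card_ball_pos (d := d) (r := r) (by linarith)).ne'
  have hk0 : ((ball d (⌈r⌉₊ : ℝ)).card : ℝ≥0∞) ≠ 0 := by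
    exact_mod_cast (card_ball_pos (d := d) (r := (⌈r⌉₊ : ℝ)) (by positivity)).ne'
  have h1 := (hpP (ball d (⌈r⌉₊ : ℝ)) fun x => max (g x) 1).trans
    (ENNReal.rpow_le_rpow h (by linarith))
  rw [ENNReal.div_le_iff hk0 (ENNReal.natCast_ne_top _)] at h1
  rw [ENNReal.div_le_iff hn0 (ENNReal.natCast_ne_top _)]
  have hcard : ((ball d (⌈r⌉₊ : ℝ)).card : ℝ≥0∞) ≤ ENNReal.ofReal V * (ball d r).card := by
    rw [← ENNReal.ofReal_natCast, ← ENNReal.ofReal_natCast (ball d r).card,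
      ← ENNReal.ofReal_mul (by positivity)]
    exact ENNReal.ofReal_le_ofReal (card_ball_ceil_le hd hr)
  have hVP : ENNReal.ofReal V ≤ ENNReal.ofReal V ^ P := by
    have : (1 : ℝ≥0∞) ≤ ENNReal.ofReal V := by simpa using hV1
    calc ENNReal.ofReal V = ENNReal.ofReal V ^ (1 : ℝ) := (ENNReal.rpow_one _).symm
      _ ≤ _ := ENNReal.rpow_le_rpow_of_exponent_le this hP.le
  calc ∑ x ∈ ball d r, g x ^ P ≤ ∑ x ∈ ball d (⌈r⌉₊ : ℝ), max (g x) 1 ^ P :=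
        (Finset.sum_le_sum fun x _ => ENNReal.rpow_le_rpow (le_max_left _ _) (by linarith)).trans
          (Finset.sum_le_sum_of_subset (ball_mono (Nat.le_ceil r)))
    _ ≤ ENNReal.ofReal M ^ P * (ball d (⌈r⌉₊ : ℝ)).card := h1
    _ ≤ ENNReal.ofReal M ^ P * (ENNReal.ofReal V ^ P * (ball d r).card) := by
        gcongr
        exact hcard.trans (by gcongr)
    _ = ENNReal.ofReal (V * M) ^ P * (ball d r).card := by
        rw [ENNReal.ofReal_mul (by positivity), ENNReal.mul_rpow_of_nonneg _ _ (by linarith)]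
        ring

section Environment

variable {Ω : Type*} [AddAction (Site d) Ω]

theorem muTilde_vadd {C : Site d → Site d → Ω → ℝ}
    (hC : ∀ x y z ω, C (x + z) (y + z) ω = C x y (z +ᵥ ω)) (x : Site d) (ω : Ω) :
    muTilde C (x +ᵥ ω) = muAt (fun x y => C x y ω) x := by
  rw [muTilde, muAt, ← (Equiv.addRight x).tsum_eq fun y =>
    ENNReal.ofReal (euclid (y - x) ^ 2 * C x y ω)]
  refine tsum_congr fun z => ?_
  rw [← hC, zero_add, Equiv.coe_addRight, add_sub_cancel_right]

theorem nuTilde_vadd {C : Site d → Site d → Ω → ℝ}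
    (hC : ∀ x y z ω, C (x + z) (y + z) ω = C x y (z +ᵥ ω)) (x : Site d) (ω : Ω) :
    nuTilde C (x +ᵥ ω) = nuAt (fun x y => C x y ω) x := by
  rw [nuTilde, nuAt, ← Finset.tsum_subtype (units d) fun z => (ENNReal.ofReal (C x (x + z) ω))⁻¹]
  rw [← (Equiv.subtypeEquivRight fun z : Site d => mem_units.symm).tsum_eq]
  refine tsum_congr fun z => ?_
  rw [← hC, zero_add, add_comm (z : Site d) x]
  rfl

/-- Because of the maximum with 1 both factors in `M0` are at least 1, so each is bounded by their
product. -/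
theorem avgNorm_le_of_M0_le {C : Site d → Site d → Ω → ℝ}
    (hC : ∀ x y z ω, C (x + z) (y + z) ω = C x y (z +ᵥ ω)) {p q : ℝ≥0∞} (hp : 0 < p) (hq : 0 < q)
    (ω : Ω) {k : ℕ} (hk : 1 ≤ k) :
    avgNorm p (ball d k) (fun x => max (muAt (fun x y => C x y ω) x) 1) ≤ M0 C p q ω ∧
      avgNorm q (ball d k) (fun x => max (nuAt (fun x y => C x y ω) x) 1) ≤ M0 C p q ω := by
  have hne : (ball d (k : ℝ)).Nonempty := Finset.card_pos.1 (card_ball_pos (by positivity))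
  have h : avgNorm p (ball d k) (fun x => max (muTilde C (x +ᵥ ω)) 1) *
      avgNorm q (ball d k) (fun x => max (nuTilde C (x +ᵥ ω)) 1) ≤ M0 C p q ω :=
    le_iSup₂ (f := fun (k : ℕ) (_ : 1 ≤ k) =>
      avgNorm p (ball d k) (fun x => max (muTilde C (x +ᵥ ω)) 1) *
        avgNorm q (ball d k) (fun x => max (nuTilde C (x +ᵥ ω)) 1)) k hk
  simp only [muTilde_vadd hC, nuTilde_vadd hC] at h
  exact ⟨(le_mul_of_one_le_right' (one_le_avgNorm hq hne fun x => le_max_right _ _)).trans h,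
    (le_mul_of_one_le_left' (one_le_avgNorm hp hne fun x => le_max_right _ _)).trans h⟩

end Environment

/-- Integration in time and the passage to the infimum. -/
theorem lintegral_div_le {r t₀ K : ℝ} (hr : 0 < r) (hK : 0 < K) {u : ℝ → Site d → ℝ} {b : ℝ≥0∞}
    (h : ∀ s ∈ Icc (t₀ - 2 * r ^ 2) (t₀ - r ^ 2), ∀ t ∈ Icc (t₀ + r ^ 2) (t₀ + 2 * r ^ 2),
      ∀ x ∈ ball d r, (∑ y ∈ ball d r, ENNReal.ofReal (u s y)) / ((ball d r).card : ℝ≥0∞) ≤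
        (K.toNNReal : ℝ≥0∞) * ENNReal.ofReal (u t x) + b) :
    (∫⁻ t in Icc (t₀ - 2 * r ^ 2) (t₀ - r ^ 2), ∑ x ∈ ball d r, ENNReal.ofReal (u t x)) /
        (ENNReal.ofReal (r ^ 2) * ((ball d r).card : ℝ≥0∞)) ≤
      (K.toNNReal : ℝ≥0∞) * (⨅ t ∈ Icc (t₀ + r ^ 2) (t₀ + 2 * r ^ 2), ⨅ x ∈ ball d r,
        ENNReal.ofReal (u t x)) + b := by
  have hK0 : (K.toNNReal : ℝ≥0∞) ≠ 0 := by simpa using hK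
  have hn0 : ((ball d r).card : ℝ≥0∞) ≠ 0 := by
    exact_mod_cast (card_ball_pos (d := d) hr.le).ne'
  set I := ⨅ t ∈ Icc (t₀ + r ^ 2) (t₀ + 2 * r ^ 2), ⨅ x ∈ ball d r, ENNReal.ofReal (u t x)
  have h1 : ∀ s ∈ Icc (t₀ - 2 * r ^ 2) (t₀ - r ^ 2), ∑ y ∈ ball d r, ENNReal.ofReal (u s y) ≤
      ((K.toNNReal : ℝ≥0∞) * I + b) * (ball d r).card := by
    intro s hs
    rw [← ENNReal.div_le_iff hn0 (ENNReal.natCast_ne_top _), ← tsub_le_iff_right, mul_comm,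
      ← ENNReal.div_le_iff hK0 ENNReal.coe_ne_top]
    refine le_iInf₂ fun t ht => le_iInf₂ fun x hx => ?_
    rw [ENNReal.div_le_iff hK0 ENNReal.coe_ne_top, mul_comm, tsub_le_iff_right]
    exact h s hs t ht x hx
  refine ENNReal.div_le_of_le_mul ?_
  refine (setLIntegral_mono' measurableSet_Icc h1).trans (le_of_eq ?_)
  rw [setLIntegral_const, Real.volume_Icc]
  have : t₀ - r ^ 2 - (t₀ - 2 * r ^ 2) = r ^ 2 := by ring
  rw [this]
  ring

/-- The two-time inequality holds for every `s` in the early and `t` in the late window, as `t - s`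
lies between `2 * r ^ 2` and `4 * r ^ 2`; the source is bounded by the supremum of the tail norms.
-/
theorem weakHarnack_of_isConductance (hd : 2 ≤ d) {p : ℝ≥0∞} {P Q : ℝ} (hP : 1 < P) (hQ : 1 < Q)
    (hPQ : 1 / P + 1 / Q < 2 / d)
    (hpP : ∀ (A : Finset (Site d)) (f : Site d → ℝ≥0∞),
      (∑ x ∈ A, f x ^ P) / (A.card : ℝ≥0∞) ≤ avgNorm p A f ^ P) {M : ℝ} (hM : 0 ≤ M) :
    ∃ K : ℝ, 0 < K ∧ ∀ (c : Site d → Site d → ℝ), IsConductance c → ∀ r R : ℝ, 2 ≤ r → r < R / 4 →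
      (∀ x ∈ ball d (2 * r), muAt c x ≠ ∞) → (∀ x ∈ ball d (2 * r), nuAt c x ≠ ∞) →
      avg (fun x : ball d (2 * r) => (muAt c x).toReal ^ P) ≤ M ^ P →
      avg (fun x : ball d (2 * r) => (nuAt c x).toReal ^ Q) ≤ M ^ Q →
      ∀ u : ℝ → Site d → ℝ,
        (∀ t ∈ Icc (-2 * R ^ 2) (2 * R ^ 2), ∀ x ∈ ball d R, 0 ≤ u t x) →
        IsCaloricOn c u (Icc (-2 * R ^ 2) (2 * R ^ 2)) (ball d R) →
        ∀ t₀ : ℝ, Icc (t₀ - 4 * r ^ 2) (t₀ + 4 * r ^ 2) ⊆ Icc (-R ^ 2) (R ^ 2) →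
          (∫⁻ t in Icc (t₀ - 2 * r ^ 2) (t₀ - r ^ 2), ∑ x ∈ ball d r, ENNReal.ofReal (u t x)) /
              (ENNReal.ofReal (r ^ 2) * ((ball d r).card : ℝ≥0∞)) ≤
            (K.toNNReal : ℝ≥0∞) * (⨅ t ∈ Icc (t₀ + r ^ 2) (t₀ + 2 * r ^ 2), ⨅ x ∈ ball d r,
              ENNReal.ofReal (u t x)) +
            (K.toNNReal : ℝ≥0∞) * ENNReal.ofReal ((r / R) ^ 2) *
              (⨆ t ∈ Icc (t₀ - 4 * r ^ 2) (t₀ + 4 * r ^ 2),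
                avgNorm p (ball d (2 * r)) (tailNeg c (u t) R)) := by
  obtain ⟨K, hK0, hK⟩ := exists_sum_le_of_isCaloricOn hd hP hQ hPQ hM
  refine ⟨K, hK0, ?_⟩
  intro c hc r R hr hrR hmu hnu hmuM hnuM u hu0 hu t₀ ht₀
  have hr0 : 0 < r := by linarith
  have hR0 : 0 < R := by linarith
  refine lintegral_div_le hr0 hK0 fun s hs t ht x hx => ?_
  set N := ⨆ t ∈ Icc (t₀ - 4 * r ^ 2) (t₀ + 4 * r ^ 2),
    avgNorm p (ball d (2 * r)) (tailNeg c (u t) R) with hN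
  have hr2 : 0 < r ^ 2 := by positivity
  have hR2 : 0 < R ^ 2 := by positivity
  by_cases hNt : N = ∞
  · rw [hNt, ENNReal.mul_top, add_top]
    · exact le_top
    · refine mul_ne_zero (by simpa using hK0) ?_
      rw [← pos_iff_ne_zero, ENNReal.ofReal_pos]
      positivity
  have hsub : Icc s t ⊆ Icc (t₀ - 4 * r ^ 2) (t₀ + 4 * r ^ 2) :=
    Icc_subset_Icc (by linarith [hs.1]) (by linarith [ht.2])
  have hsubR : Icc (-R ^ 2) (R ^ 2) ⊆ Icc (-2 * R ^ 2) (2 * R ^ 2) :=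
    Icc_subset_Icc (by linarith) (by linarith)
  have hI : Icc s t ⊆ Icc (-2 * R ^ 2) (2 * R ^ 2) := hsub.trans (ht₀.trans hsubR)
  have hst : s ≤ t := by linarith [hs.2, ht.1]
  have hball : ball d r ⊆ ball d R := ball_mono (by linarith)
  have main := hK c hc r R hr (by linarith) hmu hnu hmuM hnuM u _ hu hu0 s t hI
    (by linarith [hs.2, ht.1]) (by linarith [hs.1, ht.2]) N.toReal ENNReal.toReal_nonneg
    (fun σ hσ => (avg_toReal_rpow_le (card_ball_pos (by linarith)) (by linarith)
      ENNReal.toReal_nonneg ((hpP _ _).trans (ENNReal.rpow_le_rpow ?_ (by linarith)))).2) x hx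
  · have hsum : ∑ y ∈ ball d r, ENNReal.ofReal (u s y) =
        ENNReal.ofReal (∑ y ∈ ball d r, u s y) :=
      (ENNReal.ofReal_sum_of_nonneg fun y hy => hu0 s (hI ⟨le_rfl, hst⟩) y (hball hy)).symm
    have hut : 0 ≤ u t x := hu0 t (hI ⟨hst, le_rfl⟩) x (hball hx)
    have hn0 : (0 : ℝ) < (ball d r).card := by exact_mod_cast card_ball_pos hr0.le
    calc (∑ y ∈ ball d r, ENNReal.ofReal (u s y)) / ((ball d r).card : ℝ≥0∞)
        = ENNReal.ofReal ((∑ y ∈ ball d r, u s y) / (ball d r).card) := by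
          rw [hsum, ENNReal.ofReal_div_of_pos hn0, ENNReal.ofReal_natCast]
      _ ≤ ENNReal.ofReal (K * (u t x + (r / R) ^ 2 * N.toReal)) := ENNReal.ofReal_le_ofReal main
      _ = ENNReal.ofReal K * (ENNReal.ofReal (u t x) + ENNReal.ofReal ((r / R) ^ 2) * N) := by
          rw [ENNReal.ofReal_mul hK0.le, ENNReal.ofReal_add hut (by positivity),
            ENNReal.ofReal_mul (by positivity), ENNReal.ofReal_toReal hNt]
      _ = _ := by
          rw [mul_add, mul_assoc]
          rfl
  · rw [ENNReal.ofReal_toReal hNt]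
    exact le_iSup₂ (f := fun t (_ : t ∈ Icc (t₀ - 4 * r ^ 2) (t₀ + 4 * r ^ 2)) =>
      avgNorm p (ball d (2 * r)) (tailNeg c (u t) R)) σ (hsub hσ)

/-- Since `p - 1 ≤ p`, replacing `1 / (p - 1)` by `1 / p` only lowers the left side. -/
theorem inv_toReal_add_lt {d : ℕ} (hd : 2 ≤ d) {p q : ℝ≥0∞} (hp : 1 < p) (hq : 1 < q)
    (hpq : 1 / (p - 1) + 1 / q < 2 / (d : ℝ≥0∞)) :
    (1 / p).toReal + (1 / q).toReal < 2 / d := by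
  have h1 : 1 / p + 1 / q < 2 / (d : ℝ≥0∞) := by
    refine lt_of_le_of_lt ?_ hpq
    gcongr
    exact tsub_le_self
  have hfin : ∀ {a : ℝ≥0∞}, 1 < a → 1 / a ≠ ∞ := fun {a} ha => by
    rw [one_div]
    exact ENNReal.inv_ne_top.2 (zero_lt_one.trans ha).ne'
  have hd0 : (d : ℝ≥0∞) ≠ 0 := by exact_mod_cast (by omega : d ≠ 0)
  rw [← ENNReal.toReal_add (hfin hp) (hfin hq)]
  have h2 := (ENNReal.toReal_lt_toReal h1.ne_top
    (ENNReal.div_ne_top (by norm_num) hd0)).2 h1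
  simpa using h2

end LRRW

end

theorem theorem4 (d : ℕ) (hd : 2 ≤ d) (p q : ℝ≥0∞) (hp : 1 < p) (hq : 1 < q)
    (hpq₁ : (1 - 1 / (d : ℝ≥0∞)) * (1 / p) + 1 / q ≤ 1 / (d : ℝ≥0∞))
    (hpq₂ : 1 / (p - 1) + 1 / q < 2 / (d : ℝ≥0∞)) :
    ∃ K : ℝ≥0 → ℝ≥0, (∀ M, 0 < K M) ∧
      ∀ (Ω : Type*) [MeasurableSpace Ω] (P : Measure Ω) [IsProbabilityMeasure P]
        [AddAction (LRRW.Site d) Ω] [MeasurableConstVAdd (LRRW.Site d) Ω]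
        [ErgodicVAdd (LRRW.Site d) Ω P]
        (C : LRRW.Site d → LRRW.Site d → Ω → ℝ),
        LRRW.IsRandomConductance P C →
        MemLp (LRRW.muTilde C) p P → MemLp (LRRW.nuTilde C) q P →
        ∀ᵐ ω ∂P, LRRW.M0 C p q ω < ∞ ∧
          ∀ (R : ℝ) (u : ℝ → LRRW.Site d → ℝ), 2 ≤ R →
            (∀ t ∈ Icc (-2 * R ^ 2) (2 * R ^ 2), ∀ x ∈ LRRW.ball d R, 0 ≤ u t x) →
            LRRW.IsCaloricOn (fun x y => C x y ω) u (Icc (-2 * R ^ 2) (2 * R ^ 2))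
              (LRRW.ball d R) →
            ∀ (r t₀ : ℝ), 2 ≤ r → r < R / 4 →
              Icc (t₀ - 4 * r ^ 2) (t₀ + 4 * r ^ 2) ⊆ Icc (-R ^ 2) (R ^ 2) →
              (∫⁻ t in Icc (t₀ - 2 * r ^ 2) (t₀ - r ^ 2),
                  ∑ x ∈ LRRW.ball d r, ENNReal.ofReal (u t x)) /
                  (ENNReal.ofReal (r ^ 2) * ((LRRW.ball d r).card : ℝ≥0∞))
                ≤ (K (LRRW.M0 C p q ω).toNNReal : ℝ≥0∞) *
                    (⨅ t ∈ Icc (t₀ + r ^ 2) (t₀ + 2 * r ^ 2), ⨅ x ∈ LRRW.ball d r,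
                      ENNReal.ofReal (u t x)) +
                  (K (LRRW.M0 C p q ω).toNNReal : ℝ≥0∞) * ENNReal.ofReal ((r / R) ^ 2) *
                    (⨆ t ∈ Icc (t₀ - 4 * r ^ 2) (t₀ + 4 * r ^ 2),
                      LRRW.avgNorm p (LRRW.ball d (2 * r))
                        (LRRW.tailNeg (fun x y => C x y ω) (u t) R)) := by
  classical
  have hd0 : (0 : ℝ) < d := by exact_mod_cast (by omega : 0 < d)
  have hp0 : 0 < p := zero_lt_one.trans hp
  have hq0 : 0 < q := zero_lt_one.trans hq
  have hpq := LRRW.inv_toReal_add_lt hd hp hq hpq₂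
  -- A third of the slack: making both exponents finite costs at most `2 * ε`.
  set ε := (2 / d - ((1 / p).toReal + (1 / q).toReal)) / 3 with hε
  have hε0 : 0 < ε := by rw [hε]; linarith
  obtain ⟨P', hP1, hPε, hPp⟩ := LRRW.exists_exponent hp hε0
  obtain ⟨Q', hQ1, hQε, hQq⟩ := LRRW.exists_exponent hq hε0
  have hPQ : 1 / P' + 1 / Q' < 2 / d := by
    have : 3 * ε = 2 / d - ((1 / p).toReal + (1 / q).toReal) := by rw [hε]; ring
    linarith
  -- The factor `(6 * √d) ^ d` absorbs the passage from integer radii to the radius `2 * r`.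
  have hK : ∀ M : ℝ≥0, ∃ K : ℝ, 0 < K ∧ _ := fun M =>
    LRRW.weakHarnack_of_isConductance hd hP1 hQ1 hPQ (hPp d) (M := (6 * √d) ^ d * M)
      (by positivity)
  choose K hK0 hK using hK
  refine ⟨fun M => (K M).toNNReal, fun M => Real.toNNReal_pos.2 (hK0 M), ?_⟩
  intro Ω _ P _ _ _ _ C hC hmu hnu
  filter_upwards [LRRW.ae_M0_lt_top (by omega) hp0 hq0 hC.measurable hmu hnu, hC.total]
    with ω hM htot
  refine ⟨hM, ?_⟩
  intro R u hR hu0 hu r t₀ hr hrR ht₀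
  have hc : LRRW.IsConductance fun x y => C x y ω :=
    ⟨fun x y => hC.nonneg x y ω, fun x y => hC.symm x y ω, fun x => (htot x).1⟩
  -- `M0` takes its supremum over integer radii, so `2 * r` is rounded up.
  have hk : 1 ≤ ⌈2 * r⌉₊ := Nat.one_le_ceil_iff.2 (by linarith)
  have hle := LRRW.avgNorm_le_of_M0_le hC.shift hp0 hq0 ω hk
  have hMt : LRRW.M0 C p q ω = ENNReal.ofReal ((LRRW.M0 C p q ω).toNNReal : ℝ) := by
    rw [ENNReal.ofReal_coe_nnreal, ENNReal.coe_toNNReal hM.ne]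
  obtain ⟨hmu1, hmu2⟩ := LRRW.avg_ball_le_of_avgNorm_le (by omega) (r := 2 * r) (by linarith) hP1
    (NNReal.coe_nonneg _) (hPp d) (hle.1.trans hMt.le)
  obtain ⟨hnu1, hnu2⟩ := LRRW.avg_ball_le_of_avgNorm_le (by omega) (r := 2 * r) (by linarith) hQ1
    (NNReal.coe_nonneg _) (hQq d) (hle.2.trans hMt.le)
  exact hK _ _ hc r R hr hrR hmu1 hnu1 hmu2 hnu2 u hu0 hu t₀ ht₀
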